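/- Let $\varphi:\mathbb{R}^3\to\mathbb{R}$ be a continuous function such that: (A.1) $\varphi(-x)=\varphi(x)$ for all $x$; (A.2) the Fourier transform $\widehat\varphi(k)=\int_{\mathbb{R}^3}e^{i\langle k,x\rangle}\varphi(x)\,dx$, understood in the sense of tempered distributions, is a real non-negative function; (A.3) $\int_{\mathbb{R}^3}\widehat\varphi(k)\,dk<\infty$; (A.4) $\int_{\mathbb{R}^3}(1+|k|^2)^2\,\widehat\varphi(k)\,dk<\infty$. Let $H^1_\#(0,1)$ be the space of closed curves of class $H^1$, i.e. of continuous $1$-periodic maps $\mathbb{R}\to\mathbb{R}^3$ having on $(0,1)$ a weak derivative in $L^2(0,1)$. For $\gamma\in H^1_\#(0,1)$, with weak derivative $\gamma_\xi$, put $$u[\gamma](x)=\int_0^1\nabla\varphi(x-\gamma(\xi))\wedge\gamma_\xi(\xi)\,d\xi ,\qquad x\in\mathbb{R}^3 .$$ Given $\gamma_0\in H^1_\#(0,1)$ and $T>0$, a solution on $[0,T]$ with initial datum $\gamma_0$ is a $$\gamma\in W^{1,\infty}(0,T;L^2(0,1))\cap L^\infty(0,T;H^1_\#(0,1))$$ (with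 $\gamma(t)\in H^1_\#(0,1)$ for every $t\in[0,T]$) such that $$\gamma(t,\xi)=\gamma_0(\xi)+\int_0^t u[\gamma(\tau)](\gamma(\tau,\xi))\,d\tau\qquad\text{for all } t\in[0,T],\ \xi\in\mathbb{R}.$$ **Theorem.** For every such $\varphi$ and every $\gamma_0\in H^1_\#(0,1)$ there is a unique global solution: there is $\gamma:[0,\infty)\to H^1_\#(0,1)$ which is a solution on $[0,T]$ with initial datum $\gamma_0$ for every $T>0$, which satisfies $\partial_t\gamma(t,\xi)=u[\gamma(t)](\gamma(t,\xi))$ for all $t\ge 0$ and $\xi\in\mathbb{R}$ (one-sided derivative at $t=0$), and every solution on some interval $[0,T]$, $T>0$, with initial datum $\gamma_0$ coincides with $\gamma$ on $[0,T]$. Moreover, for all $\Gamma,\mu>0$ the Rosenhead kernel $\varphi_R(x)=\Gamma\,(|x|^2+\mu^2)^{-1/2}$ is continuous and satisfies (A.1)–(A.4). -/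

import Mathlib

open MeasureTheory

noncomputable section

namespace VortexFilament

/-- The Euclidean space `ℝ³`. -/
abbrev E3 : Type := EuclideanSpace ℝ (Fin 3)

/-- The vector product of `ℝ³`. -/
def cross (a b : E3) : E3 := WithLp.toLp 2 (crossProduct a.ofLp b.ofLp)

/-! ### Kernels -/

/-- `φhat` is the Fourier transform of `φ`, with the convention
`φhat(k) = ∫ exp(i⟨k,x⟩) φ(x) dx`. As for the kernel `Γ / (|x|² + μ²)^{1/2}`, which is not
integrable, the transform is taken in the sense of tempered distributions:
`∫ φ(x) (∫ exp(i⟨k,x⟩) ψ(k) dk) dx = ∫ φhat(k) ψ(k) dk` for all Schwartz functions `ψ`.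
(For integrable `φ` the function `∫ exp(i⟨k,x⟩) φ(x) dx` satisfies this, by Fubini.) -/
structure IsFourierTransform (φ φhat : E3 → ℝ) : Prop where
  integrable_left : ∀ ψ : SchwartzMap E3 ℂ, Integrable (fun x => (φ x : ℂ) * ψ x)
  integrable_right : ∀ ψ : SchwartzMap E3 ℂ, Integrable (fun k => (φhat k : ℂ) * ψ k)
  pairing : ∀ ψ : SchwartzMap E3 ℂ,
    ∫ x : E3, (φ x : ℂ) * ∫ k : E3, Complex.exp (Complex.I * (inner ℝ k x : ℝ)) * ψ k =
      ∫ k : E3, (φhat k : ℂ) * ψ k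

/-- The hypotheses (A.1)-(A.4) on the kernel `φ`. -/
def HypothesisA (φ : E3 → ℝ) : Prop :=
  Continuous φ ∧ (∀ x, φ (-x) = φ x) ∧
    ∃ φhat : E3 → ℝ, IsFourierTransform φ φhat ∧ (∀ k, 0 ≤ φhat k) ∧ Integrable φhat ∧
      Integrable (fun k : E3 => (1 + ‖k‖ ^ 2) ^ 2 * φhat k)

/-- The Rosenhead kernel `φ_R(x) = Γ / (|x|² + μ²)^{1/2}`. -/
def rosenheadKernel (Γ μ : ℝ) (x : E3) : ℝ := Γ / √(‖x‖ ^ 2 + μ ^ 2)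

/-! ### Closed curves of class `H¹` -/

/-- Lebesgue measure on the interval `(0,1)`. -/
def unitMeasure : Measure ℝ := volume.restrict (Set.Ioo 0 1)

/-- `g ∈ L²(0,1)` is a weak (distributional) derivative of `γ` on `(0,1)`. -/
structure IsWeakDeriv (γ g : ℝ → E3) : Prop where
  memLp : MemLp g 2 unitMeasure
  integral_eq : ∀ θ : ℝ → ℝ, ContDiff ℝ (⊤ : ℕ∞) θ → HasCompactSupport θ →
    tsupport θ ⊆ Set.Ioo 0 1 →
    ∫ ξ, deriv θ ξ • γ ξ ∂unitMeasure = -∫ ξ, θ ξ • g ξ ∂unitMeasure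

/-- The space `H¹_#(0,1)` of closed curves: continuous `1`-periodic maps `ℝ → ℝ³` with a weak
derivative in `L²(0,1)` (elements of `H¹(0,1)` are identified with their continuous
representatives). -/
structure MemH1Closed (γ : ℝ → E3) : Prop where
  continuous : Continuous γ
  periodic : Function.Periodic γ 1
  exists_weakDeriv : ∃ g, IsWeakDeriv γ g

open Classical in
/-- The weak derivative `γ_ξ` (determined almost everywhere on `(0,1)`; `0` if there is none). -/
def weakDeriv (γ : ℝ → E3) : ℝ → E3 :=
  if h : ∃ g, IsWeakDeriv γ g then h.choose else 0

/-! ### The evolution problem -/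

/-- The velocity `u(x) = ∫₀¹ ∇φ(x - γ(ξ)) ∧ γ_ξ(ξ) dξ` generated by the curve `γ`. -/
def velocity (φ : E3 → ℝ) (γ : ℝ → E3) (x : E3) : E3 :=
  ∫ ξ, cross (gradient φ (x - γ ξ)) (weakDeriv γ ξ) ∂unitMeasure

/-- `γ = γ(t, ξ)` solves the evolution problem `∂_t γ = u(γ)`, `γ(0) = γ₀` on `[0,T]`, in the class
`W^{1,∞}(0,T; L²(0,1)) ∩ L^∞(0,T; H¹_#(0,1))`. Membership in `W^{1,∞}(0,T; L²)` is Lipschitz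
continuity in time with values in `L²`. -/
structure IsSolutionOn (φ : E3 → ℝ) (γ₀ : ℝ → E3) (T : ℝ) (γ : ℝ → ℝ → E3) : Prop where
  memH1 : ∀ t ∈ Set.Icc 0 T, MemH1Closed (γ t)
  lipschitz : ∃ K : ℝ, ∀ s ∈ Set.Icc 0 T, ∀ t ∈ Set.Icc 0 T,
    eLpNorm (fun ξ => γ t ξ - γ s ξ) 2 unitMeasure ≤ ENNReal.ofReal (K * |t - s|)
  bounded : ∃ M : ℝ, ∀ t ∈ Set.Icc 0 T,
    eLpNorm (γ t) 2 unitMeasure + eLpNorm (weakDeriv (γ t)) 2 unitMeasure ≤ ENNReal.ofReal M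
  integrable : ∀ t ∈ Set.Icc 0 T, ∀ ξ,
    IntervalIntegrable (fun τ => velocity φ (γ τ) (γ τ ξ)) volume 0 t
  equation : ∀ t ∈ Set.Icc 0 T, ∀ ξ,
    γ t ξ = γ₀ ξ + ∫ τ in (0 : ℝ)..t, velocity φ (γ τ) (γ τ ξ)

end VortexFilament

end

/-! Since `φ` has a non-negative Fourier transform, it is the cosine transform of a finite positive
measure `ν`, with finite fourth moment by (A.4) (`HypothesisA.exists_isSpectralMeasure`). Hence `∇φ`
is bounded and `C¹` with bounded Lipschitz derivative (`IsSpectralMeasure.exists_isC1Kernel`), which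
yields local existence. Positivity of `ν` makes the energy `∬ φ(γ(ξ) - γ(η)) ⟨γ_ξ(ξ), γ_ξ(η)⟩ dξ dη`
equal to the `ν`-integral of `|∫ exp(i⟨k,γ⟩) γ_ξ dξ|²`. The energy is conserved, and by Young's
inequality it bounds `u` and `∇u` uniformly in space (`IsSpectralMeasure.norm_flowVelocity_le`,
`IsSpectralMeasure.norm_flowGradient_le`). Finite-time blow-up is thereby excluded.

Conservation: after integration by parts along the closed curve, the Binet–Cauchy identity writes
the rate of change at frequency `k` as twice the integral of `⟨k ∧ D, u ∧ γ_ξ⟩` along the curve,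
where `∫ k ∧ D dν = u(γ(ξ))`. Integration in `k` leaves `⟨u, u ∧ γ_ξ⟩ = 0`
(`IsSpectralMeasure.hasDerivAt_energy_zero`).

Existence is obtained from an ordinary differential equation for pairs `(γ, M)` in the supremum
norm, with `γ_ξ = M g₀`, where `g₀` is the derivative of the initial curve: `γ' = u(γ)` and `M' =
∇u(γ) M`. The `L²` function `g₀` is fixed, and all the evolving quantities are bounded and
continuous. The field is cut off outside a large ball; the energy bound and Gronwall's inequality
show that the cutoff never acts on `[0,T]` (`IsSpectralMeasure.exists_flow`).

Uniqueness holds in the whole weak class: an integration by parts removes `γ_ξ - γ'_ξ` from the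
difference of two velocities, so this difference is Lipschitz in the uniform distance of the curves
(`IsC1Kernel.norm_lineIntegral_sub_le_of_closed`), and an iterated integral inequality concludes.
The Rosenhead kernel is a positive superposition of Gaussians, and so is its Fourier transform. -/

noncomputable section

set_option linter.unusedSectionVars false

namespace VortexFilament

open Set Filter Topology

/-! ### Absolutely continuous curves and weak derivatives -/

section Primitive

variable {V W : Type*} [NormedAddCommGroup V] [NormedSpace ℝ V]
  [NormedAddCommGroup W] [NormedSpace ℝ W]

instance : IsProbabilityMeasure unitMeasure := ⟨by simp [unitMeasure]⟩

lemma integrable_unitMeasure_iff {V : Type*} [NormedAddCommGroup V] {g : ℝ → V} :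
    Integrable g unitMeasure ↔ IntervalIntegrable g volume 0 1 := by
  rw [intervalIntegrable_iff_integrableOn_Ioo_of_le zero_le_one]
  rfl

lemma integral_unitMeasure (g : ℝ → V) : ∫ ξ, g ξ ∂unitMeasure = ∫ ξ in (0 : ℝ)..1, g ξ := by
  rw [intervalIntegral.integral_of_le zero_le_one, integral_Ioc_eq_integral_Ioo]
  rfl

/-- `γ` is absolutely continuous on `[0,1]` with derivative `g`. -/
structure IsPrimitive (γ g : ℝ → V) : Prop where
  integrable : Integrable g unitMeasure
  eq_add_integral : ∀ ξ ∈ Icc (0 : ℝ) 1, γ ξ = γ 0 + ∫ s in (0 : ℝ)..ξ, g s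

lemma IsPrimitive.intervalIntegrable {γ g : ℝ → V} (h : IsPrimitive γ g) {a b : ℝ}
    (ha : a ∈ Icc (0 : ℝ) 1) (hb : b ∈ Icc (0 : ℝ) 1) : IntervalIntegrable g volume a b := by
  refine (integrable_unitMeasure_iff.1 h.integrable).mono_set ?_
  rw [uIcc_of_le zero_le_one]
  exact uIcc_subset_Icc ha hb

lemma IsPrimitive.sub_eq_integral {γ g : ℝ → V} (h : IsPrimitive γ g) {a b : ℝ}
    (ha : a ∈ Icc (0 : ℝ) 1) (hb : b ∈ Icc (0 : ℝ) 1) : γ b - γ a = ∫ s in a..b, g s := by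
  have h0 : (0 : ℝ) ∈ Icc (0 : ℝ) 1 := ⟨le_rfl, zero_le_one⟩
  rw [h.eq_add_integral a ha, h.eq_add_integral b hb,
    ← intervalIntegral.integral_interval_sub_left (h.intervalIntegrable h0 hb)
      (h.intervalIntegrable h0 ha)]
  abel

lemma IsPrimitive.integral_eq {γ g : ℝ → V} (h : IsPrimitive γ g) :
    ∫ s, g s ∂unitMeasure = γ 1 - γ 0 := by
  rw [integral_unitMeasure, h.sub_eq_integral ⟨le_rfl, zero_le_one⟩ ⟨zero_le_one, le_rfl⟩]

lemma IsPrimitive.continuousOn {γ g : ℝ → V} (h : IsPrimitive γ g) :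
    ContinuousOn γ (Icc 0 1) := by
  have := (intervalIntegral.continuousOn_primitive_interval' (a := (0 : ℝ))
    (integrable_unitMeasure_iff.1 h.integrable) (by simp)).const_add (γ 0)
  rw [uIcc_of_le zero_le_one] at this
  exact this.congr fun ξ hξ => h.eq_add_integral ξ hξ

lemma IsPrimitive.ae_hasDerivAt [CompleteSpace V] {γ g : ℝ → V} (h : IsPrimitive γ g) :
    ∀ᵐ ξ, ξ ∈ Ioo (0 : ℝ) 1 → HasDerivAt γ (g ξ) ξ := by
  filter_upwards [(integrable_unitMeasure_iff.1 h.integrable).ae_hasDerivAt_integral] with ξ hξ h01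
  have := (hξ (by rw [uIcc_of_le zero_le_one]; exact ⟨h01.1.le, h01.2.le⟩) 0 (by simp)).const_add
    (γ 0)
  refine this.congr_of_eventuallyEq ?_
  filter_upwards [Icc_mem_nhds h01.1 h01.2] with s hs using h.eq_add_integral s hs

/-- The sums of increments of `f` are at most `C` times those of `G`. It is used with `G` the
primitive of `‖g‖`, and with an absolutely continuous curve in place of `G` and its Lipschitz image
in place of `f`. -/
lemma absolutelyContinuousOnInterval_of_dist_le {X Y : Type*} [PseudoMetricSpace X]
    [PseudoMetricSpace Y] {f : ℝ → X} {G : ℝ → Y} {a b C : ℝ}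
    (hG : AbsolutelyContinuousOnInterval G a b)
    (h : ∀ x ∈ uIcc a b, ∀ y ∈ uIcc a b, dist (f x) (f y) ≤ C * dist (G x) (G y)) :
    AbsolutelyContinuousOnInterval f a b := by
  unfold AbsolutelyContinuousOnInterval at hG ⊢
  refine squeeze_zero' (Eventually.of_forall fun _ => Finset.sum_nonneg fun _ _ => dist_nonneg) ?_
    (by simpa using hG.const_mul C)
  rw [eventually_inf_principal]
  filter_upwards with E hE
  rw [Finset.mul_sum]
  exact Finset.sum_le_sum fun i hi => h _ (hE.1 i hi).1 _ (hE.1 i hi).2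

lemma IsPrimitive.norm_sub_le {γ g : ℝ → V} (h : IsPrimitive γ g) {x y : ℝ}
    (hx : x ∈ Icc (0 : ℝ) 1) (hy : y ∈ Icc (0 : ℝ) 1) :
    ‖γ x - γ y‖ ≤ dist (∫ s in (0 : ℝ)..x, ‖g s‖) (∫ s in (0 : ℝ)..y, ‖g s‖) := by
  have h0 : (0 : ℝ) ∈ Icc (0 : ℝ) 1 := ⟨le_rfl, zero_le_one⟩
  rw [h.sub_eq_integral hy hx, Real.dist_eq,
    intervalIntegral.integral_interval_sub_left (h.intervalIntegrable h0 hx).norm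
      (h.intervalIntegrable h0 hy).norm]
  exact intervalIntegral.norm_integral_le_abs_integral_norm

lemma IsPrimitive.absolutelyContinuousOnInterval {γ g : ℝ → V} (h : IsPrimitive γ g) :
    AbsolutelyContinuousOnInterval γ 0 1 := by
  refine absolutelyContinuousOnInterval_of_dist_le (C := 1)
    ((integrable_unitMeasure_iff.1 h.integrable).norm
      |>.absolutelyContinuousOnInterval_intervalIntegral (c := 0) (by simp)) fun x hx y hy => ?_
  rw [uIcc_of_le zero_le_one] at hx hy
  rw [one_mul, dist_eq_norm]
  exact h.norm_sub_le hx hy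

/-- The difference of `γ` and the primitive of `g` is absolutely continuous with derivative zero
almost everywhere, hence constant. -/
lemma IsPrimitive.of_absolutelyContinuousOnInterval [CompleteSpace V] {γ g : ℝ → V}
    (hg : Integrable g unitMeasure) (hγ : AbsolutelyContinuousOnInterval γ 0 1)
    (hd : ∀ᵐ ξ, ξ ∈ Ioo (0 : ℝ) 1 → HasDerivAt γ (g ξ) ξ) : IsPrimitive γ g := by
  refine ⟨hg, fun ξ hξ => ?_⟩
  set G : ℝ → V := fun x => ∫ s in (0 : ℝ)..x, g s with hGdef
  have hG : IsPrimitive G g := ⟨hg, fun x _ => by simp [G]⟩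
  -- Derivatives are known in the open interval only; the two end points are discarded as null sets.
  have h₁ : ∀ᵐ x : ℝ, x ≠ 0 := by simp [ae_iff, measure_singleton]
  have h₂ : ∀ᵐ x : ℝ, x ≠ 1 := by simp [ae_iff, measure_singleton]
  obtain ⟨C, hC⟩ := (hγ.sub hG.absolutelyContinuousOnInterval).const_of_ae_hasDerivAt_zero (by
    filter_upwards [hd, hG.ae_hasDerivAt, h₁, h₂] with x hx hx' h0 h1 hx01
    rw [uIcc_of_le zero_le_one] at hx01
    have h01 : x ∈ Ioo (0 : ℝ) 1 := ⟨lt_of_le_of_ne hx01.1 h0.symm, lt_of_le_of_ne hx01.2 h1⟩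
    simpa using (hx h01).sub (hx' h01))
  rw [uIcc_of_le zero_le_one] at hC
  have e0 := hC 0 ⟨le_rfl, zero_le_one⟩
  have e1 := hC ξ hξ
  simp only [Pi.sub_apply, G, intervalIntegral.integral_same, sub_zero] at e0 e1
  rw [e0, ← e1]
  abel

lemma integrable_clm_apply {A : ℝ → V →L[ℝ] W} {g : ℝ → V} (hg : Integrable g unitMeasure)
    (hA : ContinuousOn A (Icc 0 1)) : Integrable (fun ξ => A ξ (g ξ)) unitMeasure := by
  obtain ⟨C, hC⟩ := isCompact_Icc.exists_bound_of_continuousOn hA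
  have hms : AEStronglyMeasurable A unitMeasure :=
    (hA.mono Ioo_subset_Icc_self).aestronglyMeasurable measurableSet_Ioo
  refine (hg.norm.const_mul C).mono'
    (isBoundedBilinearMap_apply.continuous.comp_aestronglyMeasurable (hms.prodMk hg.1)) ?_
  refine (ae_restrict_iff' measurableSet_Ioo).2 (Eventually.of_forall fun ξ hξ => ?_)
  exact (A ξ).le_of_opNorm_le (hC ξ (Ioo_subset_Icc_self hξ)) _

/-- The chain rule for absolutely continuous curves. -/
lemma IsPrimitive.comp [CompleteSpace V] [CompleteSpace W] {γ g : ℝ → V} (h : IsPrimitive γ g)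
    {U : V → W} (hU : ContDiff ℝ 1 U) :
    IsPrimitive (fun ξ => U (γ ξ)) (fun ξ => fderiv ℝ U (γ ξ) (g ξ)) := by
  -- `U` is only locally Lipschitz; compactness of the image of `[0,1]` provides a single constant.
  obtain ⟨K, hK⟩ := LocallyLipschitzOn.exists_lipschitzOnWith_of_compact
    (isCompact_Icc.image_of_continuousOn h.continuousOn)
    (hU.locallyLipschitz.locallyLipschitzOn (s := γ '' Icc 0 1))
  refine .of_absolutelyContinuousOnInterval ?_ ?_ ?_
  · exact integrable_clm_apply h.integrable
      ((hU.continuous_fderiv one_ne_zero).comp_continuousOn h.continuousOn)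
  · refine absolutelyContinuousOnInterval_of_dist_le h.absolutelyContinuousOnInterval (C := K)
      fun x hx y hy => ?_
    rw [uIcc_of_le zero_le_one] at hx hy
    exact hK.dist_le_mul _ (mem_image_of_mem γ hx) _ (mem_image_of_mem γ hy)
  · filter_upwards [h.ae_hasDerivAt] with ξ hξ h01
    exact ((hU.differentiable one_ne_zero) (γ ξ)).hasFDerivAt.comp_hasDerivAt ξ (hξ h01)

lemma IsPrimitive.prodMk [CompleteSpace V] [CompleteSpace W] {γ g : ℝ → V} {γ' g' : ℝ → W} (h : IsPrimitive γ g)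
    (h' : IsPrimitive γ' g') :
    IsPrimitive (fun ξ => (γ ξ, γ' ξ)) (fun ξ => (g ξ, g' ξ)) := by
  refine ⟨h.integrable.prodMk h'.integrable, fun ξ hξ => ?_⟩
  have h0 : (0 : ℝ) ∈ Icc (0 : ℝ) 1 := ⟨le_rfl, zero_le_one⟩
  rw [intervalIntegral.integral_of_le hξ.1, integral_pair, ← intervalIntegral.integral_of_le hξ.1,
    ← intervalIntegral.integral_of_le hξ.1, Prod.mk_add_mk, ← h.eq_add_integral ξ hξ,
    ← h'.eq_add_integral ξ hξ]
  · exact (h.intervalIntegrable h0 hξ).1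
  · exact (h'.intervalIntegrable h0 hξ).1

lemma IsPrimitive.sub {γ g γ' g' : ℝ → V} (h : IsPrimitive γ g) (h' : IsPrimitive γ' g') :
    IsPrimitive (fun ξ => γ ξ - γ' ξ) (fun ξ => g ξ - g' ξ) := by
  refine ⟨h.integrable.sub h'.integrable, fun ξ hξ => ?_⟩
  have h0 : (0 : ℝ) ∈ Icc (0 : ℝ) 1 := ⟨le_rfl, zero_le_one⟩
  rw [intervalIntegral.integral_sub (h.intervalIntegrable h0 hξ) (h'.intervalIntegrable h0 hξ),
    h.eq_add_integral ξ hξ, h'.eq_add_integral ξ hξ]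
  abel

lemma IsPrimitive.ae_eq [CompleteSpace V] {γ g g' : ℝ → V} (h : IsPrimitive γ g)
    (h' : IsPrimitive γ g') : g =ᵐ[unitMeasure] g' := by
  refine (ae_restrict_iff' measurableSet_Ioo).2 ?_
  filter_upwards [h.ae_hasDerivAt, h'.ae_hasDerivAt] with ξ h1 h2 h01
  exact (h1 h01).unique (h2 h01)

lemma IsPrimitive.smul [CompleteSpace V] {a b : ℝ → ℝ} {γ g : ℝ → V} (ha : IsPrimitive a b)
    (h : IsPrimitive γ g) :
    IsPrimitive (fun ξ => a ξ • γ ξ) (fun ξ => a ξ • g ξ + b ξ • γ ξ) := by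
  have hc : ContDiff ℝ 1 (fun p : ℝ × V => p.1 • p.2) := contDiff_fst.smul contDiff_snd
  have := (ha.prodMk h).comp hc
  convert! this using 2 with ξ
  have hd : HasFDerivAt (fun p : ℝ × V => p.1 • p.2) _ (a ξ, γ ξ) :=
    (hasFDerivAt_fst (𝕜 := ℝ) (E := ℝ) (F := V)).smul hasFDerivAt_snd
  rw [hd.fderiv]
  simp

lemma isPrimitive_of_contDiff {θ : ℝ → ℝ} (hθ : ContDiff ℝ 1 θ) : IsPrimitive θ (deriv θ) := by
  have hc := hθ.continuous_deriv le_rfl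
  refine ⟨integrable_unitMeasure_iff.2 (hc.intervalIntegrable 0 1), fun ξ _ => ?_⟩
  rw [intervalIntegral.integral_deriv_eq_sub (fun x _ => hθ.differentiable one_ne_zero x)
    (hc.intervalIntegrable _ _)]
  abel

lemma IsPrimitive.integral_deriv_smul [CompleteSpace V] {γ g : ℝ → V} (h : IsPrimitive γ g)
    {θ : ℝ → ℝ} (hθ : ContDiff ℝ (⊤ : ℕ∞) θ) (hs : tsupport θ ⊆ Ioo 0 1) :
    ∫ ξ, deriv θ ξ • γ ξ ∂unitMeasure = -∫ ξ, θ ξ • g ξ ∂unitMeasure := by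
  have h1 : ContDiff ℝ 1 θ := hθ.of_le (by exact_mod_cast le_top)
  have hp := (isPrimitive_of_contDiff h1).smul h
  have e0 : θ 0 = 0 := image_eq_zero_of_notMem_tsupport fun h => by simpa using hs h
  have e1 : θ 1 = 0 := image_eq_zero_of_notMem_tsupport fun h => by simpa using hs h
  have hi := hp.integral_eq
  have hint : Integrable (fun ξ => θ ξ • g ξ) unitMeasure := by
    rw [integrable_unitMeasure_iff]
    exact (integrable_unitMeasure_iff.1 h.integrable).continuousOn_smul h1.continuous.continuousOn
  have hint' : Integrable (fun ξ => deriv θ ξ • γ ξ) unitMeasure := by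
    rw [integrable_unitMeasure_iff]
    refine ContinuousOn.intervalIntegrable ?_
    rw [uIcc_of_le zero_le_one]
    exact (h1.continuous_deriv le_rfl).continuousOn.smul h.continuousOn
  rw [e0, e1, integral_add hint hint', zero_smul, zero_smul, sub_zero] at hi
  rw [eq_neg_iff_add_eq_zero, add_comm, hi]

/-- A smooth function of vanishing integral supported in `(0,1)` is the derivative of such a
function. -/
lemma exists_deriv_eq {ψ : ℝ → ℝ} (hψ : ContDiff ℝ (⊤ : ℕ∞) ψ) (hc : HasCompactSupport ψ)
    (hs : tsupport ψ ⊆ Ioo 0 1) (h0 : ∫ x, ψ x = 0) :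
    ∃ θ : ℝ → ℝ, ContDiff ℝ (⊤ : ℕ∞) θ ∧ HasCompactSupport θ ∧ tsupport θ ⊆ Ioo 0 1 ∧
      deriv θ = ψ := by
  -- A compact interval inside `(0,1)` that contains the support; the support of the primitive of
  -- `ψ` will lie in it as well.
  obtain ⟨a, b, ha, hb, hab⟩ : ∃ a b : ℝ, 0 < a ∧ b < 1 ∧ tsupport ψ ⊆ Icc a b := by
    rcases (tsupport ψ).eq_empty_or_nonempty with h | h
    · exact ⟨1 / 2, 1 / 2, by norm_num, by norm_num, by simp [h]⟩
    · refine ⟨sInf (tsupport ψ), sSup (tsupport ψ), (hs (hc.sInf_mem h)).1,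
        (hs (hc.sSup_mem h)).2, fun x hx => ⟨csInf_le hc.bddBelow hx, le_csSup hc.bddAbove hx⟩⟩
  have hz : ∀ x, x ∉ Icc a b → ψ x = 0 := fun x hx =>
    image_eq_zero_of_notMem_tsupport fun h => hx (hab h)
  have hcont : Continuous ψ := hψ.continuous
  have hint : Integrable ψ := hcont.integrable_of_hasCompactSupport hc
  have hd : ∀ x, HasDerivAt (fun y => ∫ s in (0 : ℝ)..y, ψ s) (ψ x) x := fun x =>
    intervalIntegral.integral_hasDerivAt_right (hcont.intervalIntegrable _ _)
      hcont.stronglyMeasurable.stronglyMeasurableAtFilter hcont.continuousAt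
  have hderiv : deriv (fun y => ∫ s in (0 : ℝ)..y, ψ s) = ψ := funext fun x => (hd x).deriv
  have hleft : ∀ y < a, ∫ s in (0 : ℝ)..y, ψ s = 0 := fun y hy => by
    rw [intervalIntegral.integral_congr (g := fun _ => 0), intervalIntegral.integral_zero]
    intro s hs
    refine hz s fun h => ?_
    rcases le_total 0 y with h' | h'
    · rw [uIcc_of_le h'] at hs
      linarith [hs.2, h.1]
    · rw [uIcc_of_ge h'] at hs
      linarith [hs.2, h.1]
  -- Beyond `b` the primitive has collected the whole integral of `ψ`; here its vanishing is used.
  have hright : ∀ y > b, ∫ s in (0 : ℝ)..y, ψ s = 0 := fun y hy => by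
    have e1 : ∫ s in Iic (0 : ℝ), ψ s = 0 :=
      setIntegral_eq_zero_of_forall_eq_zero fun s hs => hz s fun h => by
        linarith [h.1, show s ≤ 0 from hs]
    have e2 : ∫ s in Iic y, ψ s = ∫ s, ψ s :=
      setIntegral_eq_integral_of_forall_compl_eq_zero fun s hs => hz s fun h => by
        exact hs (h.2.trans hy.le)
    rw [← intervalIntegral.integral_Iic_sub_Iic hint.integrableOn hint.integrableOn, e1, e2, h0,
      sub_zero]
  have hts : tsupport (fun y => ∫ s in (0 : ℝ)..y, ψ s) ⊆ Icc a b := by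
    refine closure_minimal (fun y hy => ?_) isClosed_Icc
    by_contra hcon
    rw [mem_Icc, not_and_or, not_le, not_le] at hcon
    exact hy (hcon.elim (hleft y) (hright y))
  refine ⟨_, ?_, HasCompactSupport.intro' isCompact_Icc isClosed_Icc fun y hy =>
    image_eq_zero_of_notMem_tsupport fun h => hy (hts h),
    hts.trans (Icc_subset_Ioo ha hb), hderiv⟩
  rw [contDiff_infty_iff_deriv, hderiv]
  exact ⟨fun x => (hd x).differentiableAt, hψ⟩

lemma exists_bump_unitInterval : ∃ ψ : ℝ → ℝ, ContDiff ℝ (⊤ : ℕ∞) ψ ∧ HasCompactSupport ψ ∧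
    tsupport ψ ⊆ Ioo 0 1 ∧ ∫ x, ψ x = 1 := by
  let f : ContDiffBump (1 / 2 : ℝ) := ⟨1 / 8, 1 / 4, by norm_num, by norm_num⟩
  refine ⟨f.normed volume, f.contDiff_normed, f.hasCompactSupport_normed, ?_, f.integral_normed⟩
  rw [f.tsupport_normed_eq, Real.closedBall_eq_Icc]
  exact Icc_subset_Ioo (by norm_num [f]) (by norm_num [f])

/-- Du Bois-Reymond: a continuous function with vanishing weak derivative is constant. -/
lemma eqOn_const_of_forall_integral_deriv_smul_eq_zero [CompleteSpace V] {h : ℝ → V}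
    (hh : ContinuousOn h (Icc 0 1))
    (H : ∀ θ : ℝ → ℝ, ContDiff ℝ (⊤ : ℕ∞) θ → HasCompactSupport θ → tsupport θ ⊆ Ioo 0 1 →
      ∫ ξ, deriv θ ξ • h ξ ∂unitMeasure = 0) :
    ∃ c, EqOn h (fun _ => c) (Icc 0 1) := by
  obtain ⟨ψ₀, h1, h2, h3, h4⟩ := exists_bump_unitInterval
  have hint : ∀ ψ : ℝ → ℝ, Continuous ψ → ∀ k : ℝ → V, ContinuousOn k (Icc 0 1) →
      Integrable (fun ξ => ψ ξ • k ξ) unitMeasure := fun ψ hψ k hk => by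
    rw [integrable_unitMeasure_iff]
    refine ContinuousOn.intervalIntegrable ?_
    rw [uIcc_of_le zero_le_one]
    exact hψ.continuousOn.smul hk
  set c := ∫ ξ, ψ₀ ξ • h ξ ∂unitMeasure with hcdef
  have hvol : ∀ ψ : ℝ → ℝ, tsupport ψ ⊆ Ioo 0 1 → ∀ k : ℝ → V,
      ∫ ξ, ψ ξ • k ξ ∂unitMeasure = ∫ ξ, ψ ξ • k ξ := fun ψ hψ k =>
    setIntegral_eq_integral_of_forall_compl_eq_zero fun ξ hξ => by
      rw [image_eq_zero_of_notMem_tsupport fun h => hξ (hψ h), zero_smul]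
  have hae : ∀ᵐ ξ, ξ ∈ Ioo (0 : ℝ) 1 → h ξ - c = 0 := by
    refine isOpen_Ioo.ae_eq_zero_of_integral_contDiff_smul_eq_zero
      (((hh.mono Ioo_subset_Icc_self).sub continuousOn_const).locallyIntegrableOn
        measurableSet_Ioo) fun ψ p1 p2 p3 => ?_
    -- The function `ψ - m ψ₀` has integral zero, so it is an admissible `deriv θ`. Testing with it
    -- gives `∫ ψ h = m c`, that is `∫ ψ (h - c) = 0`.
    set m := ∫ x, ψ x
    have q1 : ContDiff ℝ (⊤ : ℕ∞) (fun x => ψ x - m * ψ₀ x) := p1.sub (contDiff_const.mul h1)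
    have q2 : HasCompactSupport (fun x => ψ x - m * ψ₀ x) := p2.sub h2.mul_left
    have q3 : tsupport (fun x => ψ x - m * ψ₀ x) ⊆ Ioo 0 1 :=
      (tsupport_sub _ _).trans (union_subset p3 ((tsupport_mul_subset_right).trans h3))
    have i1 : Integrable ψ := p1.continuous.integrable_of_hasCompactSupport p2
    have i2 : Integrable ψ₀ := h1.continuous.integrable_of_hasCompactSupport h2
    obtain ⟨θ, t1, t2, t3, t4⟩ := exists_deriv_eq q1 q2 q3 (by
      rw [integral_sub i1 (i2.const_mul m), integral_const_mul, h4, mul_one, sub_self])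
    have e := H θ t1 t2 t3
    rw [t4] at e
    simp_rw [sub_smul, mul_smul] at e
    rw [integral_sub (hint _ p1.continuous _ hh) ((hint _ h1.continuous _ hh).fun_smul m),
      integral_smul, ← hcdef, sub_eq_zero] at e
    rw [← hvol ψ p3]
    simp_rw [smul_sub]
    rw [integral_sub (hint _ p1.continuous _ hh) (hint _ p1.continuous _ continuousOn_const), e,
      sub_eq_zero, hvol ψ p3, integral_smul_const]
  refine ⟨c, ?_⟩
  have hEq : EqOn h (fun _ => c) (Ioo 0 1) := by
    refine Measure.eqOn_open_of_ae_eq (μ := volume) ?_ isOpen_Ioo (hh.mono Ioo_subset_Icc_self)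
      continuousOn_const
    refine (ae_restrict_iff' measurableSet_Ioo).2 ?_
    filter_upwards [hae] with ξ hξ h01 using sub_eq_zero.1 (hξ h01)
  have := hEq.of_subset_closure hh continuousOn_const Ioo_subset_Icc_self
    (by rw [closure_Ioo zero_ne_one])
  exact this

lemma integrable_of_memLp_two {V : Type*} [NormedAddCommGroup V] {g : ℝ → V} (hg : MemLp g 2 unitMeasure) :
    Integrable g unitMeasure := hg.integrable (by norm_num)

/-- The difference of `γ` and the primitive of `g` is continuous with zero weak derivative, hence
constant by du Bois-Reymond. From here on, weak derivatives are handled through the fundamental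
theorem of calculus. -/
lemma IsWeakDeriv.isPrimitive {γ g : ℝ → E3} (hγ : Continuous γ) (h : IsWeakDeriv γ g) :
    IsPrimitive γ g := by
  have hg : Integrable g unitMeasure := integrable_of_memLp_two h.memLp
  have hG : IsPrimitive (fun ξ => ∫ s in (0 : ℝ)..ξ, g s) g := ⟨hg, fun ξ _ => by simp⟩
  obtain ⟨c, hc⟩ := eqOn_const_of_forall_integral_deriv_smul_eq_zero
    (h := fun ξ => γ ξ - ∫ s in (0 : ℝ)..ξ, g s) (hγ.continuousOn.sub hG.continuousOn) fun θ t1 t2 t3 => by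
      have hcd := t1.continuous_deriv (by simp)
      have hint : ∀ k : ℝ → E3, ContinuousOn k (Icc 0 1) →
          Integrable (fun ξ => deriv θ ξ • k ξ) unitMeasure := fun k hk => by
        rw [integrable_unitMeasure_iff]
        refine ContinuousOn.intervalIntegrable ?_
        rw [uIcc_of_le zero_le_one]
        exact hcd.continuousOn.smul hk
      simp_rw [smul_sub]
      rw [integral_sub (hint _ hγ.continuousOn) (hint _ hG.continuousOn),
        h.integral_eq θ t1 t2 t3, hG.integral_deriv_smul t1 t3, sub_self]
  refine ⟨hg, fun ξ hξ => ?_⟩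
  have e0 := hc ⟨le_rfl, zero_le_one⟩
  have e1 := hc hξ
  simp only [intervalIntegral.integral_same, sub_zero] at e0 e1
  rw [e0, ← e1]
  abel

lemma IsPrimitive.isWeakDeriv {γ g : ℝ → E3} (h : IsPrimitive γ g) (hg : MemLp g 2 unitMeasure) :
    IsWeakDeriv γ g :=
  ⟨hg, fun _ h1 _ h3 => h.integral_deriv_smul h1 h3⟩

lemma MemH1Closed.isWeakDeriv {γ : ℝ → E3} (h : MemH1Closed γ) : IsWeakDeriv γ (weakDeriv γ) := by
  rw [weakDeriv, dif_pos h.exists_weakDeriv]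
  exact h.exists_weakDeriv.choose_spec

lemma MemH1Closed.isPrimitive {γ : ℝ → E3} (h : MemH1Closed γ) :
    IsPrimitive γ (weakDeriv γ) :=
  h.isWeakDeriv.isPrimitive h.continuous

end Primitive

/-! ### The kernel as the cosine transform of a positive measure -/

/-- A finite positive measure with finite fourth moment whose cosine transform is `φ`. -/
structure IsSpectralMeasure {E : Type*} [NormedAddCommGroup E] [InnerProductSpace ℝ E]
    [MeasurableSpace E] (φ : E → ℝ) (ν : Measure E) : Prop where
  isFinite : IsFiniteMeasure ν
  moment : Integrable (fun k : E => ‖k‖ ^ 4) ν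
  eq_integral_cos : ∀ x, φ x = ∫ k, Real.cos (inner ℝ k x) ∂ν

section SpectralMeasure

open scoped FourierTransform SchwartzMap

lemma continuous_neg_innerₗ : Continuous fun p : E3 × E3 => (-innerₗ E3) p.1 p.2 :=
  (continuous_inner (𝕜 := ℝ) (E := E3)).neg

lemma continuous_fourierInv {f : E3 → ℂ} (hf : Integrable f) : Continuous (𝓕⁻ f) :=
  VectorFourier.fourierIntegral_continuous Real.continuous_fourierChar
    (L := -innerₗ E3) continuous_neg_innerₗ hf

lemma integral_mul_fourierInv {f g : E3 → ℂ} (hf : Integrable f) (hg : Integrable g) :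
    ∫ k, f k * (𝓕⁻ g) k = ∫ x, (𝓕⁻ f) x * g x := by
  have h := VectorFourier.integral_fourierIntegral_smul_eq_flip (L := -innerₗ E3)
    (μ := volume) (ν := volume) Real.continuous_fourierChar
    continuous_neg_innerₗ hf hg
  have e : (-innerₗ E3).flip = -innerₗ E3 := by
    ext x y
    simp [real_inner_comm]
  rw [e] at h
  exact h.symm

/-- Fourier inversion, with the factor `-1/(2π)` converting the character `exp(i⟨k,x⟩)` of the
hypotheses into the character `exp(-2πi⟨k,x⟩)` of `𝓕`. -/
lemma integral_exp_mul_fourierInv (η : 𝓢(E3, ℂ)) (x : E3) :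
    ∫ k : E3, Complex.exp (Complex.I * (inner ℝ k x : ℝ)) * (𝓕⁻ η) k =
      η ((-(2 * Real.pi)⁻¹ : ℝ) • x) := by
  have h : 𝓕 (𝓕⁻ η) = η := FourierTransform.fourier_fourierInv_eq η
  conv_rhs => rw [← h, SchwartzMap.fourier_coe, Real.fourier_eq']
  refine integral_congr_ae (Eventually.of_forall fun k => ?_)
  simp only [smul_eq_mul, inner_smul_right]
  congr 2
  rw [mul_comm]
  congr 2
  field_simp

/-- Inverse transforms of Schwartz functions, inserted as test functions in the pairing, show that a
rescaled `φ` and the inverse transform of `φhat` have the same integrals against every `η`. Both are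
continuous, so they agree everywhere. -/
lemma eq_fourierInv_of_isFourierTransform {φ φhat : E3 → ℝ} (hφ : Continuous φ)
    (h : IsFourierTransform φ φhat) (hi : Integrable φhat) (x : E3) :
    (φ x : ℂ) = ((2 * (Real.pi : ℂ)) ^ 3)⁻¹ *
      ∫ k : E3, Complex.exp (-(Complex.I * (inner ℝ k x : ℝ))) * φhat k := by
  have hπ : (0 : ℝ) < 2 * Real.pi := by positivity
  set f : E3 → ℂ := fun k => (φhat k : ℂ) with hf
  have hfi : Integrable f := hi.ofReal
  -- The dilation by `-2π` matches the two normalizations; `(2π)³` is its Jacobian in dimension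
  -- three.
  set G : E3 → ℂ := fun y => ((2 * Real.pi) ^ 3 : ℝ) * (φ ((-(2 * Real.pi)) • y) : ℂ) with hG
  have hGc : Continuous G :=
    continuous_const.mul (Complex.continuous_ofReal.comp (hφ.comp (continuous_const_smul _)))
  set F : E3 → ℂ := 𝓕⁻ f with hFdef
  have key : ∀ η : 𝓢(E3, ℂ), ∫ y, η y * G y = ∫ y, η y * F y := fun η => by
    have h1 := h.pairing (𝓕⁻ η)
    simp_rw [integral_exp_mul_fourierInv] at h1
    rw [SchwartzMap.fourierInv_coe] at h1
    have h2 := integral_mul_fourierInv hfi (SchwartzMap.integrable η)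
    simp only [hf] at h2
    rw [h2] at h1
    have h3 := Measure.integral_comp_smul (volume : Measure E3)
      (fun x => (φ x : ℂ) * η ((-(2 * Real.pi)⁻¹ : ℝ) • x)) (-(2 * Real.pi))
    rw [h1] at h3
    simp only [smul_smul, finrank_euclideanSpace, Fintype.card_fin] at h3
    have e1 : (-(2 * Real.pi)⁻¹ : ℝ) * -(2 * Real.pi) = 1 := by field_simp
    have e2 : |((-(2 * Real.pi)) ^ 3)⁻¹| = ((2 * Real.pi) ^ 3)⁻¹ := by
      rw [abs_inv, abs_pow, abs_neg, abs_of_pos hπ]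
    simp only [e1, e2, one_smul] at h3
    calc ∫ y, η y * G y
        = ((2 * Real.pi) ^ 3 : ℝ) * ∫ y, (φ ((-(2 * Real.pi)) • y) : ℂ) * η y := by
          rw [← integral_const_mul]
          refine integral_congr_ae (Eventually.of_forall fun y => ?_)
          simp only [G]
          ring
      _ = ∫ y, η y * F y := by
          rw [h3, Complex.real_smul, ← mul_assoc, ← Complex.ofReal_mul, mul_inv_cancel₀
            (by positivity), Complex.ofReal_one, one_mul]
          simp_rw [mul_comm (η _)]
          rfl
  have hFc : Continuous F := continuous_fourierInv hfi
  have hae : G =ᵐ[volume] F := by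
    refine ae_eq_of_integral_contDiff_smul_eq hGc.locallyIntegrable hFc.locallyIntegrable
      fun g g1 g2 => ?_
    have := key ((g2.comp_left (g := Complex.ofReal) Complex.ofReal_zero).toSchwartzMap
      (Complex.ofRealCLM.contDiff.comp g1))
    simp only [Complex.real_smul]
    exact this
  have heq := (Continuous.ae_eq_iff_eq volume hGc hFc).1 hae
  have hx := congrFun heq ((-(2 * Real.pi)⁻¹ : ℝ) • x)
  have e1 : -(2 * Real.pi) * (-(2 * Real.pi)⁻¹ : ℝ) = 1 := by field_simp
  simp only [G, smul_smul, e1, one_smul] at hx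
  have hne : (((2 * Real.pi) ^ 3 : ℝ) : ℂ) ≠ 0 := by
    exact_mod_cast (pow_pos hπ 3).ne'
  rw [← eq_inv_mul_iff_mul_eq₀ hne] at hx
  rw [hx, hFdef, Real.fourierInv_eq']
  congr 1
  · push_cast
    rfl
  · refine integral_congr_ae (Eventually.of_forall fun k => ?_)
    simp only [smul_eq_mul, inner_smul_right, hf]
    congr 2
    rw [mul_comm Complex.I, ← neg_mul, ← Complex.ofReal_neg]
    congr 2
    field_simp

/-- The measure has density `(2π)⁻³ φhat`, which is non-negative by (A.2). Since `φ` and `φhat` are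
real, the real part of the inversion formula is a cosine transform; the fourth moment is dominated
by the weight in (A.4). -/
theorem HypothesisA.exists_isSpectralMeasure {φ : E3 → ℝ} (h : HypothesisA φ) :
    ∃ ν, IsSpectralMeasure φ ν := by
  obtain ⟨hφ, -, φhat, hF, h0, hi, hw⟩ := h
  set c : ℝ := ((2 * Real.pi) ^ 3)⁻¹ with hc
  have hc0 : 0 ≤ c := by positivity
  have hci : Integrable (fun k => c * φhat k) := hi.const_mul c
  have hm : AEMeasurable (fun k => ENNReal.ofReal (c * φhat k)) :=
    hci.1.aemeasurable.ennreal_ofReal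
  have hlt : ∀ᵐ k : E3, ENNReal.ofReal (c * φhat k) < ⊤ :=
    Eventually.of_forall fun k => ENNReal.ofReal_lt_top
  have htr : ∀ k, (ENNReal.ofReal (c * φhat k)).toReal = c * φhat k := fun k =>
    ENNReal.toReal_ofReal (mul_nonneg hc0 (h0 k))
  refine ⟨volume.withDensity fun k => ENNReal.ofReal (c * φhat k), ?_, ?_, fun x => ?_⟩
  · exact isFiniteMeasure_withDensity_ofReal hci.2
  · rw [integrable_withDensity_iff_integrable_smul₀' hm hlt]
    simp_rw [htr, smul_eq_mul]
    refine (hw.const_mul c).mono' ((hci.1.mul (continuous_norm.pow 4).aestronglyMeasurable)) ?_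
    refine Eventually.of_forall fun k => ?_
    have := h0 k
    rw [Real.norm_eq_abs, abs_of_nonneg (by positivity)]
    have h4 : ‖k‖ ^ 4 ≤ (1 + ‖k‖ ^ 2) ^ 2 := by nlinarith [sq_nonneg ‖k‖]
    calc c * φhat k * ‖k‖ ^ 4 ≤ c * φhat k * (1 + ‖k‖ ^ 2) ^ 2 := by gcongr
      _ = _ := by ring
  · rw [integral_withDensity_eq_integral_toReal_smul₀ hm hlt]
    simp_rw [htr, smul_eq_mul]
    have hx := eq_fourierInv_of_isFourierTransform hφ hF hi x
    rw [← Complex.ofReal_re (φ x), hx]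
    have e : ((2 * (Real.pi : ℂ)) ^ 3)⁻¹ = ((c : ℝ) : ℂ) := by
      rw [hc]
      push_cast
      rfl
    rw [e, Complex.re_ofReal_mul]
    have hint : Integrable (fun k : E3 =>
        Complex.exp (-(Complex.I * (inner ℝ k x : ℝ))) * φhat k) := by
      refine (hi.ofReal (𝕜 := ℂ)).bdd_mul (c := 1) (Continuous.aestronglyMeasurable (by fun_prop))
        (Eventually.of_forall fun k => ?_)
      rw [mul_comm, ← neg_mul, ← Complex.ofReal_neg, Complex.norm_exp_ofReal_mul_I]
    have hre := integral_re hint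
    simp only [RCLike.re_eq_complex_re] at hre
    rw [← hre, ← integral_const_mul]
    refine integral_congr_ae (Eventually.of_forall fun k => ?_)
    simp only
    rw [mul_comm (Complex.exp _), Complex.re_ofReal_mul, mul_comm Complex.I, ← neg_mul,
      ← Complex.ofReal_neg, Complex.exp_ofReal_mul_I_re, Real.cos_neg]
    ring

end SpectralMeasure

/-! ### The vector product -/

section Cross

lemma cross_add_left (a a' b : E3) : cross (a + a') b = cross a b + cross a' b := by
  ext i
  simp [cross]

lemma cross_smul_left (r : ℝ) (a b : E3) : cross (r • a) b = r • cross a b := by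
  ext i
  simp [cross]

lemma cross_add_right (a b b' : E3) : cross a (b + b') = cross a b + cross a b' := by
  ext i
  simp [cross]

lemma cross_smul_right (r : ℝ) (a b : E3) : cross a (r • b) = r • cross a b := by
  ext i
  simp [cross]

/-- The vector product as a continuous bilinear map. -/
def crossL : E3 →L[ℝ] E3 →L[ℝ] E3 :=
  (LinearMap.mk₂ ℝ cross cross_add_left cross_smul_left cross_add_right
    cross_smul_right).toContinuousBilinearMap

@[simp] lemma crossL_apply (a b : E3) : crossL a b = cross a b := rfl

/-- The Binet–Cauchy identity. Together with `inner_cross_self_left` it is all that the energy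
argument needs of the vector product, so that argument is carried out for an abstract bilinear map
`A` with these two properties. -/
lemma inner_cross_cross (a b c d : E3) :
    inner ℝ (cross a b) (cross c d) = inner ℝ a c * inner ℝ b d - inner ℝ a d * inner ℝ b c := by
  have h := cross_dot_cross a.ofLp b.ofLp c.ofLp d.ofLp
  simp only [EuclideanSpace.inner_eq_star_dotProduct, star_trivial, cross]
  rw [dotProduct_comm, h, dotProduct_comm c.ofLp a.ofLp, dotProduct_comm d.ofLp b.ofLp,
    dotProduct_comm d.ofLp a.ofLp, dotProduct_comm c.ofLp b.ofLp]

end Cross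

/-! ### Regularity of the gradient of the kernel -/

section Kernel

section

variable {E : Type*} [NormedAddCommGroup E] [NormedSpace ℝ E]

/-- A bounded `C¹` field with bounded Lipschitz derivative. -/
structure IsC1Kernel (K : E → E) (DK : E → E →L[ℝ] E) (c : ℝ) : Prop where
  norm_le : ∀ x, ‖K x‖ ≤ c
  norm_deriv_le : ∀ x, ‖DK x‖ ≤ c
  hasFDerivAt : ∀ x, HasFDerivAt K (DK x) x
  lipschitz_deriv : ∀ x y, ‖DK x - DK y‖ ≤ c * ‖x - y‖

lemma IsC1Kernel.nonneg {K : E → E} {DK : E → E →L[ℝ] E} {c : ℝ} (h : IsC1Kernel K DK c) :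
    0 ≤ c := (norm_nonneg _).trans (h.norm_le 0)

lemma IsC1Kernel.lipschitz {K : E → E} {DK : E → E →L[ℝ] E} {c : ℝ}
    (h : IsC1Kernel K DK c) (x y : E) : ‖K x - K y‖ ≤ c * ‖x - y‖ :=
  convex_univ.norm_image_sub_le_of_norm_hasFDerivWithin_le
    (fun x _ => (h.hasFDerivAt x).hasFDerivWithinAt) (fun x _ => h.norm_deriv_le x) (mem_univ y)
    (mem_univ x)

end

variable {E : Type*} [NormedAddCommGroup E] [InnerProductSpace ℝ E] [CompleteSpace E]
  [SecondCountableTopology E] [MeasurableSpace E] [BorelSpace E]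

variable {φ : E → ℝ} {ν : Measure E}

lemma IsSpectralMeasure.integrable_norm_pow (h : IsSpectralMeasure φ ν) {n : ℕ} (hn : n ≤ 4) :
    Integrable (fun k : E => ‖k‖ ^ n) ν := by
  have := h.isFinite
  refine ((integrable_const (1 : ℝ)).add h.moment).mono'
    (continuous_norm.pow n).aestronglyMeasurable (Eventually.of_forall fun k => ?_)
  rw [Real.norm_eq_abs, abs_of_nonneg (by positivity)]
  simp only [Pi.add_apply]
  rcases le_total ‖k‖ 1 with h1 | h1
  · linarith [pow_le_one₀ (n := n) (norm_nonneg k) h1, pow_nonneg (norm_nonneg k) 4]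
  · linarith [pow_le_pow_right₀ h1 hn]

/-- The gradient of the cosine transform of `ν`. -/
def kernel (ν : Measure E) (x : E) : E := ∫ k, -(Real.sin (inner ℝ k x)) • k ∂ν

/-- The second derivative of the cosine transform of `ν`. -/
def kernelDeriv (ν : Measure E) (x : E) : E →L[ℝ] E :=
  ∫ k, -(Real.cos (inner ℝ k x)) • (innerSL ℝ k).smulRight k ∂ν

lemma continuous_smulRight_self : Continuous fun k : E => (innerSL ℝ k).smulRight k :=
  (((ContinuousLinearMap.smulRightL ℝ E E).continuous.comp (innerSL ℝ).continuous).clm_apply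
    continuous_id)

lemma norm_smulRight_self (k : E) : ‖(innerSL ℝ k).smulRight k‖ = ‖k‖ ^ 2 := by
  rw [ContinuousLinearMap.norm_smulRight_apply, innerSL_apply_norm, sq]

lemma IsSpectralMeasure.integrable_kernel (h : IsSpectralMeasure φ ν) (x : E) :
    Integrable (fun k : E => -(Real.sin (inner ℝ k x)) • k) ν := by
  refine (h.integrable_norm_pow (n := 1) (by norm_num)).mono'
    (Continuous.aestronglyMeasurable (by fun_prop)) (Eventually.of_forall fun k => ?_)
  rw [norm_smul, norm_neg, Real.norm_eq_abs, pow_one]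
  exact mul_le_of_le_one_left (norm_nonneg k) (Real.abs_sin_le_one _)

lemma IsSpectralMeasure.integrable_kernelDeriv (h : IsSpectralMeasure φ ν) (x : E) :
    Integrable (fun k : E => -(Real.cos (inner ℝ k x)) • (innerSL ℝ k).smulRight k) ν := by
  refine (h.integrable_norm_pow (n := 2) (by norm_num)).mono'
    (Continuous.aestronglyMeasurable
      (((Real.continuous_cos.comp (continuous_id.inner continuous_const)).neg).smul
        continuous_smulRight_self))
    (Eventually.of_forall fun k => ?_)
  rw [norm_smul, norm_neg, Real.norm_eq_abs, norm_smulRight_self]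
  exact mul_le_of_le_one_left (by positivity) (Real.abs_cos_le_one _)

/-- Differentiation under the integral, with the first moment as domination; in particular `gradient
φ` is a true gradient and not a default value. -/
lemma IsSpectralMeasure.gradient_eq (h : IsSpectralMeasure φ ν) (x : E) :
    gradient φ x = kernel ν x := by
  have := h.isFinite
  refine HasGradientAt.gradient (hasGradientAt_iff_hasFDerivAt.2 ?_)
  have hd := hasFDerivAt_integral_of_dominated_of_fderiv_le (μ := ν) (𝕜 := ℝ) (x₀ := x)
    (F := fun x k => Real.cos (inner ℝ k x))
    (F' := fun x k => -(Real.sin (inner ℝ k x)) • innerSL ℝ k)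
    (bound := fun k => ‖k‖ ^ 1) univ_mem
    (Eventually.of_forall fun y => Continuous.aestronglyMeasurable (by fun_prop))
    ((integrable_const (1 : ℝ)).mono' (Continuous.aestronglyMeasurable (by fun_prop))
      (Eventually.of_forall fun k => Real.abs_cos_le_one _))
    (Continuous.aestronglyMeasurable
      (((Real.continuous_sin.comp (continuous_id.inner continuous_const)).neg).smul
        (innerSL ℝ).continuous))
    (Eventually.of_forall fun k y _ => by
      rw [norm_smul, norm_neg, Real.norm_eq_abs, pow_one, innerSL_apply_norm]
      exact mul_le_of_le_one_left (norm_nonneg k) (Real.abs_sin_le_one _))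
    (h.integrable_norm_pow (by norm_num))
    (Eventually.of_forall fun k y _ => ((innerSL ℝ k).hasFDerivAt (x := y)).cos)
  rw [show φ = fun x => ∫ k, Real.cos (inner ℝ k x) ∂ν from funext h.eq_integral_cos]
  convert! hd using 1
  rw [kernel]
  have e := ((InnerProductSpace.toDual ℝ E).toContinuousLinearEquiv.toContinuousLinearMap
    ).integral_comp_comm (h.integrable_kernel x)
  refine e.symm.trans (integral_congr_ae (Eventually.of_forall fun k => ?_))
  ext z
  simp

lemma IsSpectralMeasure.hasFDerivAt_kernel (h : IsSpectralMeasure φ ν) (x : E) :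
    HasFDerivAt (kernel ν) (kernelDeriv ν x) x := by
  have := h.isFinite
  refine hasFDerivAt_integral_of_dominated_of_fderiv_le (μ := ν) (𝕜 := ℝ) (x₀ := x)
    (F := fun x k => -(Real.sin (inner ℝ k x)) • k)
    (F' := fun x k => -(Real.cos (inner ℝ k x)) • (innerSL ℝ k).smulRight k)
    (bound := fun k => ‖k‖ ^ 2) univ_mem
    (Eventually.of_forall fun y => Continuous.aestronglyMeasurable (by fun_prop))
    (h.integrable_kernel x) (h.integrable_kernelDeriv x).1
    (Eventually.of_forall fun k y _ => ?_) (h.integrable_norm_pow (by norm_num))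
    (Eventually.of_forall fun k y _ => ?_)
  · rw [norm_smul, norm_neg, Real.norm_eq_abs, norm_smulRight_self]
    exact mul_le_of_le_one_left (by positivity) (Real.abs_cos_le_one _)
  · have := (((innerSL ℝ k).hasFDerivAt (x := y)).sin.neg).smul_const k
    convert! this using 1
    ext z
    simp [smul_smul]

/-- Each derivative of the cosine costs one power of `‖k‖`: the kernel, its derivative and the
Lipschitz constant of the latter are bounded by the moments of order one, two and three. Their sum
serves as a common constant. -/
theorem IsSpectralMeasure.exists_isC1Kernel (h : IsSpectralMeasure φ ν) :
    ∃ c, IsC1Kernel (kernel ν) (kernelDeriv ν) c := by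
  set m : ℕ → ℝ := fun n => ∫ k, ‖k‖ ^ n ∂ν with hm
  have hm0 : ∀ n, 0 ≤ m n := fun n => integral_nonneg fun k => by positivity
  refine ⟨m 1 + m 2 + m 3, fun x => ?_, fun x => ?_, h.hasFDerivAt_kernel, fun x y => ?_⟩
  · have : ‖kernel ν x‖ ≤ m 1 := by
      refine norm_integral_le_of_norm_le (h.integrable_norm_pow (by norm_num))
        (Eventually.of_forall fun k => ?_)
      rw [norm_smul, norm_neg, Real.norm_eq_abs, pow_one]
      exact mul_le_of_le_one_left (norm_nonneg k) (Real.abs_sin_le_one _)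
    linarith [hm0 2, hm0 3]
  · have : ‖kernelDeriv ν x‖ ≤ m 2 := by
      refine norm_integral_le_of_norm_le (h.integrable_norm_pow (by norm_num))
        (Eventually.of_forall fun k => ?_)
      rw [norm_smul, norm_neg, Real.norm_eq_abs, norm_smulRight_self]
      exact mul_le_of_le_one_left (by positivity) (Real.abs_cos_le_one _)
    linarith [hm0 1, hm0 3]
  · have : ‖kernelDeriv ν x - kernelDeriv ν y‖ ≤ m 3 * ‖x - y‖ := by
      rw [kernelDeriv, kernelDeriv, ← integral_sub (h.integrable_kernelDeriv x)
        (h.integrable_kernelDeriv y), hm, ← integral_mul_const]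
      refine norm_integral_le_of_norm_le ((h.integrable_norm_pow (by norm_num)).mul_const _)
        (Eventually.of_forall fun k => ?_)
      rw [← sub_smul, norm_smul, norm_smulRight_self, neg_sub_neg, Real.norm_eq_abs]
      have h1 := Real.abs_cos_sub_cos_le (inner ℝ k y) (inner ℝ k x)
      rw [← inner_sub_right] at h1
      have h2 := h1.trans (abs_real_inner_le_norm k (y - x))
      rw [norm_sub_rev y x] at h2
      calc _ ≤ ‖k‖ * ‖x - y‖ * ‖k‖ ^ 2 := by gcongr
        _ = _ := by ring
    refine this.trans ?_
    gcongr
    linarith [hm0 1, hm0 2]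

end Kernel

/-! ### Line integrals of a kernel along a curve -/

section LineIntegral

variable {E : Type*} [NormedAddCommGroup E] [NormedSpace ℝ E]

variable {V W : Type*} [NormedAddCommGroup V] [NormedSpace ℝ V]
  [NormedAddCommGroup W] [NormedSpace ℝ W]

/-- The integral `∫ B(T(x - γ(ξ)), g(ξ)) dξ`. -/
def lineIntegral (B : V →L[ℝ] E →L[ℝ] W) (T : E → V) (γ g : ℝ → E) (x : E) : W :=
  ∫ ξ, B (T (x - γ ξ)) (g ξ) ∂unitMeasure

variable {B : V →L[ℝ] E →L[ℝ] W} {b : ℝ} {T : E → V} {c : ℝ} {γ γ' g g' : ℝ → E}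

lemma integrable_bilin {A : ℝ → V} (hA : Continuous A) {C : ℝ} (hC : ∀ ξ, ‖A ξ‖ ≤ C)
    (hg : Integrable g unitMeasure) : Integrable (fun ξ => B (A ξ) (g ξ)) unitMeasure := by
  refine (hg.norm.const_mul (‖B‖ * C)).mono'
    (B.aestronglyMeasurable_comp₂ hA.aestronglyMeasurable hg.1) (Eventually.of_forall fun ξ => ?_)
  exact B.le_of_opNorm₂_le_of_le le_rfl (hC ξ) le_rfl

lemma continuous_of_norm_sub_le {E V : Type*} [NormedAddCommGroup E] [NormedAddCommGroup V]
    {T : E → V} {c : ℝ} (hl : ∀ x y, ‖T x - T y‖ ≤ c * ‖x - y‖) : Continuous T :=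
  (LipschitzWith.of_dist_le' fun x y => by
    simpa only [dist_eq_norm] using hl x y : LipschitzWith _ T).continuous

lemma integrable_lineIntegral (hb : ∀ x, ‖T x‖ ≤ c) (hT : Continuous T) (hγ : Continuous γ)
    (hg : Integrable g unitMeasure) (x : E) :
    Integrable (fun ξ => B (T (x - γ ξ)) (g ξ)) unitMeasure :=
  integrable_bilin (hT.comp (continuous_const.sub hγ)) (fun _ => hb _) hg

lemma norm_lineIntegral_le (hb0 : 0 ≤ b) (hB : ∀ v w, ‖B v w‖ ≤ b * ‖v‖ * ‖w‖)
    (hb : ∀ x, ‖T x‖ ≤ c) (hg : Integrable g unitMeasure) (x : E) :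
    ‖lineIntegral B T γ g x‖ ≤ b * c * ∫ ξ, ‖g ξ‖ ∂unitMeasure := by
  rw [← integral_const_mul]
  refine norm_integral_le_of_norm_le (hg.norm.const_mul _) (Eventually.of_forall fun ξ =>
    (hB _ _).trans ?_)
  gcongr
  exact hb _

/-- The difference is split by bilinearity into a change of the kernel, measured uniformly, and a
change of the tangent, measured in `L¹`. The second term is harmless in the phase space, where the
tangents are controlled; the uniqueness proof needs the sharper bound for closed curves. -/
lemma norm_lineIntegral_sub_le (hb0 : 0 ≤ b) (hB : ∀ v w, ‖B v w‖ ≤ b * ‖v‖ * ‖w‖)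
    (hc : 0 ≤ c) (hb : ∀ x, ‖T x‖ ≤ c)
    (hl : ∀ x y, ‖T x - T y‖ ≤ c * ‖x - y‖) (hγ : Continuous γ) (hγ' : Continuous γ')
    (hg : Integrable g unitMeasure) (hg' : Integrable g' unitMeasure) {d : ℝ}
    (hd : ∀ ξ, ‖γ ξ - γ' ξ‖ ≤ d) (x x' : E) :
    ‖lineIntegral B T γ g x - lineIntegral B T γ' g' x'‖ ≤
      b * c * ((‖x - x'‖ + d) * (∫ ξ, ‖g ξ‖ ∂unitMeasure) +
        ∫ ξ, ‖g ξ - g' ξ‖ ∂unitMeasure) := by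
  have hT := continuous_of_norm_sub_le hl
  have hs : Integrable (fun ξ => ‖g ξ - g' ξ‖) unitMeasure := (hg.sub hg').norm
  rw [lineIntegral, lineIntegral, ← integral_sub (integrable_lineIntegral hb hT hγ hg x)
    (integrable_lineIntegral hb hT hγ' hg' x'), ← integral_const_mul,
    ← integral_add (hg.norm.const_mul _) hs, ← integral_const_mul]
  refine norm_integral_le_of_norm_le (((hg.norm.const_mul _).add hs).const_mul _)
    (Eventually.of_forall fun ξ => ?_)
  have e : B (T (x - γ ξ)) (g ξ) - B (T (x' - γ' ξ)) (g' ξ) =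
      B (T (x - γ ξ) - T (x' - γ' ξ)) (g ξ) + B (T (x' - γ' ξ)) (g ξ - g' ξ) := by
    simp only [map_sub, _root_.sub_apply]
    abel
  have h1 : ‖T (x - γ ξ) - T (x' - γ' ξ)‖ ≤ c * (‖x - x'‖ + d) := by
    refine (hl _ _).trans ?_
    gcongr
    rw [show x - γ ξ - (x' - γ' ξ) = (x - x') - (γ ξ - γ' ξ) by abel]
    exact (norm_sub_le _ _).trans (by gcongr; exact hd ξ)
  rw [e]
  calc _ ≤ b * (c * (‖x - x'‖ + d)) * ‖g ξ‖ + b * c * ‖g ξ - g' ξ‖ := by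
        refine (norm_add_le _ _).trans (add_le_add ((hB _ _).trans ?_) ((hB _ _).trans ?_))
        · gcongr
        · gcongr
          exact hb _
    _ = _ := by ring

/-- The bilinear map `(L, v) ↦ (h ↦ B(L h, v))`. -/
def derivBilin (B : E →L[ℝ] E →L[ℝ] E) : (E →L[ℝ] E) →L[ℝ] E →L[ℝ] (E →L[ℝ] E) :=
  ((ContinuousLinearMap.compL ℝ E E E).comp B.flip).flip

@[simp] lemma derivBilin_apply (B : E →L[ℝ] E →L[ℝ] E) (L : E →L[ℝ] E) (v h : E) :
    derivBilin B L v h = B (L h) v := rfl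

lemma norm_derivBilin_le (B : E →L[ℝ] E →L[ℝ] E) (L : E →L[ℝ] E) (v : E) :
    ‖derivBilin B L v‖ ≤ ‖B‖ * ‖L‖ * ‖v‖ := by
  refine ContinuousLinearMap.opNorm_le_bound _ (by positivity) fun h => ?_
  rw [derivBilin_apply]
  calc ‖B (L h) v‖ ≤ ‖B‖ * (‖L‖ * ‖h‖) * ‖v‖ :=
        B.le_of_opNorm₂_le_of_le le_rfl (L.le_opNorm h) le_rfl
    _ = _ := by ring

lemma IsC1Kernel.hasFDerivAt_lineIntegral {K : E → E} {DK : E → E →L[ℝ] E}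
    (h : IsC1Kernel K DK c) (B : E →L[ℝ] E →L[ℝ] E) (hγ : Continuous γ)
    (hg : Integrable g unitMeasure) (x : E) :
    HasFDerivAt (lineIntegral B K γ g) (lineIntegral (derivBilin B) DK γ g x) x := by
  have hK := continuous_of_norm_sub_le h.lipschitz
  have hDK := continuous_of_norm_sub_le h.lipschitz_deriv
  refine hasFDerivAt_integral_of_dominated_of_fderiv_le (𝕜 := ℝ)
    (bound := fun ξ => ‖B‖ * c * ‖g ξ‖)
    (F' := fun x ξ => derivBilin B (DK (x - γ ξ)) (g ξ)) univ_mem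
    (Eventually.of_forall fun y => (integrable_lineIntegral h.norm_le hK hγ hg y).1)
    (integrable_lineIntegral h.norm_le hK hγ hg x)
    (integrable_lineIntegral h.norm_deriv_le hDK hγ hg x).1
    (Eventually.of_forall fun ξ y _ =>
      (norm_derivBilin_le B _ _).trans (by gcongr; exact h.norm_deriv_le _))
    (hg.norm.const_mul _) (Eventually.of_forall fun ξ y _ => ?_)
  have h1 : HasFDerivAt (fun y => K (y - γ ξ)) (DK (y - γ ξ)) y :=
    (h.hasFDerivAt (y - γ ξ)).comp y ((hasFDerivAt_id y).sub_const (γ ξ))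
  have h2 : HasFDerivAt (fun v => B v (g ξ)) (B.flip (g ξ)) (K (y - γ ξ)) :=
    (B.flip (g ξ)).hasFDerivAt
  exact HasFDerivAt.comp y h2 h1

end LineIntegral

/-! ### Cutoff of a locally Lipschitz vector field -/

section Cutoff

/-- A Lipschitz cutoff equal to `1` for `r ≤ R` and to `0` for `r ≥ R + 1`. -/
def cutoff (R r : ℝ) : ℝ := max 0 (min 1 (R + 1 - r))

lemma cutoff_nonneg (R r : ℝ) : 0 ≤ cutoff R r := le_max_left _ _

lemma cutoff_le_one (R r : ℝ) : cutoff R r ≤ 1 := max_le zero_le_one (min_le_left _ _)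

lemma cutoff_eq_one {R r : ℝ} (h : r ≤ R) : cutoff R r = 1 := by
  rw [cutoff, min_eq_left (by linarith), max_eq_right zero_le_one]

lemma cutoff_eq_zero {R r : ℝ} (h : R + 1 ≤ r) : cutoff R r = 0 := by
  rw [cutoff, min_eq_right (by linarith), max_eq_left (by linarith)]

lemma abs_cutoff_sub_le (R r s : ℝ) : |cutoff R r - cutoff R s| ≤ |r - s| := by
  have h1 := abs_max_sub_max_le_max (0 : ℝ) (min 1 (R + 1 - r)) 0 (min 1 (R + 1 - s))
  have h2 := abs_min_sub_min_le_max (1 : ℝ) (R + 1 - r) 1 (R + 1 - s)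
  simp only [sub_self, abs_zero] at h1 h2
  rw [show R + 1 - r - (R + 1 - s) = -(r - s) by ring, abs_neg] at h2
  rw [max_eq_right (abs_nonneg _)] at h2
  exact h1.trans (max_le (abs_nonneg _) h2)

variable {X : Type*} [NormedAddCommGroup X] [NormedSpace ℝ X]

/-- In the constant `B + L`, the term `B` comes from the cutoff, which is 1-Lipschitz, and `L` from
`F`. The difference is split so that `F` is estimated only at points of the ball; two points outside
it contribute nothing. -/
lemma norm_cutoff_smul_sub_le {F : X → X} {R B L : ℝ} (hL0 : 0 ≤ L)
    (hB : ∀ p, ‖p‖ ≤ R + 1 → ‖F p‖ ≤ B)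
    (hL : ∀ p q, ‖p‖ ≤ R + 1 → ‖q‖ ≤ R + 1 → ‖F p - F q‖ ≤ L * ‖p - q‖) (hB0 : 0 ≤ B) (p q : X) :
    ‖cutoff R ‖p‖ • F p - cutoff R ‖q‖ • F q‖ ≤ (B + L) * ‖p - q‖ := by
  have key : ∀ p q : X, ‖p‖ ≤ R + 1 → (R + 1 ≤ ‖q‖ ∨ ‖q‖ ≤ R + 1) →
      ‖cutoff R ‖p‖ • F p - cutoff R ‖q‖ • F q‖ ≤ (B + L) * ‖p - q‖ := fun p q hp hq => by
    have h1 : ‖(cutoff R ‖p‖ - cutoff R ‖q‖) • F p‖ ≤ B * ‖p - q‖ := by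
      rw [norm_smul, mul_comm, Real.norm_eq_abs]
      exact mul_le_mul (hB p hp) ((abs_cutoff_sub_le _ _ _).trans (abs_norm_sub_norm_le p q))
        (abs_nonneg _) hB0
    have h2 : ‖cutoff R ‖q‖ • (F p - F q)‖ ≤ L * ‖p - q‖ := by
      rcases hq with hq | hq
      · rw [cutoff_eq_zero hq, zero_smul, norm_zero]
        positivity
      · rw [norm_smul, Real.norm_eq_abs, abs_of_nonneg (cutoff_nonneg _ _)]
        exact (mul_le_of_le_one_left (norm_nonneg _) (cutoff_le_one _ _)).trans (hL p q hp hq)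
    rw [show cutoff R ‖p‖ • F p - cutoff R ‖q‖ • F q =
      (cutoff R ‖p‖ - cutoff R ‖q‖) • F p + cutoff R ‖q‖ • (F p - F q) by
        rw [sub_smul, smul_sub]; abel, add_mul]
    exact (norm_add_le _ _).trans (add_le_add h1 h2)
  rcases le_total ‖p‖ (R + 1) with hp | hp
  · exact key p q hp (le_total _ _)
  · rcases le_total ‖q‖ (R + 1) with hq | hq
    · rw [norm_sub_rev, norm_sub_rev p q]
      exact key q p hq (le_total _ _)
    · rw [cutoff_eq_zero hp, cutoff_eq_zero hq, zero_smul, zero_smul, sub_self, norm_zero]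
      positivity

lemma norm_cutoff_smul_le {F : X → X} {R B : ℝ} (hB : ∀ p, ‖p‖ ≤ R + 1 → ‖F p‖ ≤ B)
    (hB0 : 0 ≤ B) (p : X) : ‖cutoff R ‖p‖ • F p‖ ≤ B := by
  rcases le_total ‖p‖ (R + 1) with hp | hp
  · rw [norm_smul, Real.norm_eq_abs, abs_of_nonneg (cutoff_nonneg _ _)]
    exact (mul_le_of_le_one_left (norm_nonneg _) (cutoff_le_one _ _)).trans (hB p hp)
  · rwa [cutoff_eq_zero hp, zero_smul, norm_zero]

/-- A vector field bounded and Lipschitz on a ball, cut off outside, has integral curves on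
arbitrarily long intervals. -/
lemma exists_integralCurve_cutoff [CompleteSpace X] {F : X → X} {R B L : ℝ} (hL0 : 0 ≤ L)
    (hB : ∀ p, ‖p‖ ≤ R + 1 → ‖F p‖ ≤ B)
    (hL : ∀ p q, ‖p‖ ≤ R + 1 → ‖q‖ ≤ R + 1 → ‖F p - F q‖ ≤ L * ‖p - q‖) (hB0 : 0 ≤ B)
    (x₀ : X) {T : ℝ} (hT : 0 ≤ T) :
    ∃ α : ℝ → X, α 0 = x₀ ∧
      ∀ t ∈ Ioo (-1) (T + 1), HasDerivAt α (cutoff R ‖α t‖ • F (α t)) t := by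
  have h0 : (0 : ℝ) ∈ Icc (-1) (T + 1) := ⟨by linarith, by linarith⟩
  -- The cut-off field is bounded by `B` everywhere, so a ball of radius `B (T + 1)` is not left and
  -- the time interval may be chosen at will. The margin of one on each side makes `[0,T]` interior,
  -- which yields two-sided derivatives.
  have hPL : IsPicardLindelof (fun _ p => cutoff R ‖p‖ • F p) (tmin := -1) (tmax := T + 1)
      ⟨0, h0⟩ x₀ (Real.toNNReal (B * (T + 1))) 0 (Real.toNNReal B) (Real.toNNReal (B + L)) := by
    refine .of_time_independent (fun p _ => ?_) ?_ ?_
    · rw [Real.coe_toNNReal _ hB0]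
      exact norm_cutoff_smul_le hB hB0 p
    · refine LipschitzOnWith.of_dist_le_mul fun p _ q _ => ?_
      rw [dist_eq_norm, dist_eq_norm, Real.coe_toNNReal _ (by positivity)]
      exact norm_cutoff_smul_sub_le hL0 hB hL hB0 p q
    · rw [Real.coe_toNNReal _ hB0, Real.coe_toNNReal _ (by positivity)]
      simp only [sub_zero, zero_sub, neg_neg, NNReal.coe_zero]
      rw [max_eq_left (by linarith)]
  obtain ⟨α, hα0, hα⟩ := hPL.exists_eq_forall_mem_Icc_hasDerivWithinAt₀
  exact ⟨α, hα0, fun t ht => (hα t (Ioo_subset_Icc_self ht)).hasDerivAt (Icc_mem_nhds ht.1 ht.2)⟩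

end Cutoff

/-! ### The phase space of curves with frames -/

section PhaseSpace

open BoundedContinuousFunction

variable {E : Type*} [NormedAddCommGroup E] [NormedSpace ℝ E]

/-- Pairs of a curve `γ` and a field `M` of linear maps along it. -/
def CurveFrame (E : Type*) [NormedAddCommGroup E] [NormedSpace ℝ E] : Type _ :=
  (ℝ →ᵇ E) × (ℝ →ᵇ (E →L[ℝ] E))

instance : NormedAddCommGroup (CurveFrame E) :=
  inferInstanceAs (NormedAddCommGroup ((ℝ →ᵇ E) × (ℝ →ᵇ (E →L[ℝ] E))))

instance : NormedSpace ℝ (CurveFrame E) :=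
  inferInstanceAs (NormedSpace ℝ ((ℝ →ᵇ E) × (ℝ →ᵇ (E →L[ℝ] E))))

instance [CompleteSpace E] : CompleteSpace (CurveFrame E) :=
  inferInstanceAs (CompleteSpace ((ℝ →ᵇ E) × (ℝ →ᵇ (E →L[ℝ] E))))

namespace CurveFrame

/-- The curve of a pair `(γ, M)`. -/
def curve (p : CurveFrame E) : ℝ →ᵇ E := Prod.fst p

/-- The linear maps of a pair `(γ, M)`. -/
def frame (p : CurveFrame E) : ℝ →ᵇ (E →L[ℝ] E) := Prod.snd p

/-- The pair `(γ, M)`. -/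
def mk (γ : ℝ →ᵇ E) (M : ℝ →ᵇ (E →L[ℝ] E)) : CurveFrame E := (γ, M)

lemma norm_curve_apply_le (p : CurveFrame E) (ξ : ℝ) : ‖p.curve ξ‖ ≤ ‖p‖ :=
  (p.curve.norm_coe_le_norm ξ).trans (le_max_left _ _)

lemma norm_frame_apply_le (p : CurveFrame E) (ξ : ℝ) : ‖p.frame ξ‖ ≤ ‖p‖ :=
  (p.frame.norm_coe_le_norm ξ).trans (le_max_right _ _)

lemma norm_le {p : CurveFrame E} {C : ℝ} (hC : 0 ≤ C) (h1 : ∀ ξ, ‖p.curve ξ‖ ≤ C)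
    (h2 : ∀ ξ, ‖p.frame ξ‖ ≤ C) : ‖p‖ ≤ C :=
  max_le ((BoundedContinuousFunction.norm_le hC).2 h1)
    ((BoundedContinuousFunction.norm_le hC).2 h2)

@[simp] lemma curve_zero_apply (ξ : ℝ) : (0 : CurveFrame E).curve ξ = 0 := rfl

@[simp] lemma frame_zero_apply (ξ : ℝ) : (0 : CurveFrame E).frame ξ = 0 := rfl

@[simp] lemma curve_add_apply (p q : CurveFrame E) (ξ : ℝ) :
    (p + q).curve ξ = p.curve ξ + q.curve ξ := rfl

@[simp] lemma frame_add_apply (p q : CurveFrame E) (ξ : ℝ) :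
    (p + q).frame ξ = p.frame ξ + q.frame ξ := rfl

@[simp] lemma curve_smul_apply (r : ℝ) (p : CurveFrame E) (ξ : ℝ) :
    (r • p).curve ξ = r • p.curve ξ := rfl

@[simp] lemma frame_smul_apply (r : ℝ) (p : CurveFrame E) (ξ : ℝ) :
    (r • p).frame ξ = r • p.frame ξ := rfl

/-- Evaluation of the curve at `ξ`. -/
def evalCurve (ξ : ℝ) : CurveFrame E →L[ℝ] E :=
  LinearMap.mkContinuous ⟨⟨fun p => p.curve ξ, fun _ _ => rfl⟩, fun _ _ => rfl⟩ 1 fun p => by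
    rw [one_mul]
    exact p.norm_curve_apply_le ξ

/-- Evaluation of the frame at `ξ`. -/
def evalFrame (ξ : ℝ) : CurveFrame E →L[ℝ] (E →L[ℝ] E) :=
  LinearMap.mkContinuous ⟨⟨fun p => p.frame ξ, fun _ _ => rfl⟩, fun _ _ => rfl⟩ 1 fun p => by
    rw [one_mul]
    exact p.norm_frame_apply_le ξ

end CurveFrame

/-- The velocity `M g₀` of the curve. -/
def tangent (g₀ : ℝ → E) (p : CurveFrame E) (ξ : ℝ) : E := p.frame ξ (g₀ ξ)

variable {g₀ : ℝ → E}

lemma norm_tangent_le (p : CurveFrame E) (ξ : ℝ) : ‖tangent g₀ p ξ‖ ≤ ‖p‖ * ‖g₀ ξ‖ :=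
  (p.frame ξ).le_of_opNorm_le (p.norm_frame_apply_le ξ) _

lemma norm_tangent_sub_le (p q : CurveFrame E) (ξ : ℝ) :
    ‖tangent g₀ p ξ - tangent g₀ q ξ‖ ≤ ‖p - q‖ * ‖g₀ ξ‖ :=
  norm_tangent_le (p - q) ξ

lemma integrable_tangent (hg₀ : Integrable g₀ unitMeasure) (p : CurveFrame E) :
    Integrable (tangent g₀ p) unitMeasure :=
  integrable_clm_apply hg₀ p.frame.continuous.continuousOn

lemma integral_norm_tangent_le (hg₀ : Integrable g₀ unitMeasure) (p : CurveFrame E) :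
    ∫ ξ, ‖tangent g₀ p ξ‖ ∂unitMeasure ≤ ‖p‖ * ∫ ξ, ‖g₀ ξ‖ ∂unitMeasure := by
  rw [← integral_const_mul]
  exact integral_mono (integrable_tangent hg₀ p).norm (hg₀.norm.const_mul _) (norm_tangent_le p)

lemma integral_norm_tangent_sub_le (hg₀ : Integrable g₀ unitMeasure) (p q : CurveFrame E) :
    ∫ ξ, ‖tangent g₀ p ξ - tangent g₀ q ξ‖ ∂unitMeasure ≤
      ‖p - q‖ * ∫ ξ, ‖g₀ ξ‖ ∂unitMeasure := by
  rw [← integral_const_mul]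
  exact integral_mono ((integrable_tangent hg₀ p).sub (integrable_tangent hg₀ q)).norm
    (hg₀.norm.const_mul _) (norm_tangent_sub_le p q)

/-- The pairs `(γ, M)` with `γ` closed and `γ_ξ = M g₀`. -/
def phaseSpace (g₀ : ℝ → E) : Submodule ℝ (CurveFrame E) where
  carrier := {p | Function.Periodic p.curve 1 ∧ IsPrimitive p.curve (tangent g₀ p)}
  zero_mem' := ⟨fun ξ => rfl, by
    have : tangent g₀ (0 : CurveFrame E) = fun _ => 0 := by
      ext1 ξ
      simp [tangent]
    rw [this]
    exact ⟨integrable_zero _ _ _, fun ξ _ => by simp⟩⟩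
  add_mem' := fun {p q} hp hq => ⟨hp.1.add hq.1, by
    have : tangent g₀ (p + q) = fun ξ => tangent g₀ p ξ - (-1 : ℝ) • tangent g₀ q ξ := by
      ext1 ξ
      simp [tangent]
    refine ⟨?_, fun ξ hξ => ?_⟩
    · rw [this]
      exact hp.2.integrable.sub (hq.2.integrable.smul (-1 : ℝ))
    · have h0 : (0 : ℝ) ∈ Icc (0 : ℝ) 1 := ⟨le_rfl, zero_le_one⟩
      have e : ∫ s in (0 : ℝ)..ξ, tangent g₀ (p + q) s =
          (∫ s in (0 : ℝ)..ξ, tangent g₀ p s) + ∫ s in (0 : ℝ)..ξ, tangent g₀ q s :=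
        intervalIntegral.integral_add (hp.2.intervalIntegrable h0 hξ)
          (hq.2.intervalIntegrable h0 hξ)
      have ep := hp.2.eq_add_integral ξ hξ
      have eq := hq.2.eq_add_integral ξ hξ
      rw [e]
      rw [CurveFrame.curve_add_apply, CurveFrame.curve_add_apply, ep, eq]
      abel⟩
  smul_mem' := fun r p hp => ⟨fun ξ => by
      simpa using congrArg (fun v => r • v) (hp.1 ξ), by
    have : tangent g₀ (r • p) = fun ξ => r • tangent g₀ p ξ := by
      ext1 ξ
      simp [tangent]
    refine ⟨?_, fun ξ hξ => ?_⟩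
    · rw [this]
      exact hp.2.integrable.smul r
    · rw [this, intervalIntegral.integral_smul]
      rw [CurveFrame.curve_smul_apply, CurveFrame.curve_smul_apply, hp.2.eq_add_integral ξ hξ, smul_add]⟩

lemma mem_phaseSpace {p : CurveFrame E} : p ∈ phaseSpace g₀ ↔
    Function.Periodic p.curve 1 ∧ IsPrimitive p.curve (tangent g₀ p) := Iff.rfl

/-- Evaluations are continuous, and the integral of the tangent is Lipschitz in `p` because `g₀` is
integrable. Closedness supplies the completeness that Picard–Lindelöf requires. -/
lemma isClosed_phaseSpace (hg₀ : Integrable g₀ unitMeasure) :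
    IsClosed (phaseSpace g₀ : Set (CurveFrame E)) := by
  have hev : ∀ ξ : ℝ, Continuous fun p : CurveFrame E => p.curve ξ := fun ξ =>
    (CurveFrame.evalCurve ξ).continuous
  have hint : ∀ ξ ∈ Icc (0 : ℝ) 1,
      Continuous fun p : CurveFrame E => ∫ s in (0 : ℝ)..ξ, tangent g₀ p s := fun ξ hξ => by
    have hi : ∀ p, IntervalIntegrable (tangent g₀ p) volume 0 ξ := fun p =>
      (integrable_unitMeasure_iff.1 (integrable_tangent hg₀ p)).mono_set (by
        rw [uIcc_of_le zero_le_one, uIcc_of_le hξ.1]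
        exact Icc_subset_Icc_right hξ.2)
    have hi₀ : IntervalIntegrable g₀ volume 0 ξ :=
      (integrable_unitMeasure_iff.1 hg₀).mono_set (by
        rw [uIcc_of_le zero_le_one, uIcc_of_le hξ.1]
        exact Icc_subset_Icc_right hξ.2)
    refine (LipschitzWith.of_dist_le' (K := ∫ s in (0 : ℝ)..ξ, ‖g₀ s‖) fun p q => ?_).continuous
    rw [dist_eq_norm (∫ s in (0 : ℝ)..ξ, tangent g₀ p s), dist_eq_norm p q, ← intervalIntegral.integral_sub (hi p) (hi q), mul_comm,
      ← intervalIntegral.integral_const_mul]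
    exact intervalIntegral.norm_integral_le_of_norm_le hξ.1
      (Eventually.of_forall fun s _ => norm_tangent_sub_le p q s) (hi₀.norm.const_mul _)
  have : (phaseSpace g₀ : Set (CurveFrame E)) =
      (⋂ ξ : ℝ, {p : CurveFrame E | p.curve (ξ + 1) = p.curve ξ}) ∩
        ⋂ ξ ∈ Icc (0 : ℝ) 1, {p : CurveFrame E | p.curve ξ = p.curve 0 + ∫ s in (0 : ℝ)..ξ, tangent g₀ p s} := by
    ext p
    simp only [SetLike.mem_coe, mem_phaseSpace, mem_inter_iff, mem_iInter, mem_ofPred_eq]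
    exact and_congr Iff.rfl ⟨fun h => h.eq_add_integral, fun h => ⟨integrable_tangent hg₀ p, h⟩⟩
  rw [this]
  exact (isClosed_iInter fun ξ => isClosed_eq (hev _) (hev _)).inter
    (isClosed_biInter fun ξ hξ => isClosed_eq (hev _) ((hev _).add (hint ξ hξ)))

end PhaseSpace

/-! ### The vector field on the phase space -/

section Field

open BoundedContinuousFunction

variable {E : Type*} [NormedAddCommGroup E] [NormedSpace ℝ E]
  {K : E → E} {DK : E → E →L[ℝ] E} {c : ℝ} {g₀ : ℝ → E}

/-- The velocity generated by the curve of `p`. -/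
def flowVelocity (A : E →L[ℝ] E →L[ℝ] E) (K : E → E) (g₀ : ℝ → E) (p : CurveFrame E) (x : E) : E :=
  lineIntegral A K p.curve (tangent g₀ p) x

/-- The spatial derivative of `flowVelocity`. -/
def flowGradient (A : E →L[ℝ] E →L[ℝ] E)
    (DK : E → E →L[ℝ] E) (g₀ : ℝ → E) (p : CurveFrame E) (x : E) : E →L[ℝ] E :=
  lineIntegral (derivBilin A) DK p.curve (tangent g₀ p) x

/-- The constant in the bounds on `flowVelocity`. -/
def fieldConst (A : E →L[ℝ] E →L[ℝ] E) (c : ℝ) (g₀ : ℝ → E) : ℝ := ‖A‖ * c * ∫ ξ, ‖g₀ ξ‖ ∂unitMeasure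

lemma fieldConst_nonneg (A : E →L[ℝ] E →L[ℝ] E) (hc : 0 ≤ c) : 0 ≤ fieldConst A c g₀ :=
  mul_nonneg (mul_nonneg (norm_nonneg A) hc) (integral_nonneg fun _ => norm_nonneg _)

section Bounds

variable {A : E →L[ℝ] E →L[ℝ] E} {V W : Type*} [NormedAddCommGroup V] [NormedSpace ℝ V]
  [NormedAddCommGroup W] [NormedSpace ℝ W] {B : V →L[ℝ] E →L[ℝ] W} {T : E → V}

/-- Stated for a general `B` and `T`, so that the velocity (`A`, `K`) and its gradient (`derivBilin
A`, `DK`) are covered at once; the same holds for the difference estimate that follows. -/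
lemma norm_lineIntegral_tangent_le (hB : ∀ v w, ‖B v w‖ ≤ ‖A‖ * ‖v‖ * ‖w‖)
    (hg₀ : Integrable g₀ unitMeasure) (hc : 0 ≤ c) (hb : ∀ x, ‖T x‖ ≤ c) {p : CurveFrame E} {R : ℝ}
    (hp : ‖p‖ ≤ R) (x : E) :
    ‖lineIntegral B T p.curve (tangent g₀ p) x‖ ≤ fieldConst A c g₀ * R := by
  refine (norm_lineIntegral_le (norm_nonneg A) hB hb (integrable_tangent hg₀ p) x).trans ?_
  calc _ ≤ ‖A‖ * c * (R * ∫ ξ, ‖g₀ ξ‖ ∂unitMeasure) := by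
        gcongr
        exact (integral_norm_tangent_le hg₀ p).trans (mul_le_mul_of_nonneg_right hp
          (integral_nonneg fun _ => norm_nonneg _))
    _ = _ := by rw [fieldConst]; ring

lemma norm_lineIntegral_tangent_sub_le (hB : ∀ v w, ‖B v w‖ ≤ ‖A‖ * ‖v‖ * ‖w‖)
    (hg₀ : Integrable g₀ unitMeasure) (hc : 0 ≤ c) (hb : ∀ x, ‖T x‖ ≤ c)
    (hl : ∀ x y, ‖T x - T y‖ ≤ c * ‖x - y‖) {p : CurveFrame E} {R : ℝ} (hp : ‖p‖ ≤ R)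
    (q : CurveFrame E) (x y : E) :
    ‖lineIntegral B T p.curve (tangent g₀ p) x - lineIntegral B T q.curve (tangent g₀ q) y‖ ≤
      fieldConst A c g₀ * ((‖x - y‖ + ‖p - q‖) * R + ‖p - q‖) := by
  refine (norm_lineIntegral_sub_le (norm_nonneg A) hB hc hb hl p.curve.continuous q.curve.continuous
    (integrable_tangent hg₀ p) (integrable_tangent hg₀ q) (d := ‖p - q‖)
    (fun ξ => (p - q).norm_curve_apply_le ξ) x y).trans ?_
  calc _ ≤ ‖A‖ * c * ((‖x - y‖ + ‖p - q‖) * (R * ∫ ξ, ‖g₀ ξ‖ ∂unitMeasure) +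
        ‖p - q‖ * ∫ ξ, ‖g₀ ξ‖ ∂unitMeasure) := by
        gcongr
        · exact (integral_norm_tangent_le hg₀ p).trans (mul_le_mul_of_nonneg_right hp
            (integral_nonneg fun _ => norm_nonneg _))
        · exact integral_norm_tangent_sub_le hg₀ p q
    _ = _ := by rw [fieldConst]; ring

end Bounds

lemma IsC1Kernel.continuous_deriv (h : IsC1Kernel K DK c) : Continuous DK :=
  continuous_of_norm_sub_le h.lipschitz_deriv

lemma IsC1Kernel.hasFDerivAt_flowVelocity (h : IsC1Kernel K DK c) (A : E →L[ℝ] E →L[ℝ] E)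
    (hg₀ : Integrable g₀ unitMeasure) (p : CurveFrame E) (x : E) :
    HasFDerivAt (flowVelocity A K g₀ p) (flowGradient A DK g₀ p x) x :=
  h.hasFDerivAt_lineIntegral A p.curve.continuous (integrable_tangent hg₀ p) x

lemma IsC1Kernel.continuous_flowGradient (h : IsC1Kernel K DK c) (A : E →L[ℝ] E →L[ℝ] E)
    (hg₀ : Integrable g₀ unitMeasure) (p : CurveFrame E) : Continuous (flowGradient A DK g₀ p) := by
  refine continuous_of_norm_sub_le (c := fieldConst A c g₀ * ‖p‖) fun x y => ?_
  have := norm_lineIntegral_tangent_sub_le (norm_derivBilin_le A) hg₀ h.nonneg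
    h.norm_deriv_le h.lipschitz_deriv (le_refl ‖p‖) p x y
  rw [sub_self, norm_zero, add_zero, add_zero] at this
  rw [mul_assoc, mul_comm ‖p‖]
  exact this

lemma IsC1Kernel.contDiff_flowVelocity (h : IsC1Kernel K DK c) (A : E →L[ℝ] E →L[ℝ] E)
    (hg₀ : Integrable g₀ unitMeasure) (p : CurveFrame E) : ContDiff ℝ 1 (flowVelocity A K g₀ p) := by
  rw [contDiff_one_iff_fderiv]
  refine ⟨fun x => (h.hasFDerivAt_flowVelocity A hg₀ p x).differentiableAt, ?_⟩
  rw [show fderiv ℝ (flowVelocity A K g₀ p) = flowGradient A DK g₀ p from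
    funext fun x => (h.hasFDerivAt_flowVelocity A hg₀ p x).fderiv]
  exact h.continuous_flowGradient A hg₀ p

/-- The vector field `(γ, M) ↦ (u(γ), ∇u(γ) M)`. -/
def curveField (A : E →L[ℝ] E →L[ℝ] E) (h : IsC1Kernel K DK c)
    (hg₀ : Integrable g₀ unitMeasure) (p : CurveFrame E) :
    CurveFrame E :=
  .mk (ofNormedAddCommGroup (fun ξ => flowVelocity A K g₀ p (p.curve ξ))
    ((h.contDiff_flowVelocity A hg₀ p).continuous.comp p.curve.continuous) (fieldConst A c g₀ * ‖p‖)
    fun _ => norm_lineIntegral_tangent_le A.le_opNorm₂ hg₀ h.nonneg h.norm_le le_rfl _)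
   (ofNormedAddCommGroup (fun ξ => (flowGradient A DK g₀ p (p.curve ξ)).comp (p.frame ξ))
    (((h.continuous_flowGradient A hg₀ p).comp p.curve.continuous).clm_comp p.frame.continuous)
    (fieldConst A c g₀ * ‖p‖ * ‖p‖) fun ξ => (ContinuousLinearMap.opNorm_comp_le _ _).trans
      (mul_le_mul (norm_lineIntegral_tangent_le (norm_derivBilin_le A) hg₀ h.nonneg
        h.norm_deriv_le le_rfl _) (p.norm_frame_apply_le ξ)
        (norm_nonneg _) (mul_nonneg (fieldConst_nonneg A h.nonneg) (norm_nonneg _))))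

lemma norm_curveField_le (A : E →L[ℝ] E →L[ℝ] E) (h : IsC1Kernel K DK c)
    (hg₀ : Integrable g₀ unitMeasure)
    {p : CurveFrame E} {R : ℝ} (hp : ‖p‖ ≤ R) :
    ‖curveField A h hg₀ p‖ ≤ fieldConst A c g₀ * R * (1 + R) := by
  have hR : 0 ≤ R := (norm_nonneg p).trans hp
  have hf := fieldConst_nonneg (g₀ := g₀) A h.nonneg
  refine CurveFrame.norm_le (by positivity) (fun ξ => ?_) fun ξ => ?_
  · refine (norm_lineIntegral_tangent_le A.le_opNorm₂ hg₀ h.nonneg h.norm_le hp _).trans ?_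
    exact le_mul_of_one_le_right (by positivity) (by linarith)
  · refine (ContinuousLinearMap.opNorm_comp_le _ _).trans ?_
    exact mul_le_mul (norm_lineIntegral_tangent_le (norm_derivBilin_le A) hg₀ h.nonneg
        h.norm_deriv_le hp _) (((p.norm_frame_apply_le ξ).trans hp).trans
        (by linarith)) (norm_nonneg _) (by positivity)

/-- The frame component is the product `∇u(γ) M`, so the field grows quadratically and is Lipschitz
on balls only. Lipschitz continuity of `DK` enters through `∇u`. -/
lemma norm_curveField_sub_le (A : E →L[ℝ] E →L[ℝ] E) (h : IsC1Kernel K DK c)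
    (hg₀ : Integrable g₀ unitMeasure)
    {p q : CurveFrame E} {R : ℝ} (hp : ‖p‖ ≤ R) (hq : ‖q‖ ≤ R) :
    ‖curveField A h hg₀ p - curveField A h hg₀ q‖ ≤
      fieldConst A c g₀ * (1 + 2 * R) * (1 + R) * ‖p - q‖ := by
  have hR : 0 ≤ R := (norm_nonneg p).trans hp
  have hf := fieldConst_nonneg (g₀ := g₀) A h.nonneg
  have h1 : ∀ ξ, ‖p.curve ξ - q.curve ξ‖ ≤ ‖p - q‖ := fun ξ =>
    (p - q).norm_curve_apply_le ξ
  have h2 : ∀ ξ, ‖p.frame ξ - q.frame ξ‖ ≤ ‖p - q‖ := fun ξ =>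
    (p - q).norm_frame_apply_le ξ
  have key : ∀ ξ, fieldConst A c g₀ * ((‖p.curve ξ - q.curve ξ‖ + ‖p - q‖) * R + ‖p - q‖) ≤
      fieldConst A c g₀ * (1 + 2 * R) * ‖p - q‖ := fun ξ => by
    calc _ ≤ fieldConst A c g₀ * ((‖p - q‖ + ‖p - q‖) * R + ‖p - q‖) := by gcongr; exact h1 ξ
      _ = _ := by ring
  refine CurveFrame.norm_le (by positivity) (fun ξ => ?_) fun ξ => ?_
  · refine (norm_lineIntegral_tangent_sub_le A.le_opNorm₂ hg₀ h.nonneg h.norm_le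
      h.lipschitz hp q (p.curve ξ) (q.curve ξ)).trans ((key ξ).trans ?_)
    rw [mul_right_comm _ (1 + R)]
    exact le_mul_of_one_le_right (by positivity) (by linarith)
  · have e : (flowGradient A DK g₀ p (p.curve ξ)).comp (p.frame ξ) -
        (flowGradient A DK g₀ q (q.curve ξ)).comp (q.frame ξ) =
        (flowGradient A DK g₀ p (p.curve ξ) - flowGradient A DK g₀ q (q.curve ξ)).comp (p.frame ξ) +
        (flowGradient A DK g₀ q (q.curve ξ)).comp (p.frame ξ - q.frame ξ) := by
      rw [ContinuousLinearMap.sub_comp, ContinuousLinearMap.comp_sub]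
      abel
    refine (le_of_eq (congrArg norm e)).trans ((norm_add_le _ _).trans ?_)
    have e1 : ‖(flowGradient A DK g₀ p (p.curve ξ) - flowGradient A DK g₀ q (q.curve ξ)).comp (p.frame ξ)‖ ≤
        fieldConst A c g₀ * (1 + 2 * R) * ‖p - q‖ * R := by
      refine (ContinuousLinearMap.opNorm_comp_le _ _).trans (mul_le_mul
        ((norm_lineIntegral_tangent_sub_le (norm_derivBilin_le A) hg₀ h.nonneg
          h.norm_deriv_le h.lipschitz_deriv hp q (p.curve ξ) (q.curve ξ)).trans (key ξ))
        ((p.norm_frame_apply_le ξ).trans hp) (norm_nonneg _)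
        (by positivity))
    have e2 : ‖(flowGradient A DK g₀ q (q.curve ξ)).comp (p.frame ξ - q.frame ξ)‖ ≤
        fieldConst A c g₀ * R * ‖p - q‖ :=
      (ContinuousLinearMap.opNorm_comp_le _ _).trans (mul_le_mul
        (norm_lineIntegral_tangent_le (norm_derivBilin_le A) hg₀ h.nonneg
          h.norm_deriv_le hq _) (h2 ξ) (norm_nonneg _) (by positivity))
    calc _ ≤ fieldConst A c g₀ * (1 + 2 * R) * ‖p - q‖ * R + fieldConst A c g₀ * R * ‖p - q‖ :=
          add_le_add e1 e2
      _ ≤ fieldConst A c g₀ * (1 + 2 * R) * ‖p - q‖ * R +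
          fieldConst A c g₀ * (1 + 2 * R) * ‖p - q‖ := by gcongr; linarith
      _ = _ := by ring

/-- By the chain rule `(u ∘ γ)_ξ = ∇u(γ) γ_ξ = (∇u(γ) M) g₀`, which is the frame component applied
to `g₀`. This is why `M` evolves by `∇u(γ) M`. -/
lemma curveField_mem_phaseSpace [CompleteSpace E] (A : E →L[ℝ] E →L[ℝ] E) (h : IsC1Kernel K DK c)
    (hg₀ : Integrable g₀ unitMeasure)
    {p : CurveFrame E} (hp : p ∈ phaseSpace g₀) : curveField A h hg₀ p ∈ phaseSpace g₀ := by
  refine ⟨fun ξ => congrArg (flowVelocity A K g₀ p) (hp.1 ξ), ?_⟩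
  have hc := hp.2.comp (h.contDiff_flowVelocity A hg₀ p)
  simp only [(h.hasFDerivAt_flowVelocity A hg₀ p _).fderiv] at hc
  exact hc

/-- The restriction of `curveField` to the phase space. -/
def phaseField [CompleteSpace E] (A : E →L[ℝ] E →L[ℝ] E) (h : IsC1Kernel K DK c)
    (hg₀ : Integrable g₀ unitMeasure) (p : phaseSpace g₀) :
    phaseSpace g₀ := ⟨curveField A h hg₀ p, curveField_mem_phaseSpace A h hg₀ p.2⟩

/-- An integral curve in phase space of the field, slowed down by a cutoff. -/
theorem exists_cutoff_flow [CompleteSpace E] (A : E →L[ℝ] E →L[ℝ] E) (h : IsC1Kernel K DK c)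
    (hg₀ : Integrable g₀ unitMeasure) {R T : ℝ}
    (hR : 0 ≤ R) (hT : 0 ≤ T) {p₀ : CurveFrame E} (hp₀ : p₀ ∈ phaseSpace g₀) :
    ∃ α : ℝ → CurveFrame E, α 0 = p₀ ∧ (∀ t, α t ∈ phaseSpace g₀) ∧
      ∀ t ∈ Ioo (-1) (T + 1),
        HasDerivAt α (cutoff R ‖α t‖ • curveField A h hg₀ (α t)) t := by
  have : CompleteSpace (phaseSpace g₀) :=
    (isClosed_phaseSpace hg₀).completeSpace_coe
  have hf := fieldConst_nonneg (g₀ := g₀) A h.nonneg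
  -- The equation is solved inside the closed subspace, so that periodicity and `γ_ξ = M g₀` persist
  -- in time by construction.
  obtain ⟨α, h0, hα⟩ := exists_integralCurve_cutoff (X := phaseSpace g₀)
    (F := phaseField A h hg₀) (R := R)
    (L := fieldConst A c g₀ * (1 + 2 * (R + 1)) * (1 + (R + 1)))
    (B := fieldConst A c g₀ * (R + 1) * (1 + (R + 1))) (by positivity)
    (fun p hp => norm_curveField_le A h hg₀ hp)
    (fun p q hp hq => norm_curveField_sub_le A h hg₀ hp hq) (by positivity) ⟨p₀, hp₀⟩ hT
  refine ⟨fun t => α t, by simp [h0], fun t => (α t).2, fun t ht => ?_⟩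
  exact (phaseSpace g₀).subtypeL.hasFDerivAt.comp_hasDerivAt t (hα t ht)

end Field

/-! ### The energy and the velocity bounds that it provides -/

section Energy

variable {E : Type*} [NormedAddCommGroup E] [InnerProductSpace ℝ E] [CompleteSpace E]
  [SecondCountableTopology E] [MeasurableSpace E] [BorelSpace E]
  {φ : E → ℝ} {ν : Measure E} {g₀ : ℝ → E}

/-- The moment `∫ a(⟨k, γ(ξ)⟩) γ_ξ(ξ) dξ`. -/
def trigMoment (a : ℝ → ℝ) (g₀ : ℝ → E) (p : CurveFrame E) (k : E) : E :=
  ∫ ξ, a (inner ℝ k (p.curve ξ)) • tangent g₀ p ξ ∂unitMeasure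

/-- The energy `∬ φ(γ(ξ) - γ(η)) ⟨γ_ξ(ξ), γ_ξ(η)⟩ dξ dη`, in Fourier variables. -/
def energy (ν : Measure E) (g₀ : ℝ → E) (p : CurveFrame E) : ℝ :=
  ∫ k, ‖trigMoment Real.cos g₀ p k‖ ^ 2 + ‖trigMoment Real.sin g₀ p k‖ ^ 2 ∂ν

lemma integrable_smul_tangent (hg₀ : Integrable g₀ unitMeasure) (p : CurveFrame E) {a : ℝ → ℝ}
    (ha : Continuous a) (h1 : ∀ r, |a r| ≤ 1) (k : E) :
    Integrable (fun ξ => a (inner ℝ k (p.curve ξ)) • tangent g₀ p ξ) unitMeasure := by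
  refine (integrable_tangent hg₀ p).bdd_smul 1
    (ha.comp (continuous_const.inner p.curve.continuous)).aestronglyMeasurable
    (Eventually.of_forall fun ξ => h1 _)

lemma norm_trigMoment_le (hg₀ : Integrable g₀ unitMeasure) (p : CurveFrame E) {a : ℝ → ℝ}
    (h1 : ∀ r, |a r| ≤ 1) (k : E) :
    ‖trigMoment a g₀ p k‖ ≤ ‖p‖ * ∫ ξ, ‖g₀ ξ‖ ∂unitMeasure := by
  refine (norm_integral_le_of_norm_le (integrable_tangent hg₀ p).norm
    (Eventually.of_forall fun ξ => ?_)).trans (integral_norm_tangent_le hg₀ p)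
  rw [norm_smul, Real.norm_eq_abs]
  exact mul_le_of_le_one_left (norm_nonneg _) (h1 _)

lemma continuous_trigMoment (hg₀ : Integrable g₀ unitMeasure) (p : CurveFrame E) {a : ℝ → ℝ}
    (ha : Continuous a) (h1 : ∀ r, |a r| ≤ 1) : Continuous (trigMoment a g₀ p) := by
  refine continuous_of_dominated (bound := fun ξ => ‖tangent g₀ p ξ‖)
    (fun k => (integrable_smul_tangent hg₀ p ha h1 k).1) (fun k => Eventually.of_forall fun ξ => ?_)
    (integrable_tangent hg₀ p).norm (Eventually.of_forall fun ξ => ?_)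
  · rw [norm_smul, Real.norm_eq_abs]
    exact mul_le_of_le_one_left (norm_nonneg _) (h1 _)
  · exact (ha.comp (continuous_id.inner continuous_const)).smul continuous_const

lemma integrable_energy [IsFiniteMeasure ν] (hg₀ : Integrable g₀ unitMeasure) (p : CurveFrame E) :
    Integrable (fun k => ‖trigMoment Real.cos g₀ p k‖ ^ 2 + ‖trigMoment Real.sin g₀ p k‖ ^ 2) ν := by
  have hc := continuous_trigMoment hg₀ p Real.continuous_cos Real.abs_cos_le_one
  have hs := continuous_trigMoment hg₀ p Real.continuous_sin Real.abs_sin_le_one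
  refine (integrable_const ((‖p‖ * ∫ ξ, ‖g₀ ξ‖ ∂unitMeasure) ^ 2 +
    (‖p‖ * ∫ ξ, ‖g₀ ξ‖ ∂unitMeasure) ^ 2)).mono'
    ((hc.norm.pow 2).add (hs.norm.pow 2)).aestronglyMeasurable (Eventually.of_forall fun k => ?_)
  rw [Real.norm_eq_abs, abs_of_nonneg (by positivity)]
  gcongr
  · exact norm_trigMoment_le hg₀ p Real.abs_cos_le_one k
  · exact norm_trigMoment_le hg₀ p Real.abs_sin_le_one k

/-- The Fourier density of the velocity. -/
def velocityDensity (g₀ : ℝ → E) (p : CurveFrame E) (x k : E) : E :=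
  Real.cos (inner ℝ k x) • trigMoment Real.sin g₀ p k -
    Real.sin (inner ℝ k x) • trigMoment Real.cos g₀ p k

lemma integrable_prod_smul [IsFiniteMeasure ν] {μ : Measure ℝ} [SFinite μ]
    (hν : Integrable (fun k : E => ‖k‖) ν) (A : E →L[ℝ] E →L[ℝ] E) {g : ℝ → E}
    (hg : Integrable g μ) {f : ℝ × E → ℝ} (hf : Continuous f) (h1 : ∀ z, |f z| ≤ 1) :
    Integrable (fun z : ℝ × E => f z • A z.2 (g z.1)) (μ.prod ν) := by
  refine ((hg.norm.mul_prod hν).const_mul ‖A‖).mono'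
    (hf.aestronglyMeasurable.smul (A.aestronglyMeasurable_comp₂
      continuous_snd.aestronglyMeasurable hg.1.comp_fst)) (Eventually.of_forall fun z => ?_)
  rw [norm_smul, Real.norm_eq_abs]
  refine (mul_le_of_le_one_left (norm_nonneg _) (h1 _)).trans ((A.le_opNorm₂ _ _).trans ?_)
  rw [mul_assoc, mul_comm ‖z.2‖]

/-- The addition formula for the sine and Fubini's theorem separate the point `x` from the curve;
the curve enters only through its two trigonometric moments, whose squares make up the energy. -/
lemma IsSpectralMeasure.flowVelocity_eq (h : IsSpectralMeasure φ ν) (A : E →L[ℝ] E →L[ℝ] E)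
    (hg₀ : Integrable g₀ unitMeasure) (p : CurveFrame E) (x : E) :
    flowVelocity A (kernel ν) g₀ p x = ∫ k, A k (velocityDensity g₀ p x k) ∂ν := by
  have := h.isFinite
  have hn : Integrable (fun k : E => ‖k‖) ν := by
    simpa using h.integrable_norm_pow (n := 1) (by norm_num)
  have e1 : ∀ ξ, A (kernel ν (x - p.curve ξ)) (tangent g₀ p ξ) =
      ∫ k, -(Real.sin (inner ℝ k (x - p.curve ξ))) • A k (tangent g₀ p ξ) ∂ν := fun ξ => by
    have := (A.flip (tangent g₀ p ξ)).integral_comp_comm (h.integrable_kernel (x - p.curve ξ))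
    rw [kernel]
    refine this.symm.trans (integral_congr_ae (Eventually.of_forall fun k => ?_))
    exact (A.flip (tangent g₀ p ξ)).map_smul _ k
  rw [flowVelocity, lineIntegral]
  simp_rw [e1]
  rw [integral_integral_swap]
  · refine integral_congr_ae (Eventually.of_forall fun k => ?_)
    have ic := integrable_smul_tangent hg₀ p Real.continuous_cos Real.abs_cos_le_one k
    have is := integrable_smul_tangent hg₀ p Real.continuous_sin Real.abs_sin_le_one k
    simp only [velocityDensity, trigMoment]
    rw [← integral_smul, ← integral_smul, ← integral_sub (is.fun_smul _) (ic.fun_smul _)]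
    refine Eq.trans ?_ ((A k).integral_comp_comm ((is.fun_smul _).sub (ic.fun_smul _)))
    refine integral_congr_ae (Eventually.of_forall fun ξ => ?_)
    simp only [inner_sub_right, Real.sin_sub, map_smul, smul_smul, ← sub_smul]
    congr 1
    ring
  · exact integrable_prod_smul hn A (integrable_tangent hg₀ p)
      (f := fun z => -Real.sin (inner ℝ z.2 (x - p.curve z.1)))
      (Real.continuous_sin.comp (continuous_snd.inner (continuous_const.sub
        (p.curve.continuous.comp continuous_fst)))).neg
      fun z => by rw [abs_neg]; exact Real.abs_sin_le_one _

lemma norm_velocityDensity_le (p : CurveFrame E) (x k : E) :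
    ‖velocityDensity g₀ p x k‖ ≤ ‖trigMoment Real.cos g₀ p k‖ + ‖trigMoment Real.sin g₀ p k‖ := by
  refine (norm_sub_le _ _).trans ?_
  rw [norm_smul, norm_smul, add_comm]
  exact add_le_add (mul_le_of_le_one_left (norm_nonneg _) (Real.abs_sin_le_one _))
    (mul_le_of_le_one_left (norm_nonneg _) (Real.abs_cos_le_one _))

lemma norm_velocityDensity_sub_le (p : CurveFrame E) (x y k : E) :
    ‖velocityDensity g₀ p x k - velocityDensity g₀ p y k‖ ≤
      ‖k‖ * ‖x - y‖ * (‖trigMoment Real.cos g₀ p k‖ + ‖trigMoment Real.sin g₀ p k‖) := by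
  have hk : |inner ℝ k x - inner ℝ k y| ≤ ‖k‖ * ‖x - y‖ := by
    rw [← inner_sub_right]
    exact abs_real_inner_le_norm k (x - y)
  rw [velocityDensity, velocityDensity, show ∀ a b c d : E, a - b - (c - d) = (a - c) - (b - d) from
    fun a b c d => by abel, ← sub_smul, ← sub_smul]
  refine (norm_sub_le _ _).trans ?_
  rw [norm_smul, norm_smul, add_comm, mul_add]
  exact add_le_add
    (mul_le_mul_of_nonneg_right ((Real.abs_sin_sub_sin_le _ _).trans hk) (norm_nonneg _))
    (mul_le_mul_of_nonneg_right ((Real.abs_cos_sub_cos_le _ _).trans hk) (norm_nonneg _))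

lemma continuous_velocityDensity (hg₀ : Integrable g₀ unitMeasure) (p : CurveFrame E) :
    Continuous fun z : E × E => velocityDensity g₀ p z.1 z.2 := by
  have hc := continuous_trigMoment hg₀ p Real.continuous_cos Real.abs_cos_le_one
  have hs := continuous_trigMoment hg₀ p Real.continuous_sin Real.abs_sin_le_one
  have hi : Continuous fun z : E × E => inner ℝ z.2 z.1 := continuous_snd.inner continuous_fst
  exact ((Real.continuous_cos.comp hi).smul (hs.comp continuous_snd)).sub
    ((Real.continuous_sin.comp hi).smul (hc.comp continuous_snd))

lemma IsSpectralMeasure.integrable_velocityDensity (h : IsSpectralMeasure φ ν)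
    (A : E →L[ℝ] E →L[ℝ] E) (hg₀ : Integrable g₀ unitMeasure) (p : CurveFrame E) (x : E) :
    Integrable (fun k => A k (velocityDensity g₀ p x k)) ν := by
  have := h.isFinite
  have hd : Continuous fun k => velocityDensity g₀ p x k :=
    (continuous_velocityDensity hg₀ p).comp (continuous_const.prodMk continuous_id)
  refine ((h.integrable_norm_pow (n := 1) (by norm_num)).const_mul
    (‖A‖ * (‖p‖ * (∫ ξ, ‖g₀ ξ‖ ∂unitMeasure) + ‖p‖ * ∫ ξ, ‖g₀ ξ‖ ∂unitMeasure))).mono'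
    (A.aestronglyMeasurable_comp₂ continuous_id.aestronglyMeasurable hd.aestronglyMeasurable)
    (Eventually.of_forall fun k => ?_)
  have hle := (norm_velocityDensity_le (g₀ := g₀) p x k).trans (add_le_add
    (norm_trigMoment_le hg₀ p Real.abs_cos_le_one k) (norm_trigMoment_le hg₀ p Real.abs_sin_le_one k))
  refine (A.le_opNorm₂ _ _).trans ?_
  rw [pow_one]
  calc _ ≤ ‖A‖ * ‖k‖ * (‖p‖ * (∫ ξ, ‖g₀ ξ‖ ∂unitMeasure) + ‖p‖ * ∫ ξ, ‖g₀ ξ‖ ∂unitMeasure) := by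
        gcongr
    _ = _ := by ring

/-- The bound on velocities in terms of the energy. -/
def energyBound (A : E →L[ℝ] E →L[ℝ] E) (ν : Measure E) (e : ℝ) : ℝ :=
  ‖A‖ * ((∫ k, ‖k‖ ^ 2 ∂ν) + (∫ k, ‖k‖ ^ 4 ∂ν) + e)

/-- Young's inequality splits `‖k‖` times a trigonometric moment into `‖k‖²`, integrable for `ν`,
and the square of the moment, which integrates to the energy. The bound does not depend on the size
of `p`. -/
lemma IsSpectralMeasure.norm_flowVelocity_le (h : IsSpectralMeasure φ ν)
    (A : E →L[ℝ] E →L[ℝ] E) (hg₀ : Integrable g₀ unitMeasure) (p : CurveFrame E) (x : E) :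
    ‖flowVelocity A (kernel ν) g₀ p x‖ ≤ energyBound A ν (energy ν g₀ p) := by
  have := h.isFinite
  have i2 := h.integrable_norm_pow (n := 2) (by norm_num)
  have ie := integrable_energy (ν := ν) hg₀ p
  have h4 : 0 ≤ ∫ k, ‖k‖ ^ 4 ∂ν := integral_nonneg fun k => by positivity
  rw [h.flowVelocity_eq A hg₀ p x]
  calc _ ≤ ∫ k, ‖A‖ * (‖k‖ ^ 2 +
        (‖trigMoment Real.cos g₀ p k‖ ^ 2 + ‖trigMoment Real.sin g₀ p k‖ ^ 2)) ∂ν := by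
        refine norm_integral_le_of_norm_le ((i2.add ie).const_mul _)
          (Eventually.of_forall fun k => (A.le_opNorm₂ _ _).trans ?_)
        rw [mul_assoc]
        refine mul_le_mul_of_nonneg_left ?_ (norm_nonneg A)
        have := norm_velocityDensity_le (g₀ := g₀) p x k
        nlinarith [sq_nonneg (‖k‖ - ‖trigMoment Real.cos g₀ p k‖),
          sq_nonneg (‖k‖ - ‖trigMoment Real.sin g₀ p k‖), norm_nonneg k,
          sq_nonneg ‖trigMoment Real.cos g₀ p k‖, sq_nonneg ‖trigMoment Real.sin g₀ p k‖,
          mul_le_mul_of_nonneg_left this (norm_nonneg k)]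
    _ = ‖A‖ * ((∫ k, ‖k‖ ^ 2 ∂ν) + energy ν g₀ p) := by
        rw [integral_const_mul, integral_add i2 ie, energy]
    _ ≤ _ := by
        rw [energyBound]
        gcongr
        linarith

/-- A difference in `x` costs a further factor `‖k‖`, so Young's inequality is applied to `‖k‖²`
times a moment; this is what the fourth moment is for. -/
lemma IsSpectralMeasure.norm_flowVelocity_sub_le (h : IsSpectralMeasure φ ν)
    (A : E →L[ℝ] E →L[ℝ] E) (hg₀ : Integrable g₀ unitMeasure) (p : CurveFrame E) (x y : E) :
    ‖flowVelocity A (kernel ν) g₀ p x - flowVelocity A (kernel ν) g₀ p y‖ ≤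
      energyBound A ν (energy ν g₀ p) * ‖x - y‖ := by
  have := h.isFinite
  have i4 := h.integrable_norm_pow (n := 4) (by norm_num)
  have ie := integrable_energy (ν := ν) hg₀ p
  have h2 : 0 ≤ ∫ k, ‖k‖ ^ 2 ∂ν := integral_nonneg fun k => by positivity
  rw [h.flowVelocity_eq A hg₀ p x, h.flowVelocity_eq A hg₀ p y,
    ← integral_sub (h.integrable_velocityDensity A hg₀ p x)
      (h.integrable_velocityDensity A hg₀ p y)]
  calc _ ≤ ∫ k, ‖A‖ * ‖x - y‖ * (‖k‖ ^ 4 +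
        (‖trigMoment Real.cos g₀ p k‖ ^ 2 + ‖trigMoment Real.sin g₀ p k‖ ^ 2)) ∂ν := by
        refine norm_integral_le_of_norm_le ((i4.add ie).const_mul _)
          (Eventually.of_forall fun k => ?_)
        rw [← map_sub]
        refine (A.le_opNorm₂ _ _).trans ?_
        have := norm_velocityDensity_sub_le (g₀ := g₀) p x y k
        calc _ ≤ ‖A‖ * ‖k‖ * (‖k‖ * ‖x - y‖ *
              (‖trigMoment Real.cos g₀ p k‖ + ‖trigMoment Real.sin g₀ p k‖)) := by gcongr
          _ = ‖A‖ * ‖x - y‖ * (‖k‖ ^ 2 *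
              (‖trigMoment Real.cos g₀ p k‖ + ‖trigMoment Real.sin g₀ p k‖)) := by ring
          _ ≤ _ := by
            gcongr
            nlinarith [sq_nonneg (‖k‖ ^ 2 - ‖trigMoment Real.cos g₀ p k‖),
              sq_nonneg (‖k‖ ^ 2 - ‖trigMoment Real.sin g₀ p k‖),
              sq_nonneg ‖trigMoment Real.cos g₀ p k‖, sq_nonneg ‖trigMoment Real.sin g₀ p k‖]
    _ = ‖A‖ * ‖x - y‖ * ((∫ k, ‖k‖ ^ 4 ∂ν) + energy ν g₀ p) := by
        rw [integral_const_mul, integral_add i4 ie, energy]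
    _ = ‖A‖ * ((∫ k, ‖k‖ ^ 4 ∂ν) + energy ν g₀ p) * ‖x - y‖ := by ring
    _ ≤ _ := by
        rw [energyBound]
        gcongr
        linarith

lemma energy_nonneg (p : CurveFrame E) : 0 ≤ energy ν g₀ p :=
  integral_nonneg fun k => by positivity

lemma energyBound_nonneg (A : E →L[ℝ] E →L[ℝ] E) {e : ℝ} (he : 0 ≤ e) :
    0 ≤ energyBound A ν e := by
  have h2 : 0 ≤ ∫ k, ‖k‖ ^ 2 ∂ν := integral_nonneg fun k => by positivity
  have h4 : 0 ≤ ∫ k, ‖k‖ ^ 4 ∂ν := integral_nonneg fun k => by positivity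
  rw [energyBound]
  positivity

lemma IsSpectralMeasure.norm_flowGradient_le (h : IsSpectralMeasure φ ν) {c : ℝ}
    (hK : IsC1Kernel (kernel ν) (kernelDeriv ν) c) (A : E →L[ℝ] E →L[ℝ] E)
    (hg₀ : Integrable g₀ unitMeasure) (p : CurveFrame E) (x : E) :
    ‖flowGradient A (kernelDeriv ν) g₀ p x‖ ≤ energyBound A ν (energy ν g₀ p) :=
  (hK.hasFDerivAt_flowVelocity A hg₀ p x).le_of_lip' (energyBound_nonneg A (energy_nonneg p))
    (Eventually.of_forall fun y => h.norm_flowVelocity_sub_le A hg₀ p y x)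

end Energy

/-! ### Conservation of the energy -/

section Conservation

variable {E : Type*} [NormedAddCommGroup E] [InnerProductSpace ℝ E] [CompleteSpace E]
  [SecondCountableTopology E] [MeasurableSpace E] [BorelSpace E]
  {φ : E → ℝ} {ν : Measure E} {g₀ : ℝ → E} {a a' : ℝ → ℝ}

/-- The integrand of the derivative of `trigMoment` in the direction `v`. -/
def trigMomentDensity (a a' : ℝ → ℝ) (g₀ : ℝ → E) (p v : CurveFrame E) (k : E) (ξ : ℝ) : E :=
  (a' (inner ℝ k (p.curve ξ)) * inner ℝ k (v.curve ξ)) • tangent g₀ p ξ +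
    a (inner ℝ k (p.curve ξ)) • tangent g₀ v ξ

/-- The derivative of `trigMoment` in the direction `v`. -/
def trigMomentDeriv (a a' : ℝ → ℝ) (g₀ : ℝ → E) (p v : CurveFrame E) (k : E) : E :=
  ∫ ξ, trigMomentDensity a a' g₀ p v k ξ ∂unitMeasure

lemma norm_trigMomentDensity_le (h : ∀ r, |a r| ≤ 1) (h' : ∀ r, |a' r| ≤ 1) {p v : CurveFrame E}
    {R L : ℝ} (hp : ‖p‖ ≤ R) (hv : ‖v‖ ≤ L) (k : E) (ξ : ℝ) :
    ‖trigMomentDensity a a' g₀ p v k ξ‖ ≤ L * (‖k‖ * R + 1) * ‖g₀ ξ‖ := by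
  have hR := (norm_nonneg p).trans hp
  have hL := (norm_nonneg v).trans hv
  have h1 : |inner ℝ k (v.curve ξ)| ≤ ‖k‖ * L := (abs_real_inner_le_norm _ _).trans
    (mul_le_mul_of_nonneg_left ((v.norm_curve_apply_le ξ).trans hv) (norm_nonneg k))
  refine (norm_add_le _ _).trans ?_
  rw [norm_smul, norm_smul, norm_mul, Real.norm_eq_abs, Real.norm_eq_abs, Real.norm_eq_abs]
  calc _ ≤ 1 * (‖k‖ * L) * (R * ‖g₀ ξ‖) + 1 * (L * ‖g₀ ξ‖) := by
        gcongr
        · exact h' _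
        · exact (norm_tangent_le p ξ).trans (by gcongr)
        · exact h _
        · exact (norm_tangent_le v ξ).trans (by gcongr)
    _ = _ := by ring

lemma aestronglyMeasurable_trigMomentDensity [SFinite ν] (ha : Continuous a) (ha' : Continuous a')
    (hg₀ : Integrable g₀ unitMeasure) (p v : CurveFrame E) :
    AEStronglyMeasurable (fun z : E × ℝ => trigMomentDensity a a' g₀ p v z.1 z.2)
      (ν.prod unitMeasure) := by
  have hi : ∀ q : CurveFrame E, Continuous fun z : E × ℝ => inner ℝ z.1 (q.curve z.2) := fun q =>
    continuous_fst.inner (q.curve.continuous.comp continuous_snd)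
  have ht : ∀ q : CurveFrame E, AEStronglyMeasurable (fun z : E × ℝ => tangent g₀ q z.2)
      (ν.prod unitMeasure) := fun q => (integrable_tangent hg₀ q).1.comp_snd
  exact ((((ha'.comp (hi p)).mul (hi v)).aestronglyMeasurable).smul (ht p)).add
    ((ha.comp (hi p)).aestronglyMeasurable.smul (ht v))

lemma integrable_trigMomentDensity (ha : Continuous a) (ha' : Continuous a')
    (h : ∀ r, |a r| ≤ 1) (h' : ∀ r, |a' r| ≤ 1)
    (hg₀ : Integrable g₀ unitMeasure) (p v : CurveFrame E) (k : E) :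
    Integrable (trigMomentDensity a a' g₀ p v k) unitMeasure := by
  have hi : ∀ q : CurveFrame E, Continuous fun ξ => inner ℝ k (q.curve ξ) := fun q =>
    continuous_const.inner q.curve.continuous
  refine (hg₀.norm.const_mul _).mono' ?_ (Eventually.of_forall
    (norm_trigMomentDensity_le h h' (le_refl ‖p‖) (le_refl ‖v‖) k))
  exact ((((ha'.comp (hi p)).mul (hi v)).aestronglyMeasurable).smul (integrable_tangent hg₀ p).1).add
    ((ha.comp (hi p)).aestronglyMeasurable.smul (integrable_tangent hg₀ v).1)

lemma norm_trigMomentDeriv_le (h : ∀ r, |a r| ≤ 1) (h' : ∀ r, |a' r| ≤ 1)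
    (hg₀ : Integrable g₀ unitMeasure) {p v : CurveFrame E}
    {R L : ℝ} (hp : ‖p‖ ≤ R) (hv : ‖v‖ ≤ L) (k : E) :
    ‖trigMomentDeriv a a' g₀ p v k‖ ≤ L * (‖k‖ * R + 1) * ∫ ξ, ‖g₀ ξ‖ ∂unitMeasure := by
  rw [← integral_const_mul]
  exact norm_integral_le_of_norm_le (hg₀.norm.const_mul _)
    (Eventually.of_forall (norm_trigMomentDensity_le h h' hp hv k))

lemma trigMomentDeriv_smul (p v : CurveFrame E) (r : ℝ) (k : E) :
    trigMomentDeriv a a' g₀ p (r • v) k = r • trigMomentDeriv a a' g₀ p v k := by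
  rw [trigMomentDeriv, trigMomentDeriv, ← integral_smul]
  refine integral_congr_ae (Eventually.of_forall fun ξ => ?_)
  simp only [trigMomentDensity, tangent, CurveFrame.curve_smul_apply, CurveFrame.frame_smul_apply,
    inner_smul_right, _root_.smul_apply, smul_add, smul_smul]
  congr 2 <;> ring

lemma hasDerivAt_trigMoment (hd : ∀ r, HasDerivAt a (a' r) r) (ha' : Continuous a')
    (h : ∀ r, |a r| ≤ 1) (h' : ∀ r, |a' r| ≤ 1) (hg₀ : Integrable g₀ unitMeasure)
    {α α' : ℝ → CurveFrame E} {R L : ℝ} {s : Set ℝ} (hs : IsOpen s)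
    (hα : ∀ t ∈ s, HasDerivAt α (α' t) t) (hR : ∀ t ∈ s, ‖α t‖ ≤ R) (hL : ∀ t ∈ s, ‖α' t‖ ≤ L)
    {t : ℝ} (ht : t ∈ s) (k : E) :
    HasDerivAt (fun t => trigMoment a g₀ (α t) k) (trigMomentDeriv a a' g₀ (α t) (α' t) k) t := by
  have ha : Continuous a := continuous_iff_continuousAt.2 fun r => (hd r).continuousAt
  refine (hasDerivAt_integral_of_dominated_loc_of_deriv_le (hs.mem_nhds ht)
    (bound := fun ξ => L * (‖k‖ * R + 1) * ‖g₀ ξ‖)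
    (F' := fun t => trigMomentDensity a a' g₀ (α t) (α' t) k)
    (Eventually.of_forall fun t => (integrable_smul_tangent hg₀ (α t) ha h k).1)
    (integrable_smul_tangent hg₀ (α t) ha h k)
    (integrable_trigMomentDensity ha ha' h h' hg₀ _ _ k).1
    (Eventually.of_forall fun ξ τ hτ => norm_trigMomentDensity_le h h' (hR τ hτ) (hL τ hτ) k ξ)
    (hg₀.norm.const_mul _) (Eventually.of_forall fun ξ τ hτ => ?_)).2
  have h1 : HasDerivAt (fun t => (α t).curve ξ) ((α' τ).curve ξ) τ :=
    (CurveFrame.evalCurve ξ).hasFDerivAt.comp_hasDerivAt τ (hα τ hτ)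
  have h2 : HasDerivAt (fun t => (α t).frame ξ) ((α' τ).frame ξ) τ := by
    have := (CurveFrame.evalFrame (E := E) ξ).hasFDerivAt.comp_hasDerivAt τ (hα τ hτ)
    exact this
  have h3 : HasDerivAt (fun t => tangent g₀ (α t) ξ) (tangent g₀ (α' τ) ξ) τ :=
    (ContinuousLinearMap.apply ℝ E (g₀ ξ)).hasFDerivAt.comp_hasDerivAt τ h2
  have h4 : HasDerivAt (fun t => inner ℝ k ((α t).curve ξ)) (inner ℝ k ((α' τ).curve ξ)) τ :=
    (innerSL ℝ k).hasFDerivAt.comp_hasDerivAt τ h1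
  have h5 := ((hd _).comp τ h4).smul h3
  rw [add_comm] at h5
  exact h5

/-- Differentiation under the `ν`-integral: for `α` and `α'` bounded, the derivative of the
integrand grows at most linearly in `‖k‖`, so the first moment dominates. -/
lemma hasDerivAt_energy [IsFiniteMeasure ν] (hν : Integrable (fun k : E => ‖k‖) ν)
    (hg₀ : Integrable g₀ unitMeasure)
    {α α' : ℝ → CurveFrame E} {R L : ℝ} {s : Set ℝ} (hs : IsOpen s)
    (hα : ∀ t ∈ s, HasDerivAt α (α' t) t) (hR : ∀ t ∈ s, ‖α t‖ ≤ R) (hL : ∀ t ∈ s, ‖α' t‖ ≤ L)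
    {t : ℝ} (ht : t ∈ s) :
    HasDerivAt (fun t => energy ν g₀ (α t))
      (∫ k, 2 * inner ℝ (trigMoment Real.cos g₀ (α t) k)
          (trigMomentDeriv Real.cos (fun r => -Real.sin r) g₀ (α t) (α' t) k) +
        2 * inner ℝ (trigMoment Real.sin g₀ (α t) k)
          (trigMomentDeriv Real.sin Real.cos g₀ (α t) (α' t) k) ∂ν) t := by
  have hsin : ∀ r, |-Real.sin r| ≤ 1 := fun r => by rw [abs_neg]; exact Real.abs_sin_le_one r
  set G := ∫ ξ, ‖g₀ ξ‖ ∂unitMeasure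
  have hG : 0 ≤ G := integral_nonneg fun _ => norm_nonneg _
  have hR0 := (norm_nonneg _).trans (hR t ht)
  have hL0 := (norm_nonneg _).trans (hL t ht)
  have hm : ∀ {a a' : ℝ → ℝ}, Continuous a → Continuous a' →
      AEStronglyMeasurable (fun k => trigMomentDeriv a a' g₀ (α t) (α' t) k) ν := fun ha ha' =>
    (aestronglyMeasurable_trigMomentDensity ha ha' hg₀ (α t) (α' t)).integral_prod_right'
  have hb : ∀ {a a' : ℝ → ℝ}, (∀ r, |a r| ≤ 1) → (∀ r, |a' r| ≤ 1) → ∀ τ ∈ s, ∀ k,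
      ‖2 * inner ℝ (trigMoment a g₀ (α τ) k) (trigMomentDeriv a a' g₀ (α τ) (α' τ) k)‖ ≤
        2 * (R * G * (L * (‖k‖ * R + 1) * G)) := fun h h' τ hτ k => by
    rw [norm_mul, Real.norm_ofNat]
    gcongr
    refine (norm_inner_le_norm _ _).trans ?_
    gcongr
    · exact (norm_trigMoment_le hg₀ _ h k).trans (by gcongr; exact hR τ hτ)
    · exact norm_trigMomentDeriv_le h h' hg₀ (hR τ hτ) (hL τ hτ) k
  have hc := continuous_trigMoment hg₀ (α t) Real.continuous_cos Real.abs_cos_le_one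
  have hs' := continuous_trigMoment hg₀ (α t) Real.continuous_sin Real.abs_sin_le_one
  refine (hasDerivAt_integral_of_dominated_loc_of_deriv_le (hs.mem_nhds ht)
    (bound := fun k => 2 * (R * G * (L * (‖k‖ * R + 1) * G)) + 2 * (R * G * (L * (‖k‖ * R + 1) * G)))
    (F' := fun t k => 2 * inner ℝ (trigMoment Real.cos g₀ (α t) k)
          (trigMomentDeriv Real.cos (fun r => -Real.sin r) g₀ (α t) (α' t) k) +
        2 * inner ℝ (trigMoment Real.sin g₀ (α t) k)
          (trigMomentDeriv Real.sin Real.cos g₀ (α t) (α' t) k))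
    (Eventually.of_forall fun t => (integrable_energy hg₀ (α t)).1)
    (integrable_energy hg₀ (α t)) ?_ ?_ ?_ ?_).2
  · exact ((hc.aestronglyMeasurable.inner (hm Real.continuous_cos Real.continuous_sin.neg)).const_mul
      2).add ((hs'.aestronglyMeasurable.inner (hm Real.continuous_sin Real.continuous_cos)).const_mul 2)
  · exact Eventually.of_forall fun k τ hτ => (norm_add_le _ _).trans
      (add_le_add (hb Real.abs_cos_le_one hsin τ hτ k)
        (hb Real.abs_sin_le_one Real.abs_cos_le_one τ hτ k))
  · have : Integrable (fun k : E => 2 * (R * G * (L * (‖k‖ * R + 1) * G))) ν :=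
      (((((hν.mul_const R).add (integrable_const (1 : ℝ))).const_mul L).mul_const G).const_mul
        (R * G)).const_mul 2
    exact this.add this
  · exact Eventually.of_forall fun k τ hτ =>
      (hasDerivAt_trigMoment Real.hasDerivAt_cos Real.continuous_sin.neg Real.abs_cos_le_one hsin hg₀
        hs hα hR hL hτ k).norm_sq.add
      (hasDerivAt_trigMoment Real.hasDerivAt_sin Real.continuous_cos Real.abs_sin_le_one
        Real.abs_cos_le_one hg₀ hs hα hR hL hτ k).norm_sq

variable {K : E → E} {DK : E → E →L[ℝ] E} {c : ℝ}

/-- Integration by parts in `trigMomentDeriv`. -/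
lemma trigMomentDeriv_curveField (hd : ∀ r, HasDerivAt a (a' r) r) (ha' : Continuous a')
    (h : ∀ r, |a r| ≤ 1) (h' : ∀ r, |a' r| ≤ 1) (A : E →L[ℝ] E →L[ℝ] E) (hK : IsC1Kernel K DK c)
    (hg₀ : Integrable g₀ unitMeasure) {p : CurveFrame E} (hp : p ∈ phaseSpace g₀) (k : E) :
    trigMomentDeriv a a' g₀ p (curveField A hK hg₀ p) k =
      ∫ ξ, a' (inner ℝ k (p.curve ξ)) •
        (inner ℝ k (flowVelocity A K g₀ p (p.curve ξ)) • tangent g₀ p ξ -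
          inner ℝ k (tangent g₀ p ξ) • flowVelocity A K g₀ p (p.curve ξ)) ∂unitMeasure := by
  have hda : deriv a = a' := funext fun r => (hd r).deriv
  have hac : ContDiff ℝ 1 a := contDiff_one_iff_deriv.2
    ⟨fun r => (hd r).differentiableAt, by rwa [hda]⟩
  have hU := hK.contDiff_flowVelocity A hg₀ p
  have hi : ContDiff ℝ 1 fun x : E => inner ℝ k x := (innerSL ℝ k).contDiff
  -- The function `a(⟨k,γ⟩) u(γ)` takes equal values at the two end points, so its derivative has
  -- integral zero. Subtracting it cancels the term in `∇u`.
  have hc := hp.2.comp ((hac.comp hi).smul hU)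
  have h0 : ∀ x y : E, fderiv ℝ ((a ∘ fun x => inner ℝ k x) • flowVelocity A K g₀ p) x y =
      a (inner ℝ k x) • flowGradient A DK g₀ p x y +
        (a' (inner ℝ k x) * inner ℝ k y) • flowVelocity A K g₀ p x := fun x y => by
    have e1 : HasFDerivAt (a ∘ fun x => inner ℝ k x) (a' (inner ℝ k x) • innerSL ℝ k) x :=
      (hd _).comp_hasFDerivAt x (innerSL ℝ k).hasFDerivAt
    rw [(e1.smul (hK.hasFDerivAt_flowVelocity A hg₀ p x)).fderiv]
    simp
  have hz := hc.integral_eq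
  have hper : p.curve 1 = p.curve 0 := by simpa using hp.1 0
  rw [hper, sub_self] at hz
  have hint := integrable_trigMomentDensity (hac.continuous) ha' h h' hg₀ p (curveField A hK hg₀ p) k
  rw [trigMomentDeriv, ← sub_zero (∫ ξ, _ ∂unitMeasure), ← hz, ← integral_sub hint hc.integrable]
  refine integral_congr_ae (Eventually.of_forall fun ξ => ?_)
  simp only [trigMomentDensity]
  have e := h0 (p.curve ξ) (tangent g₀ p ξ)
  refine (congrArg (fun w => _ - w) e).trans ?_
  have e2 : tangent g₀ (curveField A hK hg₀ p) ξ =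
    flowGradient A DK g₀ p (p.curve ξ) (tangent g₀ p ξ) := rfl
  have e3 : (curveField A hK hg₀ p).curve ξ = flowVelocity A K g₀ p (p.curve ξ) := rfl
  rw [e2, e3, smul_sub, smul_smul, smul_smul]
  abel

/-- The energy balance at a fixed frequency. -/
lemma inner_trigMomentDeriv_add (A : E →L[ℝ] E →L[ℝ] E)
    (hA : ∀ a b c d, inner ℝ (A a b) (A c d) =
      inner ℝ a c * inner ℝ b d - inner ℝ a d * inner ℝ b c)
    (hK : IsC1Kernel K DK c) (hg₀ : Integrable g₀ unitMeasure) {p : CurveFrame E}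
    (hp : p ∈ phaseSpace g₀) (k : E) :
    inner ℝ (trigMoment Real.cos g₀ p k)
        (trigMomentDeriv Real.cos (fun r => -Real.sin r) g₀ p (curveField A hK hg₀ p) k) +
      inner ℝ (trigMoment Real.sin g₀ p k)
        (trigMomentDeriv Real.sin Real.cos g₀ p (curveField A hK hg₀ p) k) =
    ∫ ξ, inner ℝ (A k (velocityDensity g₀ p (p.curve ξ) k))
      (A (flowVelocity A K g₀ p (p.curve ξ)) (tangent g₀ p ξ)) ∂unitMeasure := by
  have hsin : ∀ r, |-Real.sin r| ≤ 1 := fun r => by rw [abs_neg]; exact Real.abs_sin_le_one r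
  have hU : Continuous fun ξ => flowVelocity A K g₀ p (p.curve ξ) :=
    (hK.contDiff_flowVelocity A hg₀ p).continuous.comp p.curve.continuous
  have hg := integrable_tangent hg₀ p
  have hD : Integrable (fun ξ => inner ℝ k (flowVelocity A K g₀ p (p.curve ξ)) • tangent g₀ p ξ -
      inner ℝ k (tangent g₀ p ξ) • flowVelocity A K g₀ p (p.curve ξ)) unitMeasure := by
    refine integrable_clm_apply (A := fun ξ => inner ℝ k (flowVelocity A K g₀ p (p.curve ξ)) •
      ContinuousLinearMap.id ℝ E - (innerSL ℝ k).smulRight (flowVelocity A K g₀ p (p.curve ξ))) hg ?_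
    exact ((((innerSL ℝ k).continuous.comp hU).smul continuous_const).sub
      ((ContinuousLinearMap.smulRightL ℝ E E (innerSL ℝ k)).continuous.comp hU)).continuousOn
  have hDa : ∀ {a : ℝ → ℝ}, Continuous a → (∀ r, |a r| ≤ 1) →
      Integrable (fun ξ => a (inner ℝ k (p.curve ξ)) •
      (inner ℝ k (flowVelocity A K g₀ p (p.curve ξ)) • tangent g₀ p ξ -
      inner ℝ k (tangent g₀ p ξ) • flowVelocity A K g₀ p (p.curve ξ))) unitMeasure := fun ha h1 =>
    hD.bdd_smul 1 (ha.comp (continuous_const.inner p.curve.continuous)).aestronglyMeasurable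
      (Eventually.of_forall fun ξ => h1 _)
  have is := hDa (a := fun r => -Real.sin r) Real.continuous_sin.neg hsin
  have ic := hDa Real.continuous_cos Real.abs_cos_le_one
  rw [trigMomentDeriv_curveField Real.hasDerivAt_cos Real.continuous_sin.neg Real.abs_cos_le_one hsin
      A hK hg₀ hp k,
    trigMomentDeriv_curveField Real.hasDerivAt_sin Real.continuous_cos Real.abs_sin_le_one
      Real.abs_cos_le_one A hK hg₀ hp k,
    ← integral_inner is, ← integral_inner ic, ← integral_add (is.const_inner _) (ic.const_inner _)]
  refine integral_congr_ae (Eventually.of_forall fun ξ => ?_)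
  -- Binet–Cauchy expands `⟨k ∧ D, u ∧ γ_ξ⟩` to `⟨k,u⟩⟨D,γ_ξ⟩ - ⟨k,γ_ξ⟩⟨D,u⟩`, with `D` the velocity
  -- density; these are the terms left by the integration by parts.
  simp only [hA, velocityDensity, inner_sub_left, inner_sub_right, inner_smul_left, inner_smul_right,
    RCLike.conj_to_real]
  ring

/-- With the `k`-integration performed first, the left factor integrates to the velocity `u` at the
point of the curve, by `IsSpectralMeasure.flowVelocity_eq`, and `u` is orthogonal to `u ∧ γ_ξ`. -/
lemma IsSpectralMeasure.integral_inner_trigMomentDeriv (h : IsSpectralMeasure φ ν)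
    (A : E →L[ℝ] E →L[ℝ] E) (hA0 : ∀ a b, inner ℝ a (A a b) = 0)
    (hA : ∀ a b c d, inner ℝ (A a b) (A c d) =
      inner ℝ a c * inner ℝ b d - inner ℝ a d * inner ℝ b c)
    (hK : IsC1Kernel (kernel ν) DK c) (hg₀ : Integrable g₀ unitMeasure) {p : CurveFrame E}
    (hp : p ∈ phaseSpace g₀) :
    ∫ k, (inner ℝ (trigMoment Real.cos g₀ p k)
        (trigMomentDeriv Real.cos (fun r => -Real.sin r) g₀ p (curveField A hK hg₀ p) k) +
      inner ℝ (trigMoment Real.sin g₀ p k)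
        (trigMomentDeriv Real.sin Real.cos g₀ p (curveField A hK hg₀ p) k)) ∂ν = 0 := by
  have := h.isFinite
  have hν : Integrable (fun k : E => ‖k‖) ν := by
    simpa using h.integrable_norm_pow (n := 1) (by norm_num)
  have hU : Continuous fun ξ => flowVelocity A (kernel ν) g₀ p (p.curve ξ) :=
    (hK.contDiff_flowVelocity A hg₀ p).continuous.comp p.curve.continuous
  simp_rw [inner_trigMomentDeriv_add A hA hK hg₀ hp]
  rw [integral_integral_swap]
  · refine integral_eq_zero_of_ae (Eventually.of_forall fun ξ => ?_)
    have hi := h.integrable_velocityDensity A hg₀ p (p.curve ξ)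
    have e := integral_inner (𝕜 := ℝ) hi (A (flowVelocity A (kernel ν) g₀ p (p.curve ξ)) (tangent g₀ p ξ))
    rw [← h.flowVelocity_eq A hg₀, real_inner_comm, hA0] at e
    simp only [Pi.zero_apply]
    rw [← e]
    exact integral_congr_ae (Eventually.of_forall fun k => real_inner_comm _ _)
  · set R := ‖p‖
    set G := ∫ ξ, ‖g₀ ξ‖ ∂unitMeasure
    have hG : 0 ≤ G := integral_nonneg fun _ => norm_nonneg _
    refine ((hν.mul_prod (hg₀.norm)).const_mul
      (‖A‖ * (R * G + R * G) * (‖A‖ * (fieldConst A c g₀ * R) * R))).mono'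
      (AEStronglyMeasurable.inner (A.aestronglyMeasurable_comp₂
        continuous_fst.aestronglyMeasurable
        ((continuous_velocityDensity hg₀ p).comp ((p.curve.continuous.comp continuous_snd).prodMk
          continuous_fst)).aestronglyMeasurable) (A.aestronglyMeasurable_comp₂
        (hU.comp continuous_snd).aestronglyMeasurable (integrable_tangent hg₀ p).1.comp_snd))
      (Eventually.of_forall fun z => ?_)
    have hf := fieldConst_nonneg (g₀ := g₀) A hK.nonneg
    have e1 : ‖A z.1 (velocityDensity g₀ p (p.curve z.2) z.1)‖ ≤ ‖A‖ * ‖z.1‖ * (R * G + R * G) :=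
      A.le_of_opNorm₂_le_of_le le_rfl le_rfl ((norm_velocityDensity_le p _ _).trans
        (add_le_add (norm_trigMoment_le hg₀ p Real.abs_cos_le_one _)
          (norm_trigMoment_le hg₀ p Real.abs_sin_le_one _)))
    have e2 : ‖A (flowVelocity A (kernel ν) g₀ p (p.curve z.2)) (tangent g₀ p z.2)‖ ≤
        ‖A‖ * (fieldConst A c g₀ * R) * (R * ‖g₀ z.2‖) :=
      A.le_of_opNorm₂_le_of_le le_rfl (norm_lineIntegral_tangent_le A.le_opNorm₂ hg₀ hK.nonneg
        hK.norm_le le_rfl _) (norm_tangent_le p _)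
    refine (norm_inner_le_norm _ _).trans ((mul_le_mul e1 e2 (norm_nonneg _)
      (by positivity)).trans (le_of_eq ?_))
    ring

/-- Conservation of the energy. -/
theorem IsSpectralMeasure.hasDerivAt_energy_zero (h : IsSpectralMeasure φ ν)
    (A : E →L[ℝ] E →L[ℝ] E) (hA0 : ∀ a b, inner ℝ a (A a b) = 0)
    (hA : ∀ a b c d, inner ℝ (A a b) (A c d) =
      inner ℝ a c * inner ℝ b d - inner ℝ a d * inner ℝ b c)
    (hK : IsC1Kernel (kernel ν) DK c) (hg₀ : Integrable g₀ unitMeasure) {α : ℝ → CurveFrame E}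
    {θ : ℝ → ℝ} (hθ : ∀ t, |θ t| ≤ 1) (hα : ∀ t, α t ∈ phaseSpace g₀) {s : Set ℝ} (hs : IsOpen s)
    (hd : ∀ t ∈ s, HasDerivAt α (θ t • curveField A hK hg₀ (α t)) t) {t : ℝ} (ht : t ∈ s) :
    HasDerivAt (fun t => energy ν g₀ (α t)) 0 t := by
  have := h.isFinite
  have hν : Integrable (fun k : E => ‖k‖) ν := by
    simpa using h.integrable_norm_pow (n := 1) (by norm_num)
  -- Continuity of `α` provides the bound on `‖α‖` near `t` that the domination requires.
  have hnhds : s ∩ {τ | ‖α τ‖ < ‖α t‖ + 1} ∈ 𝓝 t := inter_mem (hs.mem_nhds ht)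
    ((hd t ht).continuousAt.norm.eventually (gt_mem_nhds (lt_add_one _)))
  obtain ⟨u, hu, huo, htu⟩ := mem_nhds_iff.1 hnhds
  have key := hasDerivAt_energy hν hg₀ (R := ‖α t‖ + 1)
    (L := fieldConst A c g₀ * (‖α t‖ + 1) * (1 + (‖α t‖ + 1))) huo (fun τ hτ => hd τ (hu hτ).1)
    (fun τ hτ => (hu hτ).2.le) (fun τ hτ => by
      rw [norm_smul, Real.norm_eq_abs]
      exact (mul_le_of_le_one_left (norm_nonneg _) (hθ τ)).trans
        (norm_curveField_le A hK hg₀ (hu hτ).2.le)) htu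
  convert! key using 1
  -- The derivative is linear in the direction, so the scalar `θ t` factors out: slowing the flow by
  -- a cutoff does not destroy conservation.
  simp only [trigMomentDeriv_smul, inner_smul_right, ← mul_add]
  rw [integral_const_mul, integral_const_mul,
    h.integral_inner_trigMomentDeriv A hA0 hA hK hg₀ (hα t), mul_zero, mul_zero]

end Conservation

/-! ### Global integral curves in the phase space -/

section Flow

variable {E : Type*} [NormedAddCommGroup E] [InnerProductSpace ℝ E] [CompleteSpace E]
  [SecondCountableTopology E] [MeasurableSpace E] [BorelSpace E]
  {φ : E → ℝ} {ν : Measure E} {g₀ : ℝ → E} {DK : E → E →L[ℝ] E} {c : ℝ}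

/-- Integral curves of `curveField` in the phase space exist on arbitrarily long intervals: the
conserved energy controls the velocity field in `C¹`. -/
theorem IsSpectralMeasure.exists_flow (h : IsSpectralMeasure φ ν)
    (A : E →L[ℝ] E →L[ℝ] E) (hA0 : ∀ a b, inner ℝ a (A a b) = 0)
    (hA : ∀ a b c d, inner ℝ (A a b) (A c d) =
      inner ℝ a c * inner ℝ b d - inner ℝ a d * inner ℝ b c)
    (hK : IsC1Kernel (kernel ν) DK c) (hDK : DK = kernelDeriv ν)
    (hg₀ : Integrable g₀ unitMeasure) {p₀ : CurveFrame E}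
    (hp₀ : p₀ ∈ phaseSpace g₀) {T : ℝ} (hT : 0 ≤ T) :
    ∃ α : ℝ → CurveFrame E, α 0 = p₀ ∧ (∀ t, α t ∈ phaseSpace g₀) ∧
      ∀ t ∈ Icc 0 T, HasDerivAt α (curveField A hK hg₀ (α t)) t := by
  subst hDK
  set C := energyBound A ν (energy ν g₀ p₀) with hC
  have hC0 : 0 ≤ C := energyBound_nonneg A (energy_nonneg p₀)
  -- `R` is an a priori bound: the curve moves at speed at most `C`, and the frame grows at most by
  -- `exp(C T)`. Since `C` depends on the initial energy alone, `R` can be fixed before the cut-off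
  -- equation is solved, and its solution stays where the cutoff is one.
  set R := max (‖p₀‖ + C * T) (‖p₀‖ * Real.exp (C * T)) with hR
  have hR0 : 0 ≤ R := le_max_of_le_left (by positivity)
  obtain ⟨α, h0, hmem, hd⟩ := exists_cutoff_flow A hK hg₀ hR0 hT hp₀
  have hθ : ∀ t, |cutoff R ‖α t‖| ≤ 1 := fun t => by
    rw [abs_of_nonneg (cutoff_nonneg _ _)]
    exact cutoff_le_one _ _
  have hsub : Icc 0 T ⊆ Ioo (-1) (T + 1) := fun t ht => ⟨by linarith [ht.1], by linarith [ht.2]⟩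
  have henergy : ∀ t ∈ Icc 0 T, energy ν g₀ (α t) = energy ν g₀ p₀ := fun t ht => by
    have he : ∀ s ∈ Icc 0 T, HasDerivAt (fun t => energy ν g₀ (α t)) 0 s := fun s hs =>
      h.hasDerivAt_energy_zero A hA0 hA hK hg₀ hθ hmem isOpen_Ioo hd (hsub hs)
    have := constant_of_has_deriv_right_zero
      (fun s hs => (he s hs).continuousAt.continuousWithinAt)
      (fun s hs => (he s (Ico_subset_Icc_self hs)).hasDerivWithinAt) t ht
    rw [this, h0]
  have hbound : ∀ t ∈ Icc 0 T, ‖α t‖ ≤ R := fun t ht => by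
    have hcurve : ∀ ξ, ∀ s ∈ Icc 0 T, HasDerivAt (fun s => (α s).curve ξ)
        (cutoff R ‖α s‖ • flowVelocity A (kernel ν) g₀ (α s) ((α s).curve ξ)) s := fun ξ s hs =>
      (CurveFrame.evalCurve (E := E) ξ).hasFDerivAt.comp_hasDerivAt s (hd s (hsub hs))
    have hframe : ∀ ξ, ∀ s ∈ Icc 0 T, HasDerivAt (fun s => (α s).frame ξ)
        (cutoff R ‖α s‖ • (flowGradient A (kernelDeriv ν) g₀ (α s) ((α s).curve ξ)).comp
          ((α s).frame ξ)) s := fun ξ s hs => by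
      have := (CurveFrame.evalFrame (E := E) ξ).hasFDerivAt.comp_hasDerivAt s (hd s (hsub hs))
      exact this
    have hCt : C * t ≤ C * T := mul_le_mul_of_nonneg_left ht.2 hC0
    refine CurveFrame.norm_le hR0 (fun ξ => le_max_of_le_left ?_) fun ξ => le_max_of_le_right ?_
    · have := norm_image_sub_le_of_norm_deriv_le_segment' (C := C)
        (fun s hs => (hcurve ξ s hs).hasDerivWithinAt) (fun s hs => by
          rw [norm_smul, Real.norm_eq_abs]
          refine (mul_le_of_le_one_left (norm_nonneg _) (hθ s)).trans
            ((h.norm_flowVelocity_le A hg₀ _ _).trans ?_)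
          rw [henergy s (Ico_subset_Icc_self hs)]) t ht
      rw [sub_zero, h0] at this
      have h1 := norm_le_norm_add_norm_sub' ((α t).curve ξ) (p₀.curve ξ)
      linarith [p₀.norm_curve_apply_le ξ]
    · have := norm_le_gronwallBound_of_norm_deriv_right_le (δ := ‖p₀‖) (K := C) (ε := 0)
        (fun s hs => (hframe ξ s hs).continuousAt.continuousWithinAt)
        (fun s hs => (hframe ξ s (Ico_subset_Icc_self hs)).hasDerivWithinAt)
        (by rw [h0]; exact p₀.norm_frame_apply_le ξ) (fun s hs => by
          rw [norm_smul, Real.norm_eq_abs, add_zero]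
          refine (mul_le_of_le_one_left (norm_nonneg _) (hθ s)).trans
            ((ContinuousLinearMap.opNorm_comp_le _ _).trans
            (mul_le_mul_of_nonneg_right ((h.norm_flowGradient_le hK A hg₀ _ _).trans ?_)
              (norm_nonneg _)))
          rw [henergy s (Ico_subset_Icc_self hs)]) t ht
      rw [sub_zero, gronwallBound_ε0] at this
      refine this.trans ?_
      gcongr
  refine ⟨α, h0, hmem, fun t ht => ?_⟩
  have := hd t (hsub ht)
  rwa [cutoff_eq_one (hbound t ht), one_smul] at this

end Flow

/-! ### Stability of the velocity under uniform convergence -/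

section Stability

variable {E : Type*} [NormedAddCommGroup E] [NormedSpace ℝ E] [CompleteSpace E]
  {K : E → E} {DK : E → E →L[ℝ] E} {c : ℝ} {g₀ : ℝ → E}

lemma IsC1Kernel.contDiff (h : IsC1Kernel K DK c) : ContDiff ℝ 1 K := by
  rw [contDiff_one_iff_fderiv, show fderiv ℝ K = DK from funext fun x => (h.hasFDerivAt x).fderiv]
  exact ⟨fun x => (h.hasFDerivAt x).differentiableAt, h.continuous_deriv⟩

/-- The function `B(K(y - γ), w)` takes the same value at both ends, so its derivative has integral
zero. The derivative is thus moved from `w` onto the kernel. -/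
lemma IsC1Kernel.integral_by_parts (h : IsC1Kernel K DK c) (B : E →L[ℝ] E →L[ℝ] E)
    {γ g w v : ℝ → E} (hγ : IsPrimitive γ g) (hγ1 : γ 1 = γ 0)
    (hw : IsPrimitive w v) (hw1 : w 1 = w 0) (hγc : Continuous γ) (hwc : Continuous w) (y : E) :
    ∫ ξ, B (K (y - γ ξ)) (v ξ) ∂unitMeasure =
      ∫ ξ, B (DK (y - γ ξ) (g ξ)) (w ξ) ∂unitMeasure := by
  have hU : ContDiff ℝ 1 fun z : E × E => B (K (y - z.1)) z.2 :=
    (B.contDiff.comp (h.contDiff.comp (contDiff_const.sub contDiff_fst))).clm_apply contDiff_snd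
  have hp := (hγ.prodMk hw).comp hU
  have hd : ∀ z e : E × E, fderiv ℝ (fun z : E × E => B (K (y - z.1)) z.2) z e =
      B (K (y - z.1)) e.2 - B (DK (y - z.1) e.1) z.2 := fun z e => by
    have h1 : HasFDerivAt (fun z : E × E => y - z.1) (-ContinuousLinearMap.fst ℝ E E) z :=
      hasFDerivAt_fst.const_sub y
    have h2 := B.hasFDerivAt.comp z ((h.hasFDerivAt (y - z.1)).comp z h1)
    have h3 := h2.clm_apply (hasFDerivAt_snd (𝕜 := ℝ) (E := E) (F := E) (p := z))
    refine (congrArg (fun L => L e) h3.fderiv).trans ?_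
    simp [sub_eq_add_neg]
  simp only [hd] at hp
  have hz := hp.integral_eq
  rw [hγ1, hw1, sub_self, integral_sub, sub_eq_zero] at hz
  · exact hz
  · exact integrable_clm_apply hw.integrable
      (B.continuous.comp (h.contDiff.continuous.comp (continuous_const.sub hγc))).continuousOn
  · refine integrable_clm_apply (A := fun ξ => (B.flip (w ξ)).comp (DK (y - γ ξ))) hγ.integrable ?_
    exact ((B.flip.continuous.comp hwc).clm_comp
      (h.continuous_deriv.comp (continuous_const.sub hγc))).continuousOn

/-- Stability of the velocity with respect to uniform convergence of closed curves. -/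
lemma IsC1Kernel.norm_lineIntegral_sub_le_of_closed (h : IsC1Kernel K DK c) (B : E →L[ℝ] E →L[ℝ] E)
    {γ g γ' g' : ℝ → E} (hγ : IsPrimitive γ g) (hγ1 : γ 1 = γ 0) (hγ' : IsPrimitive γ' g')
    (hγ'1 : γ' 1 = γ' 0) (hγc : Continuous γ) (hγ'c : Continuous γ') {M d : ℝ}
    (hM : ∫ ξ, ‖g ξ‖ ∂unitMeasure ≤ M) (hM' : ∫ ξ, ‖g' ξ‖ ∂unitMeasure ≤ M)
    (hd : ∀ ξ, ‖γ ξ - γ' ξ‖ ≤ d) (x y : E) :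
    ‖lineIntegral B K γ g x - lineIntegral B K γ' g' y‖ ≤ ‖B‖ * c * M * (‖x - y‖ + 2 * d) := by
  have hK := h.contDiff.continuous
  have hc := h.nonneg
  have hd0 : 0 ≤ d := (norm_nonneg _).trans (hd 0)
  have hM0 : 0 ≤ M := (integral_nonneg fun _ => norm_nonneg _).trans hM
  have i1 := integrable_lineIntegral (B := B) h.norm_le hK hγc hγ.integrable x
  have i2 := integrable_lineIntegral (B := B) h.norm_le hK hγ'c hγ.integrable y
  have i3 := integrable_lineIntegral (B := B) h.norm_le hK hγ'c hγ'.integrable y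
  have e1 : lineIntegral B K γ g x - lineIntegral B K γ' g' y =
      (∫ ξ, B (K (x - γ ξ)) (g ξ) - B (K (y - γ' ξ)) (g ξ) ∂unitMeasure) +
        ∫ ξ, B (K (y - γ' ξ)) (g ξ - g' ξ) ∂unitMeasure := by
    simp only [map_sub]
    rw [integral_sub i1 i2, integral_sub i2 i3, lineIntegral, lineIntegral]
    abel
  have b1 : ‖∫ ξ, B (K (x - γ ξ)) (g ξ) - B (K (y - γ' ξ)) (g ξ) ∂unitMeasure‖ ≤
      ‖B‖ * (c * (‖x - y‖ + d)) * M := by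
    refine (norm_integral_le_of_norm_le (hγ.integrable.norm.const_mul
      (‖B‖ * (c * (‖x - y‖ + d)))) (Eventually.of_forall fun ξ => ?_)).trans ?_
    · rw [← _root_.sub_apply, ← map_sub]
      refine B.le_of_opNorm₂_le_of_le le_rfl ((h.lipschitz _ _).trans ?_) le_rfl
      gcongr
      rw [show x - γ ξ - (y - γ' ξ) = (x - y) - (γ ξ - γ' ξ) by abel]
      exact (norm_sub_le _ _).trans (by gcongr; exact hd ξ)
    · rw [integral_const_mul]
      gcongr
  -- Nothing is assumed on the size of `g - g'`; by parts, only the uniform distance of the curves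
  -- enters. This accounts for the second `d` in the bound.
  have b2 : ‖∫ ξ, B (K (y - γ' ξ)) (g ξ - g' ξ) ∂unitMeasure‖ ≤ ‖B‖ * c * d * M := by
    rw [h.integral_by_parts B hγ' hγ'1 (hγ.sub hγ') (by rw [hγ1, hγ'1]) hγ'c (hγc.sub hγ'c)]
    refine (norm_integral_le_of_norm_le (hγ'.integrable.norm.const_mul (‖B‖ * c * d))
      (Eventually.of_forall fun ξ => ?_)).trans ?_
    · refine (B.le_of_opNorm₂_le_of_le le_rfl ((DK (y - γ' ξ)).le_of_opNorm_le
        (h.norm_deriv_le _) _) (hd ξ)).trans (le_of_eq ?_)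
      ring
    · rw [integral_const_mul]
      gcongr
  rw [e1]
  refine (norm_add_le _ _).trans ((add_le_add b1 b2).trans (le_of_eq ?_))
  ring

lemma continuous_curveField (A : E →L[ℝ] E →L[ℝ] E) (h : IsC1Kernel K DK c)
    (hg₀ : Integrable g₀ unitMeasure) : Continuous (curveField A h hg₀) := by
  refine continuous_iff_continuousAt.2 fun p => ?_
  have : ContinuousOn (curveField A h hg₀) (Metric.closedBall 0 (‖p‖ + 1)) :=
    (LipschitzOnWith.of_dist_le' fun q hq q' hq' => by
      rw [mem_closedBall_zero_iff] at hq hq'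
      simpa only [dist_eq_norm] using norm_curveField_sub_le A h hg₀ hq hq' :
      LipschitzOnWith _ _ _).continuousOn
  exact this.continuousAt (mem_of_superset (Metric.ball_mem_nhds p one_pos) fun q hq => by
    rw [mem_closedBall_zero_iff]
    rw [mem_ball_iff_norm] at hq
    linarith [norm_le_norm_add_norm_sub' q p])

end Stability

lemma inner_cross_self_left (a b : E3) : inner ℝ a (cross a b) = 0 := by
  simp only [EuclideanSpace.inner_eq_star_dotProduct, star_trivial, cross]
  rw [dotProduct_comm]
  exact dot_self_cross _ _

/-! ### Closed curves of class `H¹` and the phase space -/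

section Curves

lemma integral_norm_le_of_eLpNorm_two_le {g : ℝ → E3} (hg : MemLp g 2 unitMeasure) {M : ℝ}
    (hM : 0 ≤ M) (h : eLpNorm g 2 unitMeasure ≤ ENNReal.ofReal M) :
    ∫ ξ, ‖g ξ‖ ∂unitMeasure ≤ M := by
  rw [integral_norm_eq_lintegral_enorm hg.1, ← eLpNorm_one_eq_lintegral_enorm]
  exact ENNReal.toReal_le_of_le_ofReal hM
    ((eLpNorm_le_eLpNorm_of_exponent_le one_le_two hg.1).trans h)

variable {φ : E3 → ℝ} {ν : Measure E3}

/-- The weak derivative chosen in `velocity` is unique almost everywhere, so any density `g` of `γ`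
may replace it; for curves in the phase space this is the tangent `M g₀`. -/
lemma IsSpectralMeasure.velocity_eq (h : IsSpectralMeasure φ ν) {γ g : ℝ → E3} (hγ : MemH1Closed γ)
    (hg : IsPrimitive γ g) (x : E3) : velocity φ γ x = lineIntegral crossL (kernel ν) γ g x := by
  refine integral_congr_ae ?_
  filter_upwards [hγ.isPrimitive.ae_eq hg] with ξ hξ
  rw [h.gradient_eq, hξ, crossL_apply]

lemma MemH1Closed.map_one {γ : ℝ → E3} (hγ : MemH1Closed γ) : γ 1 = γ 0 := by
  simpa using hγ.periodic 0

variable {g₀ : ℝ → E3}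

lemma memLp_tangent (hg₀ : MemLp g₀ 2 unitMeasure) (p : CurveFrame E3) :
    MemLp (tangent g₀ p) 2 unitMeasure :=
  hg₀.of_le_mul (integrable_tangent (integrable_of_memLp_two hg₀) p).1
    (Eventually.of_forall (norm_tangent_le p))

lemma memH1Closed_curve (hg₀ : MemLp g₀ 2 unitMeasure) {p : CurveFrame E3} (hp : p ∈ phaseSpace g₀) :
    MemH1Closed p.curve :=
  ⟨p.curve.continuous, hp.1, _, hp.2.isWeakDeriv (memLp_tangent hg₀ p)⟩

/-- The initial datum as an element of the phase space. -/
lemma MemH1Closed.exists_mem_phaseSpace {γ₀ : ℝ → E3} (h : MemH1Closed γ₀) :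
    ∃ p ∈ phaseSpace (weakDeriv γ₀), ⇑p.curve = γ₀ := by
  obtain ⟨C, hC⟩ := (h.periodic.isBounded_of_continuous one_ne_zero h.continuous).exists_norm_le
  refine ⟨.mk (.ofNormedAddCommGroup γ₀ h.continuous C fun ξ => hC _ (mem_range_self ξ))
    (.const ℝ (.id ℝ E3)), ⟨h.periodic, ?_⟩, rfl⟩
  exact h.isPrimitive

end Curves

/-! ### Existence, uniqueness and gluing of solutions -/

section Solutions

variable {φ : E3 → ℝ} {ν : Measure E3} {γ₀ : ℝ → E3} {T : ℝ} {γ γ' : ℝ → ℝ → E3}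

lemma IsSolutionOn.mono (h : IsSolutionOn φ γ₀ T γ) {S : ℝ} (hS : S ≤ T) :
    IsSolutionOn φ γ₀ S γ := by
  have hsub : Icc 0 S ⊆ Icc 0 T := Icc_subset_Icc_right hS
  obtain ⟨K, hK⟩ := h.lipschitz
  obtain ⟨M, hM⟩ := h.bounded
  exact ⟨fun t ht => h.memH1 t (hsub ht), ⟨K, fun s hs t ht => hK s (hsub hs) t (hsub ht)⟩,
    ⟨M, fun t ht => hM t (hsub ht)⟩, fun t ht => h.integrable t (hsub ht),
    fun t ht => h.equation t (hsub ht)⟩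

lemma IsSolutionOn.congr (h : IsSolutionOn φ γ₀ T γ) (hγ : ∀ t ∈ Icc 0 T, γ' t = γ t) :
    IsSolutionOn φ γ₀ T γ' := by
  have hv : ∀ t ∈ Icc 0 T, ∀ ξ, ∀ τ ∈ uIcc 0 t,
      velocity φ (γ' τ) (γ' τ ξ) = velocity φ (γ τ) (γ τ ξ) := fun t ht ξ τ hτ => by
    rw [uIcc_of_le ht.1] at hτ
    rw [hγ τ ⟨hτ.1, hτ.2.trans ht.2⟩]
  obtain ⟨K, hK⟩ := h.lipschitz
  obtain ⟨M, hM⟩ := h.bounded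
  refine ⟨fun t ht => ?_, ⟨K, fun s hs t ht => ?_⟩, ⟨M, fun t ht => ?_⟩, fun t ht ξ => ?_,
    fun t ht ξ => ?_⟩
  · rw [hγ t ht]
    exact h.memH1 t ht
  · rw [hγ t ht, hγ s hs]
    exact hK s hs t ht
  · rw [hγ t ht]
    exact hM t ht
  · refine (h.integrable t ht ξ).congr fun τ hτ => ?_
    exact (hv t ht ξ τ (uIoc_subset_uIcc hτ)).symm
  · rw [intervalIntegral.integral_congr (hv t ht ξ), hγ t ht]
    exact h.equation t ht ξ

/-- The curve of an integral curve in the phase space is a solution. -/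
lemma IsSpectralMeasure.isSolutionOn_curve (h : IsSpectralMeasure φ ν) {DK : E3 → E3 →L[ℝ] E3}
    {c : ℝ} (hK : IsC1Kernel (kernel ν) DK c) {g₀ : ℝ → E3} (hg₀ : MemLp g₀ 2 unitMeasure)
    {α : ℝ → CurveFrame E3} (h0 : ⇑(α 0).curve = γ₀) (hmem : ∀ t, α t ∈ phaseSpace g₀)
    (hd : ∀ t ∈ Icc 0 T,
      HasDerivAt α (curveField crossL hK (integrable_of_memLp_two hg₀) (α t)) t) :
    IsSolutionOn φ γ₀ T (fun t => (α t).curve) ∧ ∀ t ∈ Icc 0 T, ∀ ξ,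
      HasDerivAt (fun s => (α s).curve ξ) (velocity φ (α t).curve ((α t).curve ξ)) t := by
  have hi := integrable_of_memLp_two hg₀
  have hvel : ∀ t ξ, velocity φ (α t).curve ((α t).curve ξ) =
      (curveField crossL hK (integrable_of_memLp_two hg₀) (α t)).curve ξ := fun t ξ =>
    h.velocity_eq (memH1Closed_curve hg₀ (hmem t)) (hmem t).2 _
  have hder : ∀ t ∈ Icc 0 T, ∀ ξ, HasDerivAt (fun s => (α s).curve ξ)
      (velocity φ (α t).curve ((α t).curve ξ)) t := fun t ht ξ => by
    rw [hvel]
    exact (CurveFrame.evalCurve (E := E3) ξ).hasFDerivAt.comp_hasDerivAt t (hd t ht)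
  have hαc : ContinuousOn α (Icc 0 T) := fun t ht => (hd t ht).continuousAt.continuousWithinAt
  obtain ⟨R, hR⟩ := isCompact_Icc.exists_bound_of_continuousOn hαc
  have hsub : ∀ t ∈ Icc 0 T, uIcc 0 t ⊆ Icc 0 T := fun t ht => by
    rw [uIcc_of_le ht.1]
    exact Icc_subset_Icc_right ht.2
  have hint : ∀ t ∈ Icc 0 T, ∀ ξ, IntervalIntegrable
      (fun τ => velocity φ (α τ).curve ((α τ).curve ξ)) volume 0 t := fun t ht ξ => by
    simp only [hvel]
    refine ContinuousOn.intervalIntegrable ?_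
    exact ((CurveFrame.evalCurve (E := E3) ξ).continuous.comp
      (continuous_curveField crossL hK hi)).comp_continuousOn (hαc.mono (hsub t ht))
  refine ⟨⟨fun t _ => memH1Closed_curve hg₀ (hmem t), ?_, ?_, hint, fun t ht ξ => ?_⟩, hder⟩
  · refine ⟨fieldConst crossL c g₀ * R * (1 + R), fun s hs t ht => ?_⟩
    have hb := (convex_Icc 0 T).norm_image_sub_le_of_norm_hasDerivWithin_le
      (fun τ hτ => (hd τ hτ).hasDerivWithinAt) (fun τ hτ => norm_curveField_le crossL hK hi (hR τ hτ))
      hs ht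
    refine (eLpNorm_le_of_ae_bound (C := fieldConst crossL c g₀ * R * (1 + R) * |t - s|)
      (Eventually.of_forall fun ξ => ?_)).trans (le_of_eq (by simp))
    exact ((α t - α s).norm_curve_apply_le ξ).trans hb
  · refine ⟨R + R * (eLpNorm g₀ 2 unitMeasure).toReal, fun t ht => ?_⟩
    have hR0 : 0 ≤ R := (norm_nonneg _).trans (hR t ht)
    rw [ENNReal.ofReal_add hR0 (by positivity)]
    refine add_le_add ?_ ?_
    · exact (eLpNorm_le_of_ae_bound (C := R) (Eventually.of_forall fun ξ =>
        ((α t).norm_curve_apply_le ξ).trans (hR t ht))).trans (le_of_eq (by simp))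
    · rw [eLpNorm_congr_ae ((memH1Closed_curve hg₀ (hmem t)).isPrimitive.ae_eq (hmem t).2),
        ENNReal.ofReal_mul hR0, ENNReal.ofReal_toReal hg₀.2.ne]
      refine eLpNorm_le_mul_eLpNorm_of_ae_le_mul (Eventually.of_forall fun ξ => ?_) 2
      exact (norm_tangent_le _ _).trans (by gcongr; exact hR t ht)
  · rw [intervalIntegral.integral_eq_sub_of_hasDerivAt (fun τ hτ => hder τ (hsub t ht hτ) ξ)
      (hint t ht ξ), h0]
    abel

lemma IsSpectralMeasure.exists_isSolutionOn (h : IsSpectralMeasure φ ν) (hγ₀ : MemH1Closed γ₀)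
    (hT : 0 ≤ T) : ∃ γ, IsSolutionOn φ γ₀ T γ ∧ ∀ t ∈ Icc 0 T, ∀ ξ,
      HasDerivAt (fun s => γ s ξ) (velocity φ (γ t) (γ t ξ)) t := by
  obtain ⟨c, hK⟩ := h.exists_isC1Kernel
  obtain ⟨p₀, hp₀, he⟩ := hγ₀.exists_mem_phaseSpace
  have hg₀ := hγ₀.isWeakDeriv.memLp
  obtain ⟨α, h0, hmem, hd⟩ := h.exists_flow crossL inner_cross_self_left inner_cross_cross hK rfl
    (integrable_of_memLp_two hg₀) hp₀ hT
  exact ⟨fun t => (α t).curve, h.isSolutionOn_curve hK hg₀ (by rw [h0, he]) hmem hd⟩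

/-- A linear integral inequality forces a bounded function to vanish. -/
lemma eq_zero_of_integral_iteration {w : ℝ → ℝ → E3} {C D : ℝ}
    (hD : ∀ t ∈ Icc 0 T, ∀ ξ, ‖w t ξ‖ ≤ D)
    (hw : ∀ f : ℝ → ℝ, Continuous f → (∀ t ∈ Icc 0 T, ∀ ξ, ‖w t ξ‖ ≤ f t) →
      ∀ t ∈ Icc 0 T, ∀ ξ, ‖w t ξ‖ ≤ ∫ τ in (0 : ℝ)..t, C * f τ)
    {t : ℝ} (ht : t ∈ Icc 0 T) (ξ : ℝ) : w t ξ = 0 := by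
  -- Picard iteration in place of Gronwall's inequality: the majorants are explicit continuous
  -- functions of time, so no regularity in `t` of the supremum over `ξ` has to be known.
  have key : ∀ n : ℕ, ∀ t ∈ Icc 0 T, ∀ ξ, ‖w t ξ‖ ≤ D * ((C * t) ^ n / n.factorial) := fun n => by
    induction n with
    | zero => simpa using hD
    | succ n ih =>
      intro t ht ξ
      refine (hw _ (by fun_prop) ih t ht ξ).trans (le_of_eq ?_)
      have : (fun τ => C * (D * ((C * τ) ^ n / n.factorial))) =
          fun τ => (C ^ (n + 1) * D / n.factorial) * τ ^ n := by
        ext τ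
        ring
      rw [this, intervalIntegral.integral_const_mul, integral_pow, Nat.factorial_succ]
      have : (n.factorial : ℝ) ≠ 0 := by positivity
      have : (n : ℝ) + 1 ≠ 0 := by positivity
      push_cast
      field_simp
      ring
  have hlim := (FloorSemiring.tendsto_pow_div_factorial_atTop (C * t)).const_mul D
  rw [mul_zero] at hlim
  exact norm_le_zero_iff.1 (ge_of_tendsto' hlim fun n => key n t ht ξ)

/-- Uniqueness of solutions. -/
theorem IsSpectralMeasure.eq_of_isSolutionOn (h : IsSpectralMeasure φ ν)
    (hγ : IsSolutionOn φ γ₀ T γ) (hγ' : IsSolutionOn φ γ₀ T γ') {t : ℝ} (ht : t ∈ Icc 0 T) :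
    γ t = γ' t := by
  obtain ⟨c, hK⟩ := h.exists_isC1Kernel
  obtain ⟨M₁, hM₁⟩ := hγ.bounded
  obtain ⟨M₂, hM₂⟩ := hγ'.bounded
  -- A common bound for both solutions; the zero is included because the given constants have no
  -- sign. On the probability space `(0,1)` it bounds the `L¹` norms of the derivatives too.
  set M := max (max M₁ M₂) 0
  have hM0 : 0 ≤ M := le_max_right _ _
  have hc := hK.nonneg
  have hm : ∀ t ∈ Icc 0 T, ∫ ξ, ‖weakDeriv (γ t) ξ‖ ∂unitMeasure ≤ M := fun t ht =>
    integral_norm_le_of_eLpNorm_two_le (hγ.memH1 t ht).isWeakDeriv.memLp hM0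
      ((le_add_self.trans (hM₁ t ht)).trans (ENNReal.ofReal_le_ofReal
        ((le_max_left _ _).trans (le_max_left _ _))))
  have hm' : ∀ t ∈ Icc 0 T, ∫ ξ, ‖weakDeriv (γ' t) ξ‖ ∂unitMeasure ≤ M := fun t ht =>
    integral_norm_le_of_eLpNorm_two_le (hγ'.memH1 t ht).isWeakDeriv.memLp hM0
      ((le_add_self.trans (hM₂ t ht)).trans (ENNReal.ofReal_le_ofReal
        ((le_max_right _ _).trans (le_max_left _ _))))
  set V := ‖crossL‖ * c * M
  have hV : 0 ≤ V := by positivity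
  have hv : ∀ {η : ℝ → E3}, MemH1Closed η → ∫ ξ, ‖weakDeriv η ξ‖ ∂unitMeasure ≤ M → ∀ x,
      ‖velocity φ η x‖ ≤ V := fun hη hm x => by
    rw [h.velocity_eq hη hη.isPrimitive]
    exact (norm_lineIntegral_le (norm_nonneg crossL) crossL.le_opNorm₂ hK.norm_le
      hη.isPrimitive.integrable x).trans (mul_le_mul_of_nonneg_left hm (by positivity))
  have hsub : ∀ t ∈ Icc 0 T, ∀ τ ∈ Ioc 0 t, τ ∈ Icc 0 T := fun t ht τ hτ =>
    ⟨hτ.1.le, hτ.2.trans ht.2⟩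
  have hdiff : ∀ t ∈ Icc 0 T, ∀ ξ, γ t ξ - γ' t ξ = ∫ τ in (0 : ℝ)..t,
      (velocity φ (γ τ) (γ τ ξ) - velocity φ (γ' τ) (γ' τ ξ)) := fun t ht ξ => by
    rw [hγ.equation t ht, hγ'.equation t ht,
      intervalIntegral.integral_sub (hγ.integrable t ht ξ) (hγ'.integrable t ht ξ)]
    abel
  ext1 ξ
  -- The stability constant multiplies `‖x - y‖ + 2 d`, and both distances are at most `f`, whence
  -- the factor 3. The initial bound `2 V T` comes from each velocity being at most `V`.
  refine sub_eq_zero.1 (eq_zero_of_integral_iteration (w := fun t ξ => γ t ξ - γ' t ξ) (T := T)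
    (C := V * 3) (D := 2 * V * T) (fun t ht ξ => ?_) (fun f hf hwf t ht ξ => ?_) ht ξ)
  · rw [hdiff t ht ξ]
    refine (intervalIntegral.norm_integral_le_of_norm_le_const (C := 2 * V) fun τ hτ => ?_).trans ?_
    · rw [uIoc_of_le ht.1] at hτ
      have hτ' := hsub t ht τ hτ
      refine (norm_sub_le _ _).trans ?_
      linarith [hv (hγ.memH1 τ hτ') (hm τ hτ') (γ τ ξ), hv (hγ'.memH1 τ hτ') (hm' τ hτ') (γ' τ ξ)]
    · rw [sub_zero, abs_of_nonneg ht.1]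
      exact mul_le_mul_of_nonneg_left ht.2 (by positivity)
  · rw [hdiff t ht ξ]
    refine intervalIntegral.norm_integral_le_of_norm_le ht.1 (Eventually.of_forall fun τ hτ => ?_)
      ((continuous_const.mul hf).intervalIntegrable _ _)
    have hτ' := hsub t ht τ hτ
    have h1 := hγ.memH1 τ hτ'
    have h2 := hγ'.memH1 τ hτ'
    rw [h.velocity_eq h1 h1.isPrimitive, h.velocity_eq h2 h2.isPrimitive]
    refine (hK.norm_lineIntegral_sub_le_of_closed crossL h1.isPrimitive h1.map_one h2.isPrimitive
      h2.map_one h1.continuous h2.continuous (hm τ hτ') (hm' τ hτ') (hwf τ hτ') _ _).trans ?_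
    calc V * (‖γ τ ξ - γ' τ ξ‖ + 2 * f τ) ≤ V * (3 * f τ) := by
          refine mul_le_mul_of_nonneg_left ?_ hV
          linarith [hwf τ hτ' ξ]
      _ = V * 3 * f τ := by ring

/-- Global existence and uniqueness. -/
theorem IsSpectralMeasure.exists_global_solution (h : IsSpectralMeasure φ ν)
    (hγ₀ : MemH1Closed γ₀) :
    ∃ γ : ℝ → ℝ → E3, (∀ T : ℝ, 0 < T → IsSolutionOn φ γ₀ T γ) ∧
      (∀ t : ℝ, 0 ≤ t → ∀ ξ : ℝ,
        HasDerivWithinAt (fun s => γ s ξ) (velocity φ (γ t) (γ t ξ)) (Ici 0) t) ∧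
      (∀ T : ℝ, 0 < T → ∀ γ' : ℝ → ℝ → E3, IsSolutionOn φ γ₀ T γ' →
        ∀ t ∈ Icc 0 T, γ' t = γ t) := by
  have hex : ∀ T : ℝ, ∃ γ : ℝ → ℝ → E3, 0 ≤ T → IsSolutionOn φ γ₀ T γ ∧ ∀ t ∈ Icc 0 T, ∀ ξ,
      HasDerivAt (fun s => γ s ξ) (velocity φ (γ t) (γ t ξ)) t := fun T => by
    by_cases hT : 0 ≤ T
    · obtain ⟨γ, hγ⟩ := h.exists_isSolutionOn hγ₀ hT
      exact ⟨γ, fun _ => hγ⟩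
    · exact ⟨0, fun h => absurd h hT⟩
  choose Γ hΓ using hex
  -- By uniqueness the solutions on different intervals agree, so the diagonal `Γ t t` is a global
  -- solution.
  have heq : ∀ T, ∀ t ∈ Icc 0 T, Γ t t = Γ T t := fun T t ht =>
    h.eq_of_isSolutionOn (hΓ t ht.1).1 ((hΓ T (ht.1.trans ht.2)).1.mono ht.2) ⟨ht.1, le_rfl⟩
  have hsol : ∀ T : ℝ, 0 < T → IsSolutionOn φ γ₀ T (fun t => Γ t t) := fun T hT =>
    (hΓ T hT.le).1.congr (heq T)
  refine ⟨fun t => Γ t t, hsol, fun t ht ξ => ?_, fun T hT γ' hγ' t ht =>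
    h.eq_of_isSolutionOn hγ' (hsol T hT) ht⟩
  -- The horizon `t + 1` leaves room to the right of `t`: near `t` within `[0,∞)` the diagonal
  -- coincides with the single solution `Γ (t + 1)`.
  have hmem : t ∈ Icc 0 (t + 1) := ⟨ht, by linarith⟩
  have hd := ((hΓ (t + 1) (by linarith)).2 t hmem ξ).hasDerivWithinAt (s := Ici 0)
  rw [← heq (t + 1) t hmem] at hd
  refine hd.congr_of_eventuallyEq ?_ (congrFun (heq (t + 1) t hmem) ξ)
  filter_upwards [self_mem_nhdsWithin, mem_nhdsWithin_of_mem_nhds (Iio_mem_nhds (lt_add_one t))]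
    with s hs0 hs1
  exact congrFun (heq (t + 1) s ⟨hs0, hs1.le⟩) ξ

end Solutions

/-! ### The Rosenhead kernel -/

section Rosenhead

open scoped FourierTransform SchwartzMap

/-- The Fourier transform in `x` of `exp(-δ r² - r² |x|²)`, for `b = 4`. -/
def gaussianMixture (δ b : ℝ) (z : ℝ × E3) : ℝ :=
  Real.exp (-δ * z.1 ^ 2) * (Real.pi / z.1 ^ 2) ^ (Module.finrank ℝ E3 / 2 : ℝ) *
    Real.exp (-(b * z.1 ^ 2)⁻¹ * ‖z.2‖ ^ 2)

lemma gaussianMixture_nonneg (δ b : ℝ) (z : ℝ × E3) : 0 ≤ gaussianMixture δ b z := by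
  unfold gaussianMixture
  positivity

lemma measurable_gaussianMixture (δ b : ℝ) : Measurable (gaussianMixture δ b) := by
  unfold gaussianMixture
  fun_prop

lemma integrable_exp_neg_mul_sq_norm {b : ℝ} (hb : 0 < b) :
    Integrable fun k : E3 => Real.exp (-b * ‖k‖ ^ 2) := by
  refine .of_integral_ne_zero ?_
  rw [GaussianFourier.integral_rexp_neg_mul_sq_norm hb]
  positivity

/-- Tonelli: the integral in `k` of the Gaussian cancels the factor `r⁻³`, and the integrable
function `exp(-δ r²)` remains, up to a constant. -/
lemma integrable_gaussianMixture {δ b : ℝ} (hδ : 0 < δ) (hb : 0 < b) :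
    Integrable (gaussianMixture δ b) ((volume.restrict (Ioi 0)).prod volume) := by
  have hpos : ∀ {r : ℝ}, 0 < r → 0 < (b * r ^ 2)⁻¹ := fun hr => by positivity
  rw [integrable_prod_iff (measurable_gaussianMixture δ b).aestronglyMeasurable]
  constructor
  · refine (ae_restrict_iff' measurableSet_Ioi).2 (Eventually.of_forall fun r hr => ?_)
    simp only [gaussianMixture]
    exact (integrable_exp_neg_mul_sq_norm (hpos hr)).const_mul _
  · have hi : IntegrableOn (fun r : ℝ => Real.exp (-δ * r ^ 2) *
        (Real.pi ^ 2 * b) ^ (Module.finrank ℝ E3 / 2 : ℝ)) (Ioi 0) :=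
      ((integrable_exp_neg_mul_sq hδ).mul_const _).integrableOn
    refine hi.congr_fun (fun r hr => ?_) measurableSet_Ioi
    have hr : 0 < r := hr
    simp only [Real.norm_of_nonneg (gaussianMixture_nonneg δ b _)]
    simp only [gaussianMixture]
    rw [integral_const_mul, GaussianFourier.integral_rexp_neg_mul_sq_norm (hpos hr), mul_assoc,
      ← Real.mul_rpow (by positivity) (by positivity)]
    congr 2
    field_simp

lemma one_add_mul_sq_le {a y : ℝ} (ha : 0 ≤ a) (hy : 0 ≤ y) :
    (1 + a * y) ^ 2 ≤ 2 * (1 + a) ^ 2 * Real.exp y := by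
  have h1 : (1 + y) ^ 2 ≤ 2 * Real.exp y := by
    nlinarith [Real.quadratic_le_exp_of_nonneg hy]
  calc (1 + a * y) ^ 2 ≤ ((1 + a) * (1 + y)) ^ 2 := by gcongr; nlinarith
    _ = (1 + a) ^ 2 * (1 + y) ^ 2 := by ring
    _ ≤ (1 + a) ^ 2 * (2 * Real.exp y) := by gcongr
    _ = _ := by ring

/-- Half of each exponent absorbs the weight: part of the Gaussian in `k` reduces it to a multiple
of `(1 + 8 r²)²`, which part of `exp(-δ r²)` then absorbs. What is left is the mixture with
parameters `δ/2` and `8`. -/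
lemma integrable_weight_mul_gaussianMixture {δ : ℝ} (hδ : 0 < δ) :
    Integrable (fun z : ℝ × E3 => (1 + ‖z.2‖ ^ 2) ^ 2 * gaussianMixture δ 4 z)
      ((volume.restrict (Ioi 0)).prod volume) := by
  refine ((integrable_gaussianMixture (half_pos hδ) (b := 8) (by norm_num)).const_mul
    (4 * (1 + 16 / δ) ^ 2)).mono' ?_ ?_
  · exact (Continuous.aestronglyMeasurable (by fun_prop)).mul
      (measurable_gaussianMixture δ 4).aestronglyMeasurable
  · have hae : ∀ᵐ z : ℝ × E3 ∂((volume.restrict (Ioi 0)).prod volume), 0 < z.1 :=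
      Measure.quasiMeasurePreserving_fst.ae (ae_restrict_mem measurableSet_Ioi)
    filter_upwards [hae] with z hz
    rw [Real.norm_of_nonneg (mul_nonneg (by positivity) (gaussianMixture_nonneg _ _ _))]
    obtain ⟨r, k⟩ := z
    simp only at hz
    simp only [gaussianMixture]
    have h1 := one_add_mul_sq_le (a := 8 * r ^ 2) (y := (8 * r ^ 2)⁻¹ * ‖k‖ ^ 2) (by positivity)
      (by positivity)
    rw [mul_inv_cancel_left₀ (by positivity)] at h1
    -- The coefficient `16/δ` is chosen so that its product with `δ r²/2` is `8 r²`.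
    have h2 := one_add_mul_sq_le (a := 16 / δ) (y := δ / 2 * r ^ 2) (by positivity) (by positivity)
    rw [show 16 / δ * (δ / 2 * r ^ 2) = 8 * r ^ 2 by field_simp; norm_num] at h2
    set P := (Real.pi / r ^ 2) ^ (Module.finrank ℝ E3 / 2 : ℝ)
    have hP : 0 ≤ P := by positivity
    have e1 : Real.exp (-δ * r ^ 2) = Real.exp (-(δ / 2) * r ^ 2) * Real.exp (-(δ / 2) * r ^ 2) := by
      rw [← Real.exp_add]
      ring_nf
    have e2 : Real.exp (-(4 * r ^ 2)⁻¹ * ‖k‖ ^ 2) = Real.exp (-(8 * r ^ 2)⁻¹ * ‖k‖ ^ 2) *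
        Real.exp (-(8 * r ^ 2)⁻¹ * ‖k‖ ^ 2) := by
      rw [← Real.exp_add]
      congr 1
      field_simp
      ring
    have e3 : Real.exp (δ / 2 * r ^ 2) * Real.exp (-(δ / 2) * r ^ 2) = 1 := by
      rw [← Real.exp_add]
      ring_nf
      exact Real.exp_zero
    have e4 : Real.exp ((8 * r ^ 2)⁻¹ * ‖k‖ ^ 2) * Real.exp (-(8 * r ^ 2)⁻¹ * ‖k‖ ^ 2) = 1 := by
      rw [← Real.exp_add, neg_mul, add_neg_cancel, Real.exp_zero]
    rw [e1, e2]
    set X := Real.exp (-(δ / 2) * r ^ 2)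
    set Y := Real.exp (-(8 * r ^ 2)⁻¹ * ‖k‖ ^ 2)
    set X' := Real.exp (δ / 2 * r ^ 2)
    set Y' := Real.exp ((8 * r ^ 2)⁻¹ * ‖k‖ ^ 2)
    have hX : 0 ≤ X := (Real.exp_pos _).le
    have hY : 0 ≤ Y := (Real.exp_pos _).le
    have hY' : 0 ≤ Y' := (Real.exp_pos _).le
    calc (1 + ‖k‖ ^ 2) ^ 2 * (X * X * P * (Y * Y))
        ≤ (2 * (2 * (1 + 16 / δ) ^ 2 * X') * Y') * (X * X * P * (Y * Y)) := by
          refine mul_le_mul_of_nonneg_right (h1.trans ?_) (by positivity)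
          gcongr
      _ = 4 * (1 + 16 / δ) ^ 2 * (X * P * Y) * ((X' * X) * (Y' * Y)) := by ring
      _ = _ := by rw [e3, e4, mul_one, mul_one]

/-- The Fourier transform of the Rosenhead kernel. -/
def rosenheadTransform (Γ μ : ℝ) (k : E3) : ℝ :=
  2 * Γ / √Real.pi * ∫ r in Ioi (0 : ℝ), gaussianMixture (μ ^ 2) 4 (r, k)

variable {Γ μ : ℝ}

/-- The Gaussian integral `s^(-1/2) = (2/√π) ∫₀^∞ exp(-s r²) dr` at `s = |x|² + μ²`. It reduces the
Fourier transform of the kernel to those of Gaussians, whose positivity gives (A.2). -/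
lemma rosenheadKernel_eq_integral (hμ : 0 < μ) (x : E3) :
    rosenheadKernel Γ μ x =
      2 * Γ / √Real.pi * ∫ r in Ioi (0 : ℝ), Real.exp (-μ ^ 2 * r ^ 2) * Real.exp (-r ^ 2 * ‖x‖ ^ 2) := by
  have : ∀ r : ℝ, Real.exp (-μ ^ 2 * r ^ 2) * Real.exp (-r ^ 2 * ‖x‖ ^ 2) =
      Real.exp (-(‖x‖ ^ 2 + μ ^ 2) * r ^ 2) := fun r => by
    rw [← Real.exp_add]
    ring_nf
  simp_rw [this]
  rw [integral_gaussian_Ioi, Real.sqrt_div Real.pi_pos.le, rosenheadKernel]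
  have h1 : √Real.pi ≠ 0 := by positivity
  have h2 : √(‖x‖ ^ 2 + μ ^ 2) ≠ 0 := by positivity
  field_simp

lemma continuous_rosenheadKernel (hμ : 0 < μ) : Continuous (rosenheadKernel Γ μ) := by
  unfold rosenheadKernel
  refine continuous_const.div (by fun_prop) fun x => ?_
  positivity

lemma integrable_gaussianMixture_four (hμ : 0 < μ) :
    Integrable (gaussianMixture (μ ^ 2) 4) ((volume.restrict (Ioi 0)).prod volume) :=
  integrable_gaussianMixture (by positivity) (by norm_num)

lemma integrable_rosenheadTransform (hμ : 0 < μ) : Integrable (rosenheadTransform Γ μ) :=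
  (integrable_gaussianMixture_four hμ).integral_prod_right.const_mul _

/-- The integral of a Gaussian against a Fourier transform. -/
lemma integral_exp_mul_fourier {r : ℝ} (hr : 0 < r) {ψ : E3 → ℂ} (hψ : Integrable ψ) :
    ∫ x : E3, (Real.exp (-r ^ 2 * ‖x‖ ^ 2) : ℂ) *
        ∫ k : E3, Complex.exp (Complex.I * (inner ℝ k x : ℝ)) * ψ k =
      ∫ k : E3, ((Real.pi / r ^ 2) ^ (Module.finrank ℝ E3 / 2 : ℝ) *
        Real.exp (-(4 * r ^ 2)⁻¹ * ‖k‖ ^ 2) : ℝ) * ψ k := by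
  have hG := integrable_exp_neg_mul_sq_norm (b := r ^ 2) (by positivity)
  simp_rw [← integral_const_mul]
  rw [integral_integral_swap]
  · refine integral_congr_ae (Eventually.of_forall fun k => ?_)
    have h := GaussianFourier.integral_cexp_neg_mul_sq_norm_add (V := E3) (b := ((r ^ 2 : ℝ) : ℂ))
      (by rw [Complex.ofReal_re]; positivity) Complex.I k
    simp only
    simp_rw [← mul_assoc]
    rw [integral_mul_const]
    congr 1
    refine Eq.trans (integral_congr_ae (Eventually.of_forall fun x => ?_)) (h.trans ?_)
    · simp only [Complex.ofReal_exp, ← Complex.exp_add]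
      push_cast
      ring_nf
    · rw [Complex.ofReal_mul, Complex.ofReal_cpow (by positivity), Complex.ofReal_exp]
      push_cast
      congr 2
      rw [Complex.I_sq]
      have : (r : ℂ) ≠ 0 := by exact_mod_cast hr.ne'
      field_simp
  · refine (hG.ofReal.mul_prod hψ).mono ?_ (Eventually.of_forall fun z => le_of_eq ?_)
    · refine (Continuous.aestronglyMeasurable (by fun_prop)).mul
        ((Continuous.aestronglyMeasurable ?_).mul hψ.1.comp_snd)
      fun_prop
    · simp only [Function.uncurry, norm_mul]
      rw [mul_comm Complex.I, Complex.norm_exp_ofReal_mul_I, one_mul]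
      rfl

/-- By Fourier inversion this is a dilated Schwartz function. The Rosenhead kernel is not
integrable, so the exchange of integrals rests on the decay of the transformed test function. -/
lemma integrable_integral_exp_mul (ψ : 𝓢(E3, ℂ)) :
    Integrable fun x : E3 => ∫ k : E3, Complex.exp (Complex.I * (inner ℝ k x : ℝ)) * ψ k := by
  have h : 𝓕⁻ (𝓕 ψ) = ψ := FourierTransform.fourierInv_fourier_eq ψ
  have e : ∀ x : E3, ∫ k : E3, Complex.exp (Complex.I * (inner ℝ k x : ℝ)) * ψ k =
      (𝓕 ψ) ((-(2 * Real.pi)⁻¹ : ℝ) • x) := fun x => by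
    conv_lhs => rw [← h]
    exact integral_exp_mul_fourierInv _ x
  simp_rw [e]
  exact (𝓕 ψ).integrable.comp_smul (by simp [Real.pi_ne_zero])

/-- The pairing holds for each Gaussian by `integral_exp_mul_fourier`. Fubini's theorem, applied on
both sides, carries it over to the superposition in `r`. -/
theorem isFourierTransform_rosenhead (hΓ : 0 < Γ) (hμ : 0 < μ) :
    IsFourierTransform (rosenheadKernel Γ μ) (rosenheadTransform Γ μ) := by
  have hbound : ∀ x : E3, ‖(rosenheadKernel Γ μ x : ℂ)‖ ≤ Γ / μ := fun x => by
    rw [Complex.norm_real, rosenheadKernel, Real.norm_of_nonneg (by positivity)]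
    refine div_le_div_of_nonneg_left hΓ.le hμ (Real.le_sqrt_of_sq_le ?_)
    linarith [sq_nonneg ‖x‖]
  refine ⟨fun ψ => ψ.integrable.bdd_mul
    (Complex.continuous_ofReal.comp (continuous_rosenheadKernel hμ)).aestronglyMeasurable
    (Eventually.of_forall hbound), fun ψ => ?_, fun ψ => ?_⟩
  · obtain ⟨C, hC⟩ := ψ.toBoundedContinuousFunction.isBounded_range.exists_norm_le
    exact (integrable_rosenheadTransform hμ).ofReal.mul_bdd ψ.continuous.aestronglyMeasurable
      (Eventually.of_forall fun k => hC _ (mem_range_self k))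
  · set Ψ : E3 → ℂ := fun x => ∫ k : E3, Complex.exp (Complex.I * (inner ℝ k x : ℝ)) * ψ k
    have hΨ : Integrable Ψ := integrable_integral_exp_mul ψ
    have hr : Integrable (fun r : ℝ => (Real.exp (-μ ^ 2 * r ^ 2) : ℂ)) (volume.restrict (Ioi 0)) :=
      (integrable_exp_neg_mul_sq (b := μ ^ 2) (by positivity)).integrableOn.ofReal
    have i1 : Integrable (Function.uncurry fun (x : E3) (r : ℝ) =>
        ((Real.exp (-μ ^ 2 * r ^ 2) * Real.exp (-r ^ 2 * ‖x‖ ^ 2) : ℝ) : ℂ) * Ψ x)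
        (volume.prod (volume.restrict (Ioi 0))) := by
      refine (hΨ.mul_prod hr).mono ?_ (Eventually.of_forall fun z => ?_)
      · refine (Continuous.aestronglyMeasurable ?_).mul hΨ.1.comp_fst
        fun_prop
      · simp only [Function.uncurry, norm_mul, Complex.norm_real, Real.norm_eq_abs, Real.abs_exp]
        rw [mul_comm, ← mul_assoc]
        refine mul_le_of_le_one_right (by positivity) (Real.exp_le_one_iff.2 ?_)
        nlinarith [sq_nonneg z.2, sq_nonneg ‖z.1‖, mul_nonneg (sq_nonneg z.2) (sq_nonneg ‖z.1‖)]
    have i2 : Integrable (Function.uncurry fun (r : ℝ) (k : E3) =>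
        (gaussianMixture (μ ^ 2) 4 (r, k) : ℂ) * ψ k) ((volume.restrict (Ioi 0)).prod volume) := by
      obtain ⟨C, hC⟩ := ψ.toBoundedContinuousFunction.isBounded_range.exists_norm_le
      exact (integrable_gaussianMixture_four hμ).ofReal.mul_bdd (c := C)
        (ψ.continuous.comp continuous_snd).aestronglyMeasurable
        (Eventually.of_forall fun z => hC _ (mem_range_self z.2))
    have e1 : ∀ x, (rosenheadKernel Γ μ x : ℂ) * Ψ x = (2 * Γ / √Real.pi : ℝ) *
        ∫ r in Ioi (0 : ℝ), ((Real.exp (-μ ^ 2 * r ^ 2) * Real.exp (-r ^ 2 * ‖x‖ ^ 2) : ℝ) : ℂ) *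
          Ψ x := fun x => by
      rw [rosenheadKernel_eq_integral hμ, integral_mul_const, integral_complex_ofReal,
        Complex.ofReal_mul, mul_assoc]
    have e2 : ∀ k, (rosenheadTransform Γ μ k : ℂ) * ψ k = (2 * Γ / √Real.pi : ℝ) *
        ∫ r in Ioi (0 : ℝ), (gaussianMixture (μ ^ 2) 4 (r, k) : ℂ) * ψ k := fun k => by
      rw [rosenheadTransform, integral_mul_const, integral_complex_ofReal,
        Complex.ofReal_mul, mul_assoc]
    change ∫ x, (rosenheadKernel Γ μ x : ℂ) * Ψ x = _
    simp_rw [e1, e2]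
    rw [integral_const_mul, integral_const_mul, integral_integral_swap i1, ← integral_integral_swap i2]
    congr 1
    refine setIntegral_congr_fun measurableSet_Ioi fun r hr => ?_
    simp only [gaussianMixture, Complex.ofReal_mul (Real.exp (-μ ^ 2 * r ^ 2)), mul_assoc]
    rw [integral_const_mul, integral_const_mul, integral_exp_mul_fourier hr ψ.integrable]

theorem hypothesisA_rosenheadKernel (hΓ : 0 < Γ) (hμ : 0 < μ) :
    HypothesisA (rosenheadKernel Γ μ) := by
  refine ⟨continuous_rosenheadKernel hμ, fun x => by simp [rosenheadKernel],
    rosenheadTransform Γ μ, isFourierTransform_rosenhead hΓ hμ, fun k => ?_,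
    integrable_rosenheadTransform hμ, ?_⟩
  · exact mul_nonneg (by positivity) (integral_nonneg fun r => gaussianMixture_nonneg _ _ _)
  · have := (integrable_weight_mul_gaussianMixture (δ := μ ^ 2)
      (by positivity)).integral_prod_right.const_mul (2 * Γ / √Real.pi)
    refine this.congr (Eventually.of_forall fun k => ?_)
    simp only [integral_const_mul, rosenheadTransform]
    ring

end Rosenhead

end VortexFilament

end

theorem mainTheorem1 :
    (∀ φ : VortexFilament.E3 → ℝ, VortexFilament.HypothesisA φ →
      ∀ γ₀ : ℝ → VortexFilament.E3, VortexFilament.MemH1Closed γ₀ →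
        ∃ γ : ℝ → ℝ → VortexFilament.E3,
          (∀ T : ℝ, 0 < T → VortexFilament.IsSolutionOn φ γ₀ T γ) ∧
          (∀ t : ℝ, 0 ≤ t → ∀ ξ : ℝ,
            HasDerivWithinAt (fun s => γ s ξ)
              (VortexFilament.velocity φ (γ t) (γ t ξ)) (Set.Ici 0) t) ∧
          (∀ T : ℝ, 0 < T → ∀ γ' : ℝ → ℝ → VortexFilament.E3,
            VortexFilament.IsSolutionOn φ γ₀ T γ' → ∀ t ∈ Set.Icc 0 T, γ' t = γ t)) ∧
    (∀ Γ μ : ℝ, 0 < Γ → 0 < μ →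
      VortexFilament.HypothesisA (VortexFilament.rosenheadKernel Γ μ)) := by
  refine ⟨fun φ hφ γ₀ hγ₀ => ?_, fun Γ μ hΓ hμ =>
    VortexFilament.hypothesisA_rosenheadKernel hΓ hμ⟩
  obtain ⟨ν, hν⟩ := hφ.exists_isSpectralMeasure
  exact hν.exists_global_solution hγ₀
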